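/- **Setting.** Let $d\ge 1$, $T>0$, and let $Q=\{(x,t)\in\mathbb R^{d}\times(0,T): x\in\Omega(t)\}$ be open, with $\overline Q=\bigcup_{i=1}^N\overline Q_i$ for pairwise disjoint patches $Q_i\subset Q$. Each patch is $Q_i=\Phi_i((0,1)^{d+1})$, where $\Phi_i=\sum_{\mathbf k} C_{\mathbf k}\widehat B_{\mathbf k}$ with control points $C_{\mathbf k}\in\mathbb R^{d+1}$ and tensor-product B-splines $\widehat B_{\mathbf k}$ (defined by the Cox–de Boor recursion from knot vectors in $[0,1]$, degrees $\ge 1$, continuously differentiable on $(0,1)$ in each variable), and $\Phi_i$ is bi-Lipschitz on $(0,1)^{d+1}$. Let $V_{h,i}=\operatorname{span}\{\widehat B_{\mathbf k}\circ\Phi_i^{-1}\}$. The mesh elements $K$ of $Q_i$ are the $\Phi_i$-images of the boxes between consecutive distinct knots, $h_K=\operatorname{diam}K$, $h_i=\max_K h_K$, and we assume $h_K\le h_i\le C_q h_K$ for all elements of all patches, with $C_q\ge1$. Let $\Sigma_0,\Sigma_T,\Sigma$ be the parts of $\partial Q$ with $t=0$, $t=T$, $0<t<T$. Let $V_{0h}$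 be the space of functions $v$ with $v|_{Q_i}\in V_{h,i}$ for all $i$ and $v=0$ on $\Sigma\cup\Sigma_0$. Derivatives are taken patchwise, and values on $\partial Q_i$ are traces from $Q_i$. Let $n_i=(n_{i,x},n_{i,t})$ be the outer unit normal of $Q_i$. For $i\ne j$ put $F_{ij}=\partial Q_i\cap\partial Q_j$. The set $\mathcal F_I$ of interior facets contains each of them under exactly one of its two names $F_{ij}$, $F_{ji}$; the sums over $\mathcal F_T$ run over $F_i=\partial Q_i\cap\Sigma_T$, $i=1,\dots,N$. On $F_{ij}\in\mathcal F_I$ set $[\![v]\!]_x=v_in_{i,x}+v_jn_{j,x}$, $[\![v]\!]_t=v_in_{i,t}+v_jn_{j,t}$, $\{v\}=\frac12(v_i+v_j)$, and $\{v\}^{up}=v_i$ where $n_{i,t}\ge0$, $\{v\}^{up}=v_j$ where $n_{i,t}<0$ (likewise for vector functions). For $\theta_i,\delta_1,\delta_2>0$ let $$\begin{aligned}a_h(u,v)=&\sum_{i=1}^N\int_{Q_i}\big(-u\,\partial_tv+\theta_ih_i\,\partial_tu\,\partial_tv+\nabla_xu\cdot\nabla_xv-\theta_ih_i\,\partial_t\nabla_xu\cdot\nabla_xv\big)\,dx\,dt\\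 &+\sum_{F_{ij}\in\mathcal F_I}\int_{F_{ij}}\{u\}^{up}[\![v]\!]_t\,ds+\sum_{F_i\in\mathcal F_T}\int_{F_i}uv\,ds+\sum_{F_i\in\mathcal F_T}\theta_ih_i\int_{F_i}\nabla_xu\cdot\nabla_xv\,ds\\ &+\sum_{F_{ij}\in\mathcal F_I}\theta_ih_i\int_{F_{ij}}\{\nabla_xu\}^{up}\cdot[\![\nabla_xv]\!]_t\,ds+\sum_{F_{ij}\in\mathcal F_I}\int_{F_{ij}}\big(-\{\nabla_xu\}\cdot[\![v]\!]_x+\{\nabla_xv\}\cdot[\![u]\!]_x\big)\,ds\\ &+\sum_{F_{ij}\in\mathcal F_I}\theta_ih_i\int_{F_{ij}}\big(-\{\nabla_xu\}\cdot[\![\partial_tv]\!]_x+\{\nabla_xv\}\cdot[\![\partial_tu]\!]_x\big)\,ds\\ &+\sum_{F_{ij}\in\mathcal F_I}\int_{F_{ij}}\Big(\frac{\delta_1}{h_i}[\![u]\!]_x\cdot[\![v]\!]_x+\delta_2\theta_ih_i[\![\partial_tu]\!]_x\cdot[\![\partial_tv]\!]_x\Big)\,ds\end{aligned}$$ and $$\begin{aligned}\|v\|_h^2=&\sum_{i=1}^N\big(\|\nabla_xv\|^2_{L_2(Q_i)}+\theta_ih_i\|\partial_tv\|^2_{L_2(Q_i)}\big)+\frac12\sum_{F_i\in\mathcal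 F_T}\|v\|^2_{L_2(F_i)}+\sum_{F_i\in\mathcal F_T}\frac{\theta_ih_i}2\|\nabla_xv\|^2_{L_2(F_i)}\\ &+\frac12\sum_{F_{ij}\in\mathcal F_I}\|[\![v]\!]_t\|^2_{L_2(F_{ij})}+\sum_{F_{ij}\in\mathcal F_I}\frac{\theta_ih_i}2\|[\![\nabla_xv]\!]_t\|^2_{L_2(F_{ij})}\\ &+\sum_{F_{ij}\in\mathcal F_I}\Big(\frac{\delta_1}{h_i}\|[\![v]\!]_x\|^2_{L_2(F_{ij})}+\delta_2\theta_ih_i\|[\![\partial_tv]\!]_x\|^2_{L_2(F_{ij})}\Big).\end{aligned}$$ **Lemma 4.** There is a constant $C_{inv,0,u}>0$ such that the inverse inequality $$\|w\|^2_{L_2(\partial Q_i)}\le C_{inv,0,u}\,h_i^{-1}\|w\|^2_{L_2(Q_i)}$$ holds for $w=v$ and for $w=\nabla_xv$, for all $v\in V_{h,i}$ and all $i=1,\dots,N$. Let $C_{inv,0,u}>0$ be any such constant, let $0<\theta_i\le(C_{inv,0,u}C_q)^{-1}$ for all $i$, and let $\delta_1,\delta_2>0$. Let the interior facets be named so that $\theta_ih_i\le2\,\theta_jh_j$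 for every $F_{ij}\in\mathcal F_I$ of positive surface measure (such names always exist; every choice is admissible if $\theta_ih_i$ is the same for all patches, or varies by a factor of at most 2 between neighbours). Then $$a_h(v_h,v_h)\ \ge\ \tfrac12\,\|v_h\|_h^2\qquad\text{for all }v_h\in V_{0h}.$$ -/

import Mathlib

open MeasureTheory

noncomputable section

namespace SpaceTimeIgA

/-! ### Points of space-time and derivatives -/

/-- Space-time `ℝ^{d+1}` with the Euclidean norm; the last coordinate is the time `t`. -/
abbrev Pt (d : ℕ) := EuclideanSpace ℝ (Fin (d + 1))

/-- Vectors in the spatial directions. -/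
abbrev Sp (d : ℕ) := EuclideanSpace ℝ (Fin d)

/-- The time component of a space-time vector. -/
def timePart {d : ℕ} (z : Pt d) : ℝ := z (Fin.last d)

/-- The spatial component of a space-time vector. -/
def spacePart {d : ℕ} (z : Pt d) : Sp d := WithLp.toLp 2 fun k => z k.castSucc

/-- The time derivative `∂_t v`. -/
def dt {d : ℕ} (v : Pt d → ℝ) (z : Pt d) : ℝ :=
  fderiv ℝ v z (EuclideanSpace.single (Fin.last d) 1)

/-- The spatial gradient `∇_x v`. -/
def gradX {d : ℕ} (v : Pt d → ℝ) (z : Pt d) : Sp d :=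
  WithLp.toLp 2 fun k => fderiv ℝ v z (EuclideanSpace.single k.castSucc 1)

/-- `∂_t ∇_x v`. For the functions considered below (`C^1` on a patch and smooth inside each mesh
element) the derivative exists off a null set and agrees there with the weak derivative. -/
def dtGradX {d : ℕ} (v : Pt d → ℝ) (z : Pt d) : Sp d :=
  WithLp.toLp 2 fun k => dt (fun y => gradX v y k) z

/-! ### B-splines -/

/-- Cox - de Boor recursion: `bspline ξ p i` is the `i`-th B-spline of degree `p` for the knots
`ξ 0 ≤ ξ 1 ≤ …`. A division by zero gives zero. -/
def bspline (ξ : ℕ → ℝ) : ℕ → ℕ → ℝ → ℝ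
  | 0, i, x => open Classical in if ξ i ≤ x ∧ x < ξ (i + 1) then 1 else 0
  | p + 1, i, x =>
      (x - ξ i) / (ξ (i + p + 1) - ξ i) * bspline ξ p i x
        + (ξ (i + p + 2) - x) / (ξ (i + p + 2) - ξ (i + 1)) * bspline ξ p (i + 1) x

/-- A knot vector `0 = ξ_0 ≤ ξ_1 ≤ … ≤ ξ_{n+p} = 1` with `n` B-splines of degree `p ≥ 1`
(the values `ξ_k` with `k > n + p` are never used), such that these B-splines are continuously
differentiable on `(0,1)`. -/
structure KnotVector where
  p : ℕ
  n : ℕ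
  knot : ℕ → ℝ
  one_le_p : 1 ≤ p
  mono : Monotone knot
  first : knot 0 = 0
  last : knot (n + p) = 1
  c1 : ∀ i < n, ContDiffOn ℝ 1 (bspline knot p i) (Set.Ioo 0 1)

/-- The open unit cube `(0,1)^m`. -/
def cube (m : ℕ) : Set (Fin m → ℝ) := Set.univ.pi fun _ => Set.Ioo 0 1

/-- The tensor product B-splines. -/
def tensorBasis {d : ℕ} (K : Fin (d + 1) → KnotVector) (i : (α : Fin (d + 1)) → Fin (K α).n)
    (ξ : Fin (d + 1) → ℝ) : ℝ :=
  ∏ α, bspline (K α).knot (K α).p (i α) (ξ α)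

/-- The map `Φ(ξ) = ∑_i C_i B_i(ξ)` with control points `C_i`. -/
def geoMap {d : ℕ} (K : Fin (d + 1) → KnotVector)
    (C : ((α : Fin (d + 1)) → Fin (K α).n) → Pt d) (ξ : Fin (d + 1) → ℝ) : Pt d :=
  ∑ i, tensorBasis K i ξ • C i

/-! ### Patches -/

/-- A patch: knot vectors in all `d + 1` directions and control points. The geometrical map is
regular, that is, bi-Lipschitz on the unit cube (it is Lipschitz since it is a `C^1` spline). -/
structure Patch (d : ℕ) where
  K : Fin (d + 1) → KnotVector
  control : ((α : Fin (d + 1)) → Fin (K α).n) → Pt d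
  regular : ∃ c > 0, ∀ ξ ∈ cube (d + 1), ∀ η ∈ cube (d + 1),
    c * dist ξ η ≤ dist (geoMap K control ξ) (geoMap K control η)

namespace Patch

variable {d : ℕ} (P : Patch d)

/-- The geometrical map `Φ` on the open cube. -/
def Φ : (Fin (d + 1) → ℝ) → Pt d := geoMap P.K P.control

/-- The open set `Φ((0,1)^{d+1})`. -/
def dom : Set (Pt d) := P.Φ '' cube (d + 1)

/-- The discrete space of the patch, the span of the `B_i ∘ Φ⁻¹`: functions whose restriction to
the patch is a linear combination of these (the values elsewhere do not matter). -/
def space : Set (Pt d → ℝ) :=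
  {v | ∃ c : ((α : Fin (d + 1)) → Fin (P.K α).n) → ℝ,
    ∀ ξ ∈ cube (d + 1), v (P.Φ ξ) = ∑ i, c i * tensorBasis P.K i ξ}

/-- The mesh elements: images of the boxes formed by consecutive distinct knots. -/
def mesh : Set (Set (Pt d)) :=
  {E | ∃ e : Fin (d + 1) → ℕ,
    (∀ α, e α < (P.K α).n + (P.K α).p ∧ (P.K α).knot (e α) < (P.K α).knot (e α + 1)) ∧
    E = P.Φ '' Set.univ.pi fun α => Set.Ioo ((P.K α).knot (e α)) ((P.K α).knot (e α + 1))}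

/-- The mesh size, i.e. the largest diameter of the (finitely many) mesh elements. -/
def h : ℝ := sSup (Metric.diam '' P.mesh)

/-- The trace: the continuous extension of `f` from the patch to its closure. -/
def trace {F : Type*} [TopologicalSpace F] (f : Pt d → F) : Pt d → F := extendFrom P.dom f

/-- `Φ`, extended continuously to the closed cube. -/
def Φbar : (Fin (d + 1) → ℝ) → Pt d := extendFrom (cube (d + 1)) P.Φ

/-- The Jacobian matrix of `Φ`, extended continuously to the closed cube. -/
def jac : (Fin (d + 1) → ℝ) → Matrix (Fin (d + 1)) (Fin (d + 1)) ℝ :=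
  extendFrom (cube (d + 1)) fun ξ => Matrix.of fun a b => fderiv ℝ P.Φ ξ (Pi.single b 1) a

/-- The covector `DΦ(ξ)^{-⊤} w`. -/
def pushCovector (ξ : Fin (d + 1) → ℝ) (w : Fin (d + 1) → ℝ) : Pt d :=
  WithLp.toLp 2 (((P.jac ξ)⁻¹).transpose.mulVec w)

/-- The point of the closed cube that `Φ` maps to `x`. -/
def param (x : Pt d) : Fin (d + 1) → ℝ := Function.invFunOn P.Φbar (Set.Icc 0 1) x

end Patch

/-- The outer normal of the unit cube at a point in the relative interior of a face. -/
def cubeNormal {m : ℕ} (ξ : Fin m → ℝ) : Fin m → ℝ :=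
  fun a => open Classical in if ξ a = 0 then -1 else if ξ a = 1 then 1 else 0

namespace Patch

variable {d : ℕ} (P : Patch d)

/-- The outer unit normal `n = DΦ^{-⊤} n̂ / |DΦ^{-⊤} n̂|` of the patch, at almost every point of
its boundary (all but the images of the lower-dimensional faces of the cube). -/
def normal (x : Pt d) : Pt d :=
  ‖P.pushCovector (P.param x) (cubeNormal (P.param x))‖⁻¹ •
    P.pushCovector (P.param x) (cubeNormal (P.param x))

/-- The time component `n_t` of the outer unit normal. -/
def nt (x : Pt d) : ℝ := timePart (P.normal x)

/-- The spatial component `n_x` of the outer unit normal. -/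
def nx (x : Pt d) : Sp d := spacePart (P.normal x)

/-- The surface measure `ds` on the boundary of the patch. The face `{ξ_k = s}` of the cube,
`s ∈ {0, 1}`, is parametrized by `y ∈ (0,1)^d`, and its image under `Φ` has the area element
`|det DΦ| |DΦ^{-⊤} e_k| dy`. -/
def surface : Measure (Pt d) :=
  ∑ k : Fin (d + 1), ∑ s : Fin 2,
    Measure.map (fun y : Fin d → ℝ => P.Φbar (k.insertNth (α := fun _ => ℝ) ((s : ℕ) : ℝ) y))
      ((volume.restrict (cube d)).withDensity fun y =>
        ENNReal.ofReal
          (|(P.jac (k.insertNth (α := fun _ => ℝ) ((s : ℕ) : ℝ) y)).det| *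
            ‖P.pushCovector (k.insertNth (α := fun _ => ℝ) ((s : ℕ) : ℝ) y) (Pi.single k 1)‖))

end Patch

/-! ### The multi-patch space-time domain -/

/-- The space-time domain `{(x,t) : 0 < t < T, x ∈ Ω(t)}`. -/
def cylinder {d : ℕ} (Ω : ℝ → Set (Sp d)) (T : ℝ) : Set (Pt d) :=
  {z | 0 < timePart z ∧ timePart z < T ∧ spacePart z ∈ Ω (timePart z)}

/-- A space-time domain `Q` with a moving spatial domain `Ω(t)`, decomposed into `N`
non-overlapping patches. -/
structure MultiPatch (d N : ℕ) where
  Ω : ℝ → Set (Sp d)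
  T : ℝ
  T_pos : 0 < T
  isOpen_cylinder : IsOpen (cylinder Ω T)
  patch : Fin N → Patch d
  subset : ∀ i, (patch i).dom ⊆ cylinder Ω T
  disjoint : ∀ i j, i ≠ j → Disjoint (patch i).dom (patch j).dom
  cover : closure (cylinder Ω T) = ⋃ i, closure (patch i).dom

namespace MultiPatch

variable {d N : ℕ} (M : MultiPatch d N)

/-- The space-time domain. -/
def Q : Set (Pt d) := cylinder M.Ω M.T

/-- The bottom `Σ_0` of the space-time domain. -/
def bottom : Set (Pt d) := {z ∈ frontier M.Q | timePart z = 0}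

/-- The top `Σ_T` of the space-time domain. -/
def top : Set (Pt d) := {z ∈ frontier M.Q | timePart z = M.T}

/-- The lateral boundary `Σ` of the space-time domain. -/
def lateral : Set (Pt d) := {z ∈ frontier M.Q | 0 < timePart z ∧ timePart z < M.T}

/-- The mesh size `h_i`. -/
def h (i : Fin N) : ℝ := (M.patch i).h

/-- Quasi-uniformity: `h_K ≤ h_i ≤ C_q h_K` for all elements `K` of all patches. -/
def QuasiUniform (Cq : ℝ) : Prop :=
  ∀ i, ∀ E ∈ (M.patch i).mesh, Metric.diam E ≤ M.h i ∧ M.h i ≤ Cq * Metric.diam E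

/-- The discrete space `V_{0h}`: in `V_{h,i}` on each patch, and zero on `Σ ∪ Σ_0`. -/
def V0 : Set (Pt d → ℝ) :=
  {v | ∀ i, v ∈ (M.patch i).space ∧
    ∀ᵐ x ∂(M.patch i).surface.restrict (M.lateral ∪ M.bottom), (M.patch i).trace v x = 0}

/-- `C` is a constant in the inverse inequality
`‖w‖²_{L_2(∂Q_i)} ≤ C h_i⁻¹ ‖w‖²_{L_2(Q_i)}`, for the discrete functions `w = v` and for their
spatial gradients `w = ∇_x v`, on all patches. -/
def InverseConst (C : ℝ) : Prop :=
  ∀ i, ∀ v ∈ (M.patch i).space,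
    (∫ x, (M.patch i).trace v x ^ 2 ∂(M.patch i).surface
      ≤ C * (M.h i)⁻¹ * ∫ x in (M.patch i).dom, v x ^ 2) ∧
    (∫ x, ‖(M.patch i).trace (gradX v) x‖ ^ 2 ∂(M.patch i).surface
      ≤ C * (M.h i)⁻¹ * ∫ x in (M.patch i).dom, ‖gradX v x‖ ^ 2)

/-! ### Facets, jumps and averages -/

/-- The interior facet `F_{ij} = ∂Q_i ∩ ∂Q_j`. -/
def facet (i j : Fin N) : Set (Pt d) := frontier (M.patch i).dom ∩ frontier (M.patch j).dom

/-- The facet of `Q_i` on the top `Σ_T`. -/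
def facetTop (i : Fin N) : Set (Pt d) := frontier (M.patch i).dom ∩ M.top

/-- The jump in space direction `v_i n_{i,x} + v_j n_{j,x}` of a scalar function. -/
def jumpX (i j : Fin N) (v : Pt d → ℝ) (x : Pt d) : Sp d :=
  (M.patch i).trace v x • (M.patch i).nx x + (M.patch j).trace v x • (M.patch j).nx x

/-- The jump in time direction `v_i n_{i,t} + v_j n_{j,t}` of a scalar or vector function. -/
def jumpT {F : Type*} [TopologicalSpace F] [AddCommGroup F] [Module ℝ F]
    (i j : Fin N) (v : Pt d → F) (x : Pt d) : F :=
  (M.patch i).nt x • (M.patch i).trace v x + (M.patch j).nt x • (M.patch j).trace v x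

/-- The average `(v_i + v_j) / 2`. -/
def avg {F : Type*} [TopologicalSpace F] [AddCommGroup F] [Module ℝ F]
    (i j : Fin N) (v : Pt d → F) (x : Pt d) : F :=
  (1 / 2 : ℝ) • ((M.patch i).trace v x + (M.patch j).trace v x)

/-- The upwind value in time: `v_i` where `n_{i,t} ≥ 0`, and `v_j` where `n_{i,t} < 0`. -/
def up {F : Type*} [TopologicalSpace F] (i j : Fin N) (v : Pt d → F) (x : Pt d) : F :=
  open Classical in
  if 0 ≤ (M.patch i).nt x then (M.patch i).trace v x else (M.patch j).trace v x

/-- The integral over the interior facet `F_{ij}`. -/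
def facetInt (i j : Fin N) (f : Pt d → ℝ) : ℝ :=
  ∫ x in M.facet i j, f x ∂(M.patch i).surface

/-- The integral over the facet of `Q_i` on `Σ_T`. -/
def topInt (i : Fin N) (f : Pt d → ℝ) : ℝ :=
  ∫ x in M.facetTop i, f x ∂(M.patch i).surface

/-- The interior facets as a list of labelled pairs: of the two names `F_{ij}` and `F_{ji}` of one
facet exactly one is in the list (pairs of patches that do not meet contribute nothing). -/
def IsLabelling (I : Finset (Fin N × Fin N)) : Prop :=
  (∀ i, (i, i) ∉ I) ∧ ∀ i j, i ≠ j → Xor ((i, j) ∈ I) ((j, i) ∈ I)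

/-! ### The bilinear form and the norm -/

/-- The discrete bilinear form `a_h(u, v)`. -/
def aForm (I : Finset (Fin N × Fin N)) (θ : Fin N → ℝ) (δ₁ δ₂ : ℝ) (u v : Pt d → ℝ) : ℝ :=
  (∑ i, ∫ x in (M.patch i).dom,
      (-(u x * dt v x) + θ i * M.h i * (dt u x * dt v x) + inner ℝ (gradX u x) (gradX v x)
        - θ i * M.h i * inner ℝ (dtGradX u x) (gradX v x)))
  + (∑ F ∈ I, M.facetInt F.1 F.2 fun x => M.up F.1 F.2 u x * M.jumpT F.1 F.2 v x)
  + (∑ i, M.topInt i fun x => (M.patch i).trace u x * (M.patch i).trace v x)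
  + (∑ i, θ i * M.h i * M.topInt i fun x =>
      inner ℝ ((M.patch i).trace (gradX u) x) ((M.patch i).trace (gradX v) x))
  + (∑ F ∈ I, θ F.1 * M.h F.1 * M.facetInt F.1 F.2 fun x =>
      inner ℝ (M.up F.1 F.2 (gradX u) x) (M.jumpT F.1 F.2 (gradX v) x))
  + (∑ F ∈ I, M.facetInt F.1 F.2 fun x =>
      -inner ℝ (M.avg F.1 F.2 (gradX u) x) (M.jumpX F.1 F.2 v x)
        + inner ℝ (M.avg F.1 F.2 (gradX v) x) (M.jumpX F.1 F.2 u x))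
  + (∑ F ∈ I, θ F.1 * M.h F.1 * M.facetInt F.1 F.2 fun x =>
      -inner ℝ (M.avg F.1 F.2 (gradX u) x) (M.jumpX F.1 F.2 (dt v) x)
        + inner ℝ (M.avg F.1 F.2 (gradX v) x) (M.jumpX F.1 F.2 (dt u) x))
  + (∑ F ∈ I, M.facetInt F.1 F.2 fun x =>
      δ₁ / M.h F.1 * inner ℝ (M.jumpX F.1 F.2 u x) (M.jumpX F.1 F.2 v x)
        + δ₂ * θ F.1 * M.h F.1 *
          inner ℝ (M.jumpX F.1 F.2 (dt u) x) (M.jumpX F.1 F.2 (dt v) x))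

/-- The square of the discrete norm. -/
def normSq (I : Finset (Fin N × Fin N)) (θ : Fin N → ℝ) (δ₁ δ₂ : ℝ) (v : Pt d → ℝ) : ℝ :=
  (∑ i, ((∫ x in (M.patch i).dom, ‖gradX v x‖ ^ 2)
      + θ i * M.h i * ∫ x in (M.patch i).dom, dt v x ^ 2))
  + 1 / 2 * (∑ i, M.topInt i fun x => (M.patch i).trace v x ^ 2)
  + (∑ i, θ i * M.h i / 2 * M.topInt i fun x => ‖(M.patch i).trace (gradX v) x‖ ^ 2)
  + 1 / 2 * (∑ F ∈ I, M.facetInt F.1 F.2 fun x => M.jumpT F.1 F.2 v x ^ 2)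
  + (∑ F ∈ I, θ F.1 * M.h F.1 / 2 * M.facetInt F.1 F.2 fun x =>
      ‖M.jumpT F.1 F.2 (gradX v) x‖ ^ 2)
  + (∑ F ∈ I,
      (δ₁ / M.h F.1 * (M.facetInt F.1 F.2 fun x => ‖M.jumpX F.1 F.2 v x‖ ^ 2)
        + δ₂ * θ F.1 * M.h F.1 *
          M.facetInt F.1 F.2 fun x => ‖M.jumpX F.1 F.2 (dt v) x‖ ^ 2))

/-- The discrete norm `‖v‖_h`. -/
def dgNorm (I : Finset (Fin N × Fin N)) (θ : Fin N → ℝ) (δ₁ δ₂ : ℝ) (v : Pt d → ℝ) : ℝ :=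
  Real.sqrt (M.normSq I θ δ₁ δ₂ v)

end MultiPatch

end SpaceTimeIgA

end

/-!
Testing with `v = v_h` makes the terms of `a_h` that are skew on interior facets cancel, and the
stabilization terms are exactly those of the norm. In the volume, `-v ∂_t v` and
`-θ_i h_i ∂_t ∇_x v · ∇_x v` are time derivatives of `-v² / 2` and `-θ_i h_i ‖∇_x v‖² / 2`, so the
divergence theorem on the patch moves them to its boundary (`Patch.integral_volume_terms`). On an
interior facet the two boundary terms, together with the upwind flux, form the square of the jump
(`inner_upwind`, `MultiPatch.facet_upwind_estimate`). For `v` this is all: on the rest of the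
boundary `v` vanishes except on the top, where a part of the top term of `a_h` pays. For `∇_x v` the
weights `κ_i = θ_i h_i` of two neighbours differ, and `∇_x v` need not vanish on the lateral
boundary. Since `κ_i ≤ 2 κ_j`, the loss is at most `κ_i / 2` times the square of the `L²` norm of
`∇_x v` on the boundary of each patch (`MultiPatch.facet_weighted_estimate`,
`MultiPatch.sum_boundary_le`), and the inverse inequality with `θ_i ≤ (C C_q)⁻¹` bounds it by half
of `‖∇_x v‖²` on the patch (`MultiPatch.absorb_boundary_gradient`).

The geometric facts behind this rest on one observation: a B-spline that is `C^1` on `(0,1)`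
is piecewise polynomial and extends to a `C^1` function on the line
(`PiecewisePoly.exists_extension`). Hence the geometrical map of a patch is the restriction of a
`C^1` map of the whole space that is bi-Lipschitz on the closed cube, and all traces are continuous.

* The divergence theorem on a patch (`Patch.integral_dom_eq_integral_surface`) is pulled back to the
  cube. The fields there are only Lipschitz, so it is proved by Fubini and the fundamental theorem
  of calculus along lines, combined with the Piola identity (`piola_identity`). Only
  mixed second derivatives of the map enter the latter; the pure ones need not exist on finitely
  many hyperplanes, which the lines cross in finitely many points.
* Two disjoint patches have opposite normals where the open faces of their boundaries meet
  (`Patch.normal_eq_neg`), since otherwise a direction would enter both. With this, the change of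
  variables for the transition map shows that both sides induce the same surface measure on a
  facet (`Patch.restrict_surface_facet_eq`). Three normals cannot be opposite in pairs, so
  interior facets do not overlap (`MultiPatch.notMem_facet_of_mem`).
* Edges and corners form a null set for every surface measure, by comparison with the
  Hausdorff measure (`Patch.surface_frontier_diff_eq_zero`). A regular boundary point on no interior
  facet lies on the boundary of the space-time domain (`MultiPatch.mem_frontier_Q`).

The inverse inequality holds because the discrete spaces are finite-dimensional: the maximum over
the closed patch is bounded by the `L²` norm (`exists_sq_norm_le_integral`).
-/

noncomputable section

namespace SpaceTimeIgA

open Set Filter Topology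

/-! ### Extended B-splines -/

/-- Piecewise polynomial functions with finitely many breakpoints and finitely many pieces. The
pieces are collected in one finite set of polynomials, so that bounds are uniform in the piece. -/
def PiecewisePoly (f : ℝ → ℝ) : Prop :=
  ∃ S : Set ℝ, S.Finite ∧ ∃ A : Set (Polynomial ℝ), A.Finite ∧
    ∀ a b, a < b → Disjoint (Ioo a b) S → ∃ P ∈ A, EqOn f (fun x => P.eval x) (Ioo a b)

theorem PiecewisePoly.polynomial (P : Polynomial ℝ) : PiecewisePoly fun x => P.eval x :=
  ⟨∅, finite_empty, {P}, finite_singleton P, fun _ _ _ _ => ⟨P, rfl, fun _ _ => rfl⟩⟩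

theorem PiecewisePoly.mul {f g : ℝ → ℝ} (hf : PiecewisePoly f) (hg : PiecewisePoly g) :
    PiecewisePoly fun x => f x * g x := by
  obtain ⟨S, hS, A, hA, h⟩ := hf
  obtain ⟨S', hS', A', hA', h'⟩ := hg
  refine ⟨S ∪ S', hS.union hS', image2 (· * ·) A A', hA.image2 _ hA', fun a b hab hd => ?_⟩
  obtain ⟨P, hP, e⟩ := h a b hab (hd.mono_right subset_union_left)
  obtain ⟨P', hP', e'⟩ := h' a b hab (hd.mono_right subset_union_right)
  refine ⟨P * P', mem_image2_of_mem hP hP', fun x hx => ?_⟩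
  simp [e hx, e' hx]

theorem PiecewisePoly.add {f g : ℝ → ℝ} (hf : PiecewisePoly f) (hg : PiecewisePoly g) :
    PiecewisePoly fun x => f x + g x := by
  obtain ⟨S, hS, A, hA, h⟩ := hf
  obtain ⟨S', hS', A', hA', h'⟩ := hg
  refine ⟨S ∪ S', hS.union hS', image2 (· + ·) A A', hA.image2 _ hA', fun a b hab hd => ?_⟩
  obtain ⟨P, hP, e⟩ := h a b hab (hd.mono_right subset_union_left)
  obtain ⟨P', hP', e'⟩ := h' a b hab (hd.mono_right subset_union_right)
  refine ⟨P + P', mem_image2_of_mem hP hP', fun x hx => ?_⟩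
  simp [e hx, e' hx]

theorem piecewisePoly_bspline (ξ : ℕ → ℝ) (p i : ℕ) : PiecewisePoly (bspline ξ p i) := by
  induction p generalizing i with
  | zero =>
    refine ⟨{ξ i, ξ (i + 1)}, by simp, {0, 1}, by simp, fun a b hab hd => ?_⟩
    have h1 : ξ i ∉ Ioo a b := fun h => disjoint_left.1 hd h (by simp)
    have h2 : ξ (i + 1) ∉ Ioo a b := fun h => disjoint_left.1 hd h (by simp)
    simp only [mem_Ioo, not_and, not_lt] at h1 h2
    by_cases hc : ξ i ≤ a ∧ b ≤ ξ (i + 1)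
    · refine ⟨1, by simp, fun x hx => ?_⟩
      have : ξ i ≤ x ∧ x < ξ (i + 1) := ⟨hc.1.trans hx.1.le, hx.2.trans_le hc.2⟩
      simp [bspline, this]
    · refine ⟨0, by simp, fun x hx => ?_⟩
      have : ¬ (ξ i ≤ x ∧ x < ξ (i + 1)) := by
        rintro ⟨h3, h4⟩
        refine hc ⟨?_, h2 (hx.1.trans h4)⟩
        by_contra! h5
        exact absurd (h1 h5) (not_le.2 (h3.trans_lt hx.2))
      simp [bspline, this]
  | succ p ih =>
    have l1 : PiecewisePoly fun x => (x - ξ i) / (ξ (i + p + 1) - ξ i) := by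
      convert PiecewisePoly.polynomial
        (Polynomial.C (ξ (i + p + 1) - ξ i)⁻¹ * (Polynomial.X - Polynomial.C (ξ i))) using 2
      simp [div_eq_inv_mul]
    have l2 : PiecewisePoly fun x => (ξ (i + p + 2) - x) / (ξ (i + p + 2) - ξ (i + 1)) := by
      convert PiecewisePoly.polynomial (Polynomial.C (ξ (i + p + 2) - ξ (i + 1))⁻¹ *
        (Polynomial.C (ξ (i + p + 2)) - Polynomial.X)) using 2
      simp [div_eq_inv_mul]
    exact (l1.mul (ih i)).add (l2.mul (ih (i + 1)))

/-- A piecewise polynomial function that is `C^1` on `(0,1)` extends to a `C^1` function on the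
line: near the end points, the first and the last polynomial piece are continued. -/
theorem PiecewisePoly.exists_extension {f : ℝ → ℝ} (hf : PiecewisePoly f)
    (h1 : ContDiffOn ℝ 1 f (Ioo 0 1)) :
    ∃ g : ℝ → ℝ, ContDiff ℝ 1 g ∧ EqOn g f (Ioo 0 1) ∧
      (∃ S : Set ℝ, S.Finite ∧ ∀ x ∉ S, DifferentiableAt ℝ (deriv g) x) ∧
      ∃ B, ∀ x ∈ Icc (0 : ℝ) 1, |deriv (deriv g) x| ≤ B := by
  obtain ⟨S, hS, A, hA, h⟩ := hf
  obtain ⟨a, ha0, ha1, had⟩ : ∃ a, 0 < a ∧ a < 1 ∧ Disjoint (Ioo 0 a) S := by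
    have : ∀ᶠ a in 𝓝[>] (0 : ℝ), a ∈ (S \ {0})ᶜ :=
      (hS.subset sdiff_subset).isClosed.isOpen_compl.mem_nhds (by simp) |> nhdsWithin_le_nhds
    obtain ⟨u, hu, hu'⟩ := (mem_nhdsGT_iff_exists_Ioo_subset).1 this
    refine ⟨min u (1 / 2), by simp at hu; positivity,
      (min_le_right _ _).trans_lt (by norm_num), disjoint_left.2 fun x hx hxS => ?_⟩
    exact hu' ⟨hx.1, hx.2.trans_le (min_le_left _ _)⟩ ⟨hxS, hx.1.ne'⟩
  obtain ⟨b, hb0, hb1, hbd⟩ : ∃ b, 0 < b ∧ b < 1 ∧ Disjoint (Ioo b 1) S := by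
    have : ∀ᶠ a in 𝓝[<] (1 : ℝ), a ∈ (S \ {1})ᶜ :=
      (hS.subset sdiff_subset).isClosed.isOpen_compl.mem_nhds (by simp) |> nhdsWithin_le_nhds
    obtain ⟨u, hu, hu'⟩ := (mem_nhdsLT_iff_exists_Ioo_subset).1 this
    refine ⟨max u (1 / 2), by positivity, max_lt hu (by norm_num),
      disjoint_left.2 fun x hx hxS => ?_⟩
    exact hu' ⟨(le_max_left _ _).trans_lt hx.1, hx.2⟩ ⟨hxS, hx.2.ne⟩
  obtain ⟨P, hP, eP⟩ := h 0 a ha0 had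
  obtain ⟨R, hR, eR⟩ := h b 1 hb1 hbd
  set g : ℝ → ℝ := fun x => if x ≤ 0 then P.eval x else if 1 ≤ x then R.eval x else f x with hg
  have g1 : EqOn g (fun x => P.eval x) (Iio a) := by
    intro x hx
    by_cases hx0 : x ≤ 0
    · simp [hg, hx0]
    · have : ¬ 1 ≤ x := by simp only [mem_Iio] at hx; linarith
      simp only [hg, hx0, this, if_false]
      exact eP ⟨not_le.1 hx0, hx⟩
  have g2 : EqOn g f (Ioo 0 1) := by
    intro x hx
    simp [hg, not_le.2 hx.1, not_le.2 hx.2]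
  have g3 : EqOn g (fun x => R.eval x) (Ioi b) := by
    intro x hx
    have hx' : b < x := hx
    by_cases hx0 : 1 ≤ x
    · simp [hg, hx0, not_le.2 (lt_of_lt_of_le one_pos hx0)]
    · simp only [hg, hx0, if_false, not_le.2 (hb0.trans hx')]
      exact eR ⟨hx, not_le.1 hx0⟩
  have loc : ∀ x, x ∉ S → ∃ P ∈ A, g =ᶠ[𝓝 x] fun x => P.eval x := by
    intro x hx
    rcases lt_or_ge x a with hxa | hxa
    · exact ⟨P, hP, eventually_of_mem (Iio_mem_nhds hxa) g1⟩
    rcases lt_or_ge b x with hxb | hxb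
    · exact ⟨R, hR, eventually_of_mem (Ioi_mem_nhds hxb) g3⟩
    have : Sᶜ ∩ Ioo 0 1 ∈ 𝓝 x := inter_mem (hS.isClosed.isOpen_compl.mem_nhds hx)
      (Ioo_mem_nhds (ha0.trans_le hxa) (hxb.trans_lt hb1))
    obtain ⟨l, u, hlu, hsub⟩ := mem_nhds_iff_exists_Ioo_subset.1 this
    obtain ⟨Z, hZ, eZ⟩ := h l u (hlu.1.trans hlu.2)
      (disjoint_left.2 fun y hy hyS => (hsub hy).1 hyS)
    refine ⟨Z, hZ, eventually_of_mem (Ioo_mem_nhds hlu.1 hlu.2) fun y hy => ?_⟩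
    exact (g2 (hsub hy).2).trans (eZ hy)
  have dpoly : ∀ (P : Polynomial ℝ), deriv (fun x => P.eval x) = fun x => P.derivative.eval x :=
    fun P => funext fun x => P.deriv
  refine ⟨g, contDiff_iff_contDiffAt.2 fun x => ?_, g2, ⟨S, hS, fun x hx => ?_⟩, ?_⟩
  · rcases lt_or_ge x a with hxa | hxa
    · exact (P.contDiff_aeval (𝕜 := ℝ) 1).contDiffAt.congr_of_eventuallyEq
        (eventually_of_mem (Iio_mem_nhds hxa) g1)
    rcases lt_or_ge b x with hxb | hxb
    · exact (R.contDiff_aeval (𝕜 := ℝ) 1).contDiffAt.congr_of_eventuallyEq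
        (eventually_of_mem (Ioi_mem_nhds hxb) g3)
    have : Ioo (0 : ℝ) 1 ∈ 𝓝 x := Ioo_mem_nhds (ha0.trans_le hxa) (hxb.trans_lt hb1)
    exact (h1.contDiffAt this).congr_of_eventuallyEq (eventually_of_mem this g2)
  · obtain ⟨Z, -, eZ⟩ := loc x hx
    have := eZ.deriv
    rw [dpoly] at this
    exact Z.derivative.differentiableAt.congr_of_eventuallyEq this
  · have hfin : (A.image fun Z : Polynomial ℝ => Z.derivative.derivative).Finite := hA.image _
    have hb : ∀ Z : Polynomial ℝ, ∃ B, ∀ x ∈ Icc (0 : ℝ) 1, |Z.eval x| ≤ B := fun Z => by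
      obtain ⟨B, hB⟩ := isCompact_Icc.exists_bound_of_continuousOn (Z.continuousOn (s := Icc 0 1))
      exact ⟨B, hB⟩
    choose B hB using hb
    obtain ⟨M, hM⟩ := (hfin.image B).bddAbove
    obtain ⟨M', hM'⟩ := (hS.image fun x => |deriv (deriv g) x|).bddAbove
    refine ⟨max M M', fun x hx => ?_⟩
    -- Off `S` the second derivative is that of one of finitely many polynomials; on `S` it may be
    -- a junk value, but `S` is finite.
    by_cases hxS : x ∈ S
    · exact (hM' (mem_image_of_mem _ hxS)).trans (le_max_right _ _)
    · obtain ⟨Z, hZ, eZ⟩ := loc x hxS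
      have e1 := eZ.deriv
      rw [dpoly] at e1
      have e2 := e1.deriv_eq
      rw [dpoly] at e2
      rw [e2]
      exact (hB _ x hx).trans ((hM (mem_image_of_mem _ (mem_image_of_mem _ hZ))).trans
        (le_max_left _ _))

namespace KnotVector

theorem exists_ext (K : KnotVector) (i : Fin K.n) :
    ∃ g : ℝ → ℝ, ContDiff ℝ 1 g ∧ EqOn g (bspline K.knot K.p i) (Ioo 0 1) ∧
      (∃ S : Set ℝ, S.Finite ∧ ∀ x ∉ S, DifferentiableAt ℝ (deriv g) x) ∧
      ∃ B, ∀ x ∈ Icc (0 : ℝ) 1, |deriv (deriv g) x| ≤ B :=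
  (piecewisePoly_bspline _ _ _).exists_extension (K.c1 i i.2)

/-- A `C^1` extension of the `i`-th B-spline from `(0,1)` to the real line. -/
def ext (K : KnotVector) (i : Fin K.n) : ℝ → ℝ := (K.exists_ext i).choose

theorem contDiff_ext (K : KnotVector) (i : Fin K.n) : ContDiff ℝ 1 (K.ext i) :=
  (K.exists_ext i).choose_spec.1

theorem ext_eq (K : KnotVector) (i : Fin K.n) :
    EqOn (K.ext i) (bspline K.knot K.p i) (Ioo 0 1) :=
  (K.exists_ext i).choose_spec.2.1

/-- A finite set that contains the breakpoints of all the extended B-splines of `K`. -/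
def breaks (K : KnotVector) : Set ℝ :=
  ⋃ i : Fin K.n, (K.exists_ext i).choose_spec.2.2.1.choose

theorem finite_breaks (K : KnotVector) : K.breaks.Finite :=
  finite_iUnion fun i => (K.exists_ext i).choose_spec.2.2.1.choose_spec.1

theorem differentiableAt_deriv_ext (K : KnotVector) (i : Fin K.n) {x : ℝ} (hx : x ∉ K.breaks) :
    DifferentiableAt ℝ (deriv (K.ext i)) x :=
  (K.exists_ext i).choose_spec.2.2.1.choose_spec.2 x fun h => hx (mem_iUnion.2 ⟨i, h⟩)

theorem continuous_iteratedDeriv_ext (K : KnotVector) (i : Fin K.n) {m : ℕ} (hm : m ≤ 1) :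
    Continuous (iteratedDeriv m (K.ext i)) :=
  (K.contDiff_ext i).continuous_iteratedDeriv m (by exact_mod_cast hm)

theorem bounded_iteratedDeriv_ext (K : KnotVector) (i : Fin K.n) {m : ℕ} (hm : m ≤ 2) :
    ∃ B, ∀ x ∈ Icc (0 : ℝ) 1, |iteratedDeriv m (K.ext i) x| ≤ B := by
  rcases Nat.lt_or_ge 1 m with h | h
  · obtain rfl : m = 2 := by omega
    simp only [iteratedDeriv_succ, iteratedDeriv_zero]
    exact (K.exists_ext i).choose_spec.2.2.2
  · exact isCompact_Icc.exists_bound_of_continuousOn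
      (K.continuous_iteratedDeriv_ext i h).continuousOn

theorem hasDerivAt_iteratedDeriv_ext (K : KnotVector) (i : Fin K.n) {m : ℕ} {x : ℝ}
    (hm : m = 0 ∨ m = 1 ∧ x ∉ K.breaks) :
    HasDerivAt (iteratedDeriv m (K.ext i)) (iteratedDeriv (m + 1) (K.ext i) x) x := by
  rw [iteratedDeriv_succ]
  refine DifferentiableAt.hasDerivAt ?_
  rcases hm with rfl | ⟨rfl, hx⟩
  · simpa using (K.contDiff_ext i).differentiable (by simp) x
  · simpa [iteratedDeriv_succ] using K.differentiableAt_deriv_ext i hx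

end KnotVector

/-! ### Tensor product splines and their partial derivatives -/

section TensorProduct

variable {d : ℕ}

/-- The partial derivative of order `m α` in the direction `α`, for all `α`, of the extended tensor
product spline with the coefficients `c`. -/
def splD (K : Fin (d + 1) → KnotVector) (m : Fin (d + 1) → ℕ)
    (c : ((α : Fin (d + 1)) → Fin (K α).n) → ℝ) (ξ : Fin (d + 1) → ℝ) : ℝ :=
  ∑ i, c i * ∏ α, iteratedDeriv (m α) ((K α).ext (i α)) (ξ α)

variable (K : Fin (d + 1) → KnotVector) (c : ((α : Fin (d + 1)) → Fin (K α).n) → ℝ)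

theorem splD_zero {ξ : Fin (d + 1) → ℝ} (hξ : ξ ∈ cube (d + 1)) :
    splD K 0 c ξ = ∑ i, c i * tensorBasis K i ξ := by
  refine Finset.sum_congr rfl fun i _ => ?_
  rw [tensorBasis]
  congr 1
  refine Finset.prod_congr rfl fun α _ => ?_
  simpa using (K α).ext_eq (i α) (hξ α (mem_univ α))

theorem continuous_splD {m : Fin (d + 1) → ℕ} (hm : ∀ α, m α ≤ 1) : Continuous (splD K m c) :=
  continuous_finsetSum _ fun i _ => continuous_const.mul <| continuous_finsetProd _ fun α _ =>
    ((K α).continuous_iteratedDeriv_ext (i α) (hm α)).comp (continuous_apply α)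

theorem bounded_splD {m : Fin (d + 1) → ℕ} (hm : ∀ α, m α ≤ 2) :
    ∃ B, ∀ ξ ∈ Icc (0 : Fin (d + 1) → ℝ) 1, |splD K m c ξ| ≤ B := by
  choose B hB using fun (i : (α : Fin (d + 1)) → Fin (K α).n) (α : Fin (d + 1)) =>
    (K α).bounded_iteratedDeriv_ext (i α) (hm α)
  refine ⟨∑ i, |c i| * ∏ α, B i α, fun ξ hξ => (Finset.abs_sum_le_sum_abs _ _).trans <|
    Finset.sum_le_sum fun i _ => ?_⟩
  rw [abs_mul, Finset.abs_prod]
  gcongr with α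
  exact hB i α _ ⟨hξ.1 α, hξ.2 α⟩

theorem hasFDerivAt_splD {m : Fin (d + 1) → ℕ} {ξ : Fin (d + 1) → ℝ}
    (hm : ∀ α, m α = 0 ∨ m α = 1 ∧ ξ α ∉ (K α).breaks) :
    HasFDerivAt (splD K m c)
      (∑ a, splD K (m + Pi.single a 1) c ξ •
        ContinuousLinearMap.proj (R := ℝ) (φ := fun _ : Fin (d + 1) => ℝ) a) ξ := by
  have key : ∀ i : (α : Fin (d + 1)) → Fin (K α).n, HasFDerivAt
      (fun ξ : Fin (d + 1) → ℝ => c i * ∏ α, iteratedDeriv (m α) ((K α).ext (i α)) (ξ α))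
      (c i • ∑ a, (∏ α ∈ Finset.univ.erase a, iteratedDeriv (m α) ((K α).ext (i α)) (ξ α)) •
        iteratedDeriv (m a + 1) ((K a).ext (i a)) (ξ a) •
          ContinuousLinearMap.proj (R := ℝ) (φ := fun _ : Fin (d + 1) => ℝ) a) ξ := by
    intro i
    refine HasFDerivAt.const_mul (HasFDerivAt.finsetProd fun a _ => ?_) _
    exact ((K a).hasDerivAt_iteratedDeriv_ext (i a) (hm a)).comp_hasFDerivAt
      (f := fun ξ : Fin (d + 1) → ℝ => ξ a) ξ (hasFDerivAt_apply a ξ)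
  refine (HasFDerivAt.fun_sum fun i _ => key i).congr_fderiv ?_
  simp only [Finset.smul_sum, splD, Finset.sum_smul]
  rw [Finset.sum_comm]
  refine Finset.sum_congr rfl fun a _ => Finset.sum_congr rfl fun i _ => ?_
  rw [smul_smul, smul_smul]
  congr 1
  rw [mul_assoc, ← Finset.prod_erase_mul _ _ (Finset.mem_univ a)]
  congr 2
  · refine Finset.prod_congr rfl fun α hα => ?_
    simp [(Finset.mem_erase.1 hα).1]
  · simp

end TensorProduct

/-! ### Integration by parts on the unit cube -/

theorem isOpen_cube (m : ℕ) : IsOpen (cube m) := isOpen_set_pi finite_univ fun _ _ => isOpen_Ioo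

theorem closure_cube (m : ℕ) : closure (cube m) = Icc 0 1 := by
  rw [cube, closure_pi_set, ← pi_univ_Icc]
  simp [closure_Ioo]

theorem cube_subset_Icc (m : ℕ) : cube m ⊆ Icc 0 1 := closure_cube m ▸ subset_closure

theorem volume_cube_ne_top (m : ℕ) : volume (cube m) ≠ ⊤ :=
  ((measure_mono (cube_subset_Icc m)).trans_lt isCompact_Icc.measure_lt_top).ne

theorem insertNth_mem_cube {d : ℕ} {a : Fin (d + 1)} {t : ℝ} {y : Fin d → ℝ} :
    a.insertNth (α := fun _ => ℝ) t y ∈ cube (d + 1) ↔ t ∈ Ioo (0 : ℝ) 1 ∧ y ∈ cube d := by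
  simp only [cube, mem_univ_pi, Fin.forall_iff_succAbove a, Fin.insertNth_apply_same,
    Fin.insertNth_apply_succAbove]

theorem insertNth_mem_Icc_iff {d : ℕ} {a : Fin (d + 1)} {t : ℝ} {y : Fin d → ℝ} :
    a.insertNth (α := fun _ => ℝ) t y ∈ Icc (0 : Fin (d + 1) → ℝ) 1 ↔
      t ∈ Icc (0 : ℝ) 1 ∧ y ∈ Icc (0 : Fin d → ℝ) 1 := by
  simp only [← pi_univ_Icc, mem_univ_pi, Fin.forall_iff_succAbove a, Fin.insertNth_apply_same,
    Fin.insertNth_apply_succAbove, Pi.zero_apply, Pi.one_apply]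

theorem ae_notMem_countable {m : ℕ} {B : Fin m → Set ℝ} (hB : ∀ α, (B α).Countable) :
    ∀ᵐ ξ : Fin m → ℝ, ∀ α, ξ α ∉ B α := by
  refine ae_all_iff.2 fun α => ?_
  have h : ∀ᵐ t : ℝ, t ∉ B α := (hB α).ae_notMem volume
  exact (Measure.quasiMeasurePreserving_eval (fun _ : Fin m => (volume : Measure ℝ)) α).ae h

theorem continuous_insertNth_left {d : ℕ} (a : Fin (d + 1)) (y : Fin d → ℝ) :
    Continuous fun t : ℝ => a.insertNth (α := fun _ => ℝ) t y :=
  Continuous.finInsertNth a continuous_id continuous_const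

theorem hasDerivAt_insertNth {d : ℕ} (a : Fin (d + 1)) (y : Fin d → ℝ) (t : ℝ) :
    HasDerivAt (fun t : ℝ => a.insertNth (α := fun _ => ℝ) t y) (Pi.single a 1) t := by
  rw [hasDerivAt_pi, Fin.forall_iff_succAbove a]
  refine ⟨by simpa using hasDerivAt_id' t, fun j => ?_⟩
  simpa using hasDerivAt_const t (y j)

theorem integrableOn_continuousOn_mul {d : ℕ} {g : (Fin (d + 1) → ℝ) → ℝ}
    (hg : IntegrableOn g (cube (d + 1)))
    (u : (Fin (d + 1) → ℝ) → ℝ) (hu : ContinuousOn u (Icc 0 1)) :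
    IntegrableOn (fun ξ => u ξ * g ξ) (cube (d + 1)) := by
  obtain ⟨M, hM⟩ := isCompact_Icc.exists_bound_of_continuousOn hu
  refine hg.bdd_mul (c := M) ?_ ?_
  · exact (hu.mono (cube_subset_Icc _)).aestronglyMeasurable (isOpen_cube _).measurableSet
  · exact (ae_restrict_iff' (isOpen_cube _).measurableSet).2
      (Eventually.of_forall fun ξ hξ => hM ξ (cube_subset_Icc _ hξ))

/-- Fubini and the fundamental theorem of calculus along the lines parallel to the axis `a`. The
function need not be differentiable on countably many hyperplanes orthogonal to each axis. -/
theorem integral_cube_partial {d : ℕ} {a : Fin (d + 1)} {B : Fin (d + 1) → Set ℝ}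
    (hB : ∀ α, (B α).Countable) {f g : (Fin (d + 1) → ℝ) → ℝ} (hf : ContinuousOn f (Icc 0 1))
    (hd : ∀ ξ ∈ cube (d + 1), (∀ α, ξ α ∉ B α) →
      ∃ f' : (Fin (d + 1) → ℝ) →L[ℝ] ℝ, HasFDerivAt f f' ξ ∧ f' (Pi.single a 1) = g ξ)
    (hg : IntegrableOn g (cube (d + 1))) :
    ∫ ξ in cube (d + 1), g ξ =
      ∫ y in cube d, (f (a.insertNth (α := fun _ => ℝ) 1 y)
        - f (a.insertNth (α := fun _ => ℝ) 0 y)) := by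
  have mp := (volume_preserving_piFinSuccAbove (fun _ : Fin (d + 1) => ℝ) a).symm
  have pre : (MeasurableEquiv.piFinSuccAbove (fun _ : Fin (d + 1) => ℝ) a).symm ⁻¹' cube (d + 1)
      = Ioo (0 : ℝ) 1 ×ˢ cube d := by
    ext ⟨t, y⟩
    exact insertNth_mem_cube
  have me := (MeasurableEquiv.piFinSuccAbove (fun _ : Fin (d + 1) => ℝ) a).symm.measurableEmbedding
  have int : IntegrableOn (fun z : ℝ × (Fin d → ℝ) => g (a.insertNth (α := fun _ => ℝ) z.1 z.2))
      (Ioo (0 : ℝ) 1 ×ˢ cube d) := by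
    rw [← pre]
    exact (mp.integrableOn_comp_preimage me).2 hg
  have e1 : ∫ ξ in cube (d + 1), g ξ = ∫ z in Ioo (0 : ℝ) 1 ×ˢ cube d,
      g (a.insertNth (α := fun _ => ℝ) z.1 z.2) := by
    rw [← pre]
    exact (mp.setIntegral_preimage_emb me g _).symm
  rw [IntegrableOn, Measure.volume_eq_prod, ← Measure.prod_restrict] at int
  rw [e1, Measure.volume_eq_prod, ← Measure.prod_restrict, integral_prod_symm _ int]
  refine integral_congr_ae ?_
  have hyB : ∀ᵐ y : Fin d → ℝ ∂(volume.restrict (cube d)), ∀ α, y α ∉ B (a.succAbove α) :=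
    ae_restrict_of_ae (ae_notMem_countable fun α => hB _)
  filter_upwards [int.prod_left_ae, hyB, ae_restrict_mem (isOpen_cube d).measurableSet]
    with y hy hyB hyc
  have hI : IntervalIntegrable (fun t => g (a.insertNth (α := fun _ => ℝ) t y)) volume 0 1 := by
    rw [intervalIntegrable_iff_integrableOn_Ioo_of_le zero_le_one]
    exact hy
  have := integral_eq_of_hasDerivAt_off_countable_of_le
    (fun t => f (a.insertNth (α := fun _ => ℝ) t y))
    (fun t => g (a.insertNth (α := fun _ => ℝ) t y)) zero_le_one (hB a)
    (hf.comp (continuous_insertNth_left a y).continuousOn fun t ht =>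
      insertNth_mem_Icc_iff.2 ⟨ht, cube_subset_Icc d hyc⟩)
    (fun t ht => by
      obtain ⟨f', h1, h2⟩ := hd (a.insertNth (α := fun _ => ℝ) t y)
        (insertNth_mem_cube.2 ⟨ht.1, hyc⟩) (by
          rw [Fin.forall_iff_succAbove a]
          exact ⟨by simpa using ht.2, fun j => by simpa using hyB j⟩)
      rw [← h2]
      exact h1.comp_hasDerivAt t (hasDerivAt_insertNth a y t)) hI
  rw [← this, intervalIntegral.integral_of_le zero_le_one, integral_Ioc_eq_integral_Ioo]

/-! ### The Piola identity -/

theorem adjugate_eq_det_updateRow_transpose {n : ℕ} (A : Matrix (Fin n) (Fin n) ℝ) (a k : Fin n) :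
    A.adjugate a k = (A.transpose.updateRow a (Pi.single k 1)).det := by
  have := Matrix.adjugate_apply A.transpose k a
  rwa [← Matrix.adjugate_transpose] at this

/-- The determinant as a continuous multilinear function of the rows. -/
def detCML (n : ℕ) : ContinuousMultilinearMap ℝ (fun _ : Fin n => Fin n → ℝ) ℝ :=
  { (Matrix.detRowAlternating (n := Fin n) (R := ℝ)).toMultilinearMap with
    cont := by
      change Continuous fun M : Matrix (Fin n) (Fin n) ℝ => M.det
      exact continuous_id.matrix_det }

/-- The Piola identity: if the columns of `J` have the mixed derivatives of a common potential, then
the columns of the adjugate matrix of `J` are divergence free. Only the mixed derivatives enter,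
since row `a` of the adjugate matrix does not depend on column `a` of `J`. -/
theorem piola_identity {n : ℕ} {J : (Fin n → ℝ) → Matrix (Fin n) (Fin n) ℝ} {ξ : Fin n → ℝ}
    {C' : Fin n → ((Fin n → ℝ) →L[ℝ] (Fin n → ℝ))}
    (hJ : ∀ b, HasFDerivAt (fun ξ r => J ξ r b) (C' b) ξ)
    (hsymm : ∀ a b, C' b (Pi.single a 1) = C' a (Pi.single b 1)) (k : Fin n) :
    ∃ D : Fin n → ((Fin n → ℝ) →L[ℝ] ℝ),
      (∀ a, HasFDerivAt (fun ξ => (J ξ).adjugate a k) (D a) ξ) ∧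
        ∑ a, D a (Pi.single a 1) = 0 := by
  classical
  set R : Fin n → Fin n → ℝ := fun b r => J ξ r b with hR
  set e : Fin n → ℝ := Pi.single k 1
  have hrow : ∀ a, HasFDerivAt (fun ξ => Function.update (fun b r => J ξ r b) a e)
      (ContinuousLinearMap.pi (Function.update C' a 0)) ξ := by
    intro a
    rw [hasFDerivAt_pi']
    intro b
    by_cases hb : b = a
    · subst hb
      simp only [Function.update_self]
      refine (hasFDerivAt_const e ξ).congr_fderiv ?_
      ext v
      simp
    · simp only [Function.update_of_ne hb]
      refine (hJ b).congr_fderiv ?_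
      ext v
      simp [Function.update_of_ne hb]
  set T : Fin n → Fin n → ℝ := fun a b => if b = a then 0 else
    detCML n (Function.update (Function.update R a e) b (C' b (Pi.single a 1))) with hT
  have key : ∀ a, ∃ D : (Fin n → ℝ) →L[ℝ] ℝ, HasFDerivAt (fun ξ => (J ξ).adjugate a k) D ξ ∧
      D (Pi.single a 1) = ∑ b, T a b := by
    intro a
    refine ⟨_, ((detCML n).hasFDerivAt (Function.update R a e)).comp ξ (hrow a)
      |>.congr_of_eventuallyEq (Eventually.of_forall fun ξ => ?_), ?_⟩
    · exact adjugate_eq_det_updateRow_transpose (J ξ) a k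
    · rw [ContinuousLinearMap.comp_apply, ContinuousMultilinearMap.linearDeriv_apply]
      refine Finset.sum_congr rfl fun b _ => ?_
      by_cases hb : b = a
      · subst hb
        simp only [hT, if_true, ContinuousLinearMap.coe_pi', Function.update_self]
        exact (detCML n).map_coord_zero b (by simp)
      · simp [hT, hb]
  -- Exchanging the rows `a` and `b` turns one matrix into the other, as `hsymm` identifies the
  -- mixed derivatives.
  have anti : ∀ a b, T a b = - T b a := by
    intro a b
    by_cases hb : b = a
    · simp [hT, hb]
    have hba : a ≠ b := fun h => hb h.symm
    simp only [hT, hb, hba, if_false]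
    rw [hsymm a b]
    have sw := (Matrix.detRowAlternating (n := Fin n) (R := ℝ)).map_swap
      (Function.update (Function.update R b e) a (C' a (Pi.single b 1))) hba
    change _ = -detCML n _ at sw
    rw [← sw]
    change _ = detCML n _
    congr 1
    funext r
    simp only [Function.comp]
    rcases eq_or_ne r a with rfl | hra
    · simp [Function.update_of_ne hba, Function.update_of_ne hb]
    rcases eq_or_ne r b with rfl | hrb
    · simp
    · simp [Equiv.swap_apply_of_ne_of_ne hra hrb, Function.update_of_ne, hra, hrb]
  choose D hD hDT using key
  refine ⟨D, hD, ?_⟩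
  simp only [hDT]
  have h1 : ∑ a, ∑ b, T a b = ∑ a, ∑ b, T b a := Finset.sum_comm
  have h2 : ∑ a, ∑ b, T b a = - ∑ a, ∑ b, T a b := by
    rw [← Finset.sum_neg_distrib]
    refine Finset.sum_congr rfl fun a _ => ?_
    rw [← Finset.sum_neg_distrib]
    exact Finset.sum_congr rfl fun b _ => anti b a
  linarith

/-- Integration by parts on the cube for the vector field `W adj(J) e_k`. -/
theorem integral_cube_adjugate {d : ℕ} {B : Fin (d + 1) → Set ℝ} (hB : ∀ α, (B α).Countable)
    {J : (Fin (d + 1) → ℝ) → Matrix (Fin (d + 1)) (Fin (d + 1)) ℝ}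
    (hJc : ∀ r b, Continuous fun ξ => J ξ r b)
    (hJ : ∀ ξ ∈ cube (d + 1), (∀ α, ξ α ∉ B α) →
      ∃ C' : Fin (d + 1) → ((Fin (d + 1) → ℝ) →L[ℝ] (Fin (d + 1) → ℝ)),
        (∀ b, HasFDerivAt (fun ξ r => J ξ r b) (C' b) ξ) ∧
        ∀ a b, C' b (Pi.single a 1) = C' a (Pi.single b 1))
    {W : (Fin (d + 1) → ℝ) → ℝ} {W' : Fin (d + 1) → (Fin (d + 1) → ℝ) → ℝ}
    (hWc : ContinuousOn W (Icc 0 1))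
    (hW : ∀ ξ ∈ cube (d + 1), (∀ α, ξ α ∉ B α) →
      ∃ f' : (Fin (d + 1) → ℝ) →L[ℝ] ℝ, HasFDerivAt W f' ξ ∧ ∀ a, f' (Pi.single a 1) = W' a ξ)
    (hW'i : ∀ a, IntegrableOn (W' a) (cube (d + 1)))
    (k : Fin (d + 1))
    (hadj : ∀ a, IntegrableOn (fun ξ => fderiv ℝ (fun ξ => (J ξ).adjugate a k) ξ (Pi.single a 1))
      (cube (d + 1))) :
    ∫ ξ in cube (d + 1), ∑ a, W' a ξ * (J ξ).adjugate a k =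
      ∑ a, ∫ y in cube d,
        (W (a.insertNth (α := fun _ => ℝ) 1 y) *
            (J (a.insertNth (α := fun _ => ℝ) 1 y)).adjugate a k
          - W (a.insertNth (α := fun _ => ℝ) 0 y) *
            (J (a.insertNth (α := fun _ => ℝ) 0 y)).adjugate a k) := by
  have hadjc : ∀ a, Continuous fun ξ => (J ξ).adjugate a k := by
    intro a
    have : Continuous J := continuous_matrix hJc
    exact this.matrix_adjugate.matrix_elem a k
  set G : Fin (d + 1) → (Fin (d + 1) → ℝ) → ℝ := fun a ξ => W' a ξ * (J ξ).adjugate a k +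
    fderiv ℝ (fun ξ => (J ξ).adjugate a k) ξ (Pi.single a 1) * W ξ with hG
  have hGi : ∀ a, IntegrableOn (G a) (cube (d + 1)) := fun a =>
    ((integrableOn_continuousOn_mul (hW'i a) _ (hadjc a).continuousOn).congr_fun
      (fun ξ _ => mul_comm _ _) (isOpen_cube _).measurableSet).add
      ((integrableOn_continuousOn_mul (hadj a) _ hWc).congr_fun
      (fun ξ _ => mul_comm _ _) (isOpen_cube _).measurableSet)
  have hlines : ∀ a, ∫ ξ in cube (d + 1), G a ξ = ∫ y in cube d,
        (W (a.insertNth (α := fun _ => ℝ) 1 y) *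
            (J (a.insertNth (α := fun _ => ℝ) 1 y)).adjugate a k
          - W (a.insertNth (α := fun _ => ℝ) 0 y) *
            (J (a.insertNth (α := fun _ => ℝ) 0 y)).adjugate a k) := by
    intro a
    refine integral_cube_partial (f := fun ξ => W ξ * (J ξ).adjugate a k) hB
      (hWc.mul (hadjc a).continuousOn) (fun ξ hξ hξB => ?_) (hGi a)
    obtain ⟨f', hf', hf''⟩ := hW ξ hξ hξB
    obtain ⟨C', hC, hs⟩ := hJ ξ hξ hξB
    obtain ⟨D, hD, -⟩ := piola_identity hC hs k
    refine ⟨_, hf'.mul (hD a), ?_⟩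
    simp only [hG, (hD a).fderiv, add_apply, smul_apply,
      smul_eq_mul, hf'']
    ring
  simp only [← hlines]
  rw [← integral_finsetSum _ fun a _ => hGi a]
  refine integral_congr_ae ?_
  filter_upwards [ae_restrict_of_ae (ae_notMem_countable hB),
    ae_restrict_mem (isOpen_cube (d + 1)).measurableSet] with ξ hξB hξ
  obtain ⟨C', hC, hs⟩ := hJ ξ hξ hξB
  -- The derivatives of the adjugate matrix add up to zero.
  obtain ⟨D, hD, h0⟩ := piola_identity hC hs k
  simp only [hG, Finset.sum_add_distrib, ← Finset.sum_mul, (hD _).fderiv, h0, zero_mul, add_zero]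

namespace Patch

variable {d : ℕ} (P : Patch d)

/-! ### The geometrical map up to the boundary -/

/-- The extension of the geometrical map `Φ` to a `C^1` map on the whole space. -/
def chart (ξ : Fin (d + 1) → ℝ) : Pt d :=
  WithLp.toLp 2 fun r => splD P.K 0 (fun i => P.control i r) ξ

/-- The Jacobian matrix of `chart`. -/
def J (ξ : Fin (d + 1) → ℝ) : Matrix (Fin (d + 1)) (Fin (d + 1)) ℝ :=
  Matrix.of fun r b => splD P.K (Pi.single b 1) (fun i => P.control i r) ξ

/-- The derivative of `chart`. -/
def D (ξ : Fin (d + 1) → ℝ) : (Fin (d + 1) → ℝ) →L[ℝ] Pt d :=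
  (EuclideanSpace.equiv (Fin (d + 1)) ℝ).symm.toContinuousLinearMap ∘L
    LinearMap.toContinuousLinearMap (Matrix.toLin' (P.J ξ))

/-- The inverse of the derivative of `chart`, where the Jacobian is invertible. -/
def Dinv (ξ : Fin (d + 1) → ℝ) : Pt d →L[ℝ] (Fin (d + 1) → ℝ) :=
  LinearMap.toContinuousLinearMap (Matrix.toLin' (P.J ξ)⁻¹) ∘L
    (EuclideanSpace.equiv (Fin (d + 1)) ℝ).toContinuousLinearMap

theorem D_apply (ξ v : Fin (d + 1) → ℝ) : P.D ξ v = WithLp.toLp 2 ((P.J ξ).mulVec v) := rfl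

theorem Dinv_apply (ξ : Fin (d + 1) → ℝ) (z : Pt d) :
    P.Dinv ξ z = (P.J ξ)⁻¹.mulVec z.ofLp := rfl

theorem chart_eq {ξ : Fin (d + 1) → ℝ} (hξ : ξ ∈ cube (d + 1)) : P.chart ξ = P.Φ ξ := by
  ext r
  simp [chart, splD_zero _ _ hξ, Φ, geoMap, mul_comm]

theorem continuous_J_apply (r b : Fin (d + 1)) : Continuous fun ξ => P.J ξ r b :=
  continuous_splD _ _ fun α => by
    by_cases h : α = b
    · subst h; simp
    · simp [Pi.single_eq_of_ne h]

theorem continuous_J : Continuous P.J := continuous_matrix P.continuous_J_apply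

theorem hasFDerivAt_chart (ξ : Fin (d + 1) → ℝ) : HasFDerivAt P.chart (P.D ξ) ξ := by
  rw [← hasFDerivWithinAt_univ, hasFDerivWithinAt_euclidean]
  intro r
  rw [hasFDerivWithinAt_univ]
  refine (hasFDerivAt_splD P.K (fun i => P.control i r) (m := 0)
    (fun α => Or.inl rfl)).congr_fderiv ?_
  ext v
  simp [D_apply, J, Matrix.mulVec, dotProduct]

theorem continuous_D : Continuous P.D := by
  rw [continuous_clm_apply]
  intro v
  exact (PiLp.continuous_toLp 2 _).comp (P.continuous_J.matrix_mulVec continuous_const)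

theorem hasStrictFDerivAt_chart (ξ : Fin (d + 1) → ℝ) : HasStrictFDerivAt P.chart (P.D ξ) ξ :=
  hasStrictFDerivAt_of_hasFDerivAt_of_continuousAt
    (Eventually.of_forall P.hasFDerivAt_chart) P.continuous_D.continuousAt

theorem contDiff_chart : ContDiff ℝ 1 P.chart := by
  rw [contDiff_one_iff_hasFDerivAt]
  exact ⟨P.D, P.continuous_D, P.hasFDerivAt_chart⟩

theorem continuous_chart : Continuous P.chart := P.contDiff_chart.continuous

theorem exists_antilipschitz : ∃ c > 0, ∀ ξ ∈ Icc (0 : Fin (d + 1) → ℝ) 1,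
    ∀ η ∈ Icc (0 : Fin (d + 1) → ℝ) 1, c * dist ξ η ≤ dist (P.chart ξ) (P.chart η) := by
  obtain ⟨c, hc, h⟩ := P.regular
  refine ⟨c, hc, fun ξ hξ η hη => ?_⟩
  have hcl : IsClosed {z : (Fin (d + 1) → ℝ) × (Fin (d + 1) → ℝ) |
      c * dist z.1 z.2 ≤ dist (P.chart z.1) (P.chart z.2)} :=
    isClosed_le (by fun_prop)
      ((P.continuous_chart.comp continuous_fst).dist (P.continuous_chart.comp continuous_snd))
  have hsub : cube (d + 1) ×ˢ cube (d + 1) ⊆ {z : (Fin (d + 1) → ℝ) × (Fin (d + 1) → ℝ) |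
      c * dist z.1 z.2 ≤ dist (P.chart z.1) (P.chart z.2)} := by
    rintro ⟨ξ, η⟩ ⟨h1, h2⟩
    have := h ξ h1 η h2
    change c * dist ξ η ≤ dist (P.chart ξ) (P.chart η)
    rw [P.chart_eq h1, P.chart_eq h2]
    exact this
  have := closure_minimal hsub hcl
  rw [closure_prod_eq, closure_cube] at this
  exact this (mk_mem_prod hξ hη)

theorem injOn_chart : InjOn P.chart (Icc 0 1) := by
  obtain ⟨c, hc, h⟩ := P.exists_antilipschitz
  intro ξ hξ η hη he
  have := h ξ hξ η hη
  rw [he, dist_self] at this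
  exact dist_le_zero.1 (nonpos_of_mul_nonpos_right this hc)

theorem exists_le_norm_D : ∃ c > 0, ∀ ξ ∈ Icc (0 : Fin (d + 1) → ℝ) 1, ∀ v,
    c * ‖v‖ ≤ ‖P.D ξ v‖ := by
  obtain ⟨c, hc, h⟩ := P.exists_antilipschitz
  refine ⟨c, hc, fun ξ hξ v => ?_⟩
  have hcl : IsClosed {ξ | c * ‖v‖ ≤ ‖P.D ξ v‖} :=
    isClosed_le continuous_const (P.continuous_D.clm_apply continuous_const).norm
  rw [← closure_cube] at hξ
  refine closure_minimal (fun ξ hξ => ?_) hcl hξ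
  have hl := (P.hasFDerivAt_chart ξ).hasLineDerivAt v
  have hs : Tendsto (fun t : ℝ => ‖t⁻¹ • (P.chart (ξ + t • v) - P.chart ξ)‖) (𝓝[≠] 0)
      (𝓝 ‖P.D ξ v‖) := by
    have := hl.tendsto_slope_zero
    simpa using this.norm
  refine ge_of_tendsto hs ?_
  have hev : ∀ᶠ t : ℝ in 𝓝 0, ξ + t • v ∈ cube (d + 1) := by
    have : ContinuousAt (fun t : ℝ => ξ + t • v) 0 := by fun_prop
    exact this.eventually ((isOpen_cube _).mem_nhds (by simpa using hξ))
  filter_upwards [nhdsWithin_le_nhds hev, self_mem_nhdsWithin] with t ht ht0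
  have ht0 : t ≠ 0 := ht0
  have := h _ (cube_subset_Icc _ ht) ξ (cube_subset_Icc _ hξ)
  rw [dist_eq_norm, dist_eq_norm, add_sub_cancel_left, norm_smul] at this
  rw [norm_smul, norm_inv, ← div_eq_inv_mul, le_div_iff₀ (norm_pos_iff.2 ht0)]
  linarith

theorem isUnit_det_J {ξ : Fin (d + 1) → ℝ} (hξ : ξ ∈ Icc (0 : Fin (d + 1) → ℝ) 1) :
    IsUnit (P.J ξ).det := by
  obtain ⟨c, hc, h⟩ := P.exists_le_norm_D
  rw [← Matrix.isUnit_iff_isUnit_det, ← Matrix.mulVec_injective_iff_isUnit]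
  intro v w hvw
  have := h ξ hξ (v - w)
  have h0 : P.D ξ (v - w) = 0 := by
    rw [D_apply, Matrix.mulVec_sub, hvw, sub_self]
    rfl
  rw [h0, norm_zero] at this
  exact sub_eq_zero.1 (norm_le_zero_iff.1 (nonpos_of_mul_nonpos_right this hc))

theorem det_J_ne_zero {ξ : Fin (d + 1) → ℝ} (hξ : ξ ∈ Icc (0 : Fin (d + 1) → ℝ) 1) :
    (P.J ξ).det ≠ 0 := (P.isUnit_det_J hξ).ne_zero

theorem Φbar_eq {ξ : Fin (d + 1) → ℝ} (hξ : ξ ∈ Icc (0 : Fin (d + 1) → ℝ) 1) :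
    P.Φbar ξ = P.chart ξ := by
  rw [← closure_cube] at hξ
  refine extendFrom_eq hξ ?_
  refine (P.continuous_chart.continuousAt.mono_left nhdsWithin_le_nhds).congr' ?_
  filter_upwards [self_mem_nhdsWithin] with η hη using P.chart_eq hη

theorem jac_eq {ξ : Fin (d + 1) → ℝ} (hξ : ξ ∈ Icc (0 : Fin (d + 1) → ℝ) 1) :
    P.jac ξ = P.J ξ := by
  rw [← closure_cube] at hξ
  refine extendFrom_eq hξ ?_
  refine (P.continuous_J.continuousAt.mono_left nhdsWithin_le_nhds).congr' ?_
  filter_upwards [self_mem_nhdsWithin] with η hη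
  have : P.Φ =ᶠ[𝓝 η] P.chart := by
    filter_upwards [(isOpen_cube _).mem_nhds hη] with ζ hζ using (P.chart_eq hζ).symm
  ext r b
  rw [Matrix.of_apply, this.fderiv_eq, (P.hasFDerivAt_chart η).fderiv, D_apply]
  simp

theorem Dinv_D {ξ : Fin (d + 1) → ℝ} (hξ : ξ ∈ Icc (0 : Fin (d + 1) → ℝ) 1)
    (v : Fin (d + 1) → ℝ) : P.Dinv ξ (P.D ξ v) = v := by
  rw [D_apply, Dinv_apply, Matrix.mulVec_mulVec, Matrix.nonsing_inv_mul _ (P.isUnit_det_J hξ),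
    Matrix.one_mulVec]

theorem D_Dinv {ξ : Fin (d + 1) → ℝ} (hξ : ξ ∈ Icc (0 : Fin (d + 1) → ℝ) 1) (z : Pt d) :
    P.D ξ (P.Dinv ξ z) = z := by
  rw [D_apply, Dinv_apply, Matrix.mulVec_mulVec, Matrix.mul_nonsing_inv _ (P.isUnit_det_J hξ),
    Matrix.one_mulVec]

/-- The inverse function theorem at a point of the closed cube, boundary included: this is what the
extension beyond the cube is for. -/
theorem exists_localInverse {ξ : Fin (d + 1) → ℝ} (hξ : ξ ∈ Icc (0 : Fin (d + 1) → ℝ) 1) :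
    ∃ g : Pt d → (Fin (d + 1) → ℝ), HasFDerivAt g (P.Dinv ξ) (P.chart ξ) ∧ g (P.chart ξ) = ξ ∧
      (∀ᶠ η in 𝓝 ξ, g (P.chart η) = η) ∧ ∀ᶠ y in 𝓝 (P.chart ξ), P.chart (g y) = y := by
  let e : (Fin (d + 1) → ℝ) ≃L[ℝ] Pt d :=
    ContinuousLinearEquiv.equivOfInverse (P.D ξ) (P.Dinv ξ) (P.Dinv_D hξ) (P.D_Dinv hξ)
  have hf : HasStrictFDerivAt P.chart (e : (Fin (d + 1) → ℝ) →L[ℝ] Pt d) ξ :=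
    P.hasStrictFDerivAt_chart ξ
  exact ⟨hf.localInverse _ _ _, hf.to_localInverse.hasFDerivAt, hf.localInverse_apply_image,
    hf.eventually_left_inverse, hf.eventually_right_inverse⟩

/-! ### The patch and its closure -/

theorem dom_eq : P.dom = P.chart '' cube (d + 1) := by
  refine image_congr fun ξ hξ => ?_
  exact (P.chart_eq hξ).symm

theorem isOpen_dom : IsOpen P.dom := by
  rw [dom_eq, isOpen_iff_mem_nhds]
  rintro _ ⟨ξ, hξ, rfl⟩
  obtain ⟨g, hg, hgξ, -, hr⟩ := P.exists_localInverse (cube_subset_Icc _ hξ)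
  have : ∀ᶠ y in 𝓝 (P.chart ξ), g y ∈ cube (d + 1) :=
    hg.continuousAt.eventually ((isOpen_cube _).mem_nhds (by rwa [hgξ]))
  filter_upwards [this, hr] with y h1 h2
  exact ⟨g y, h1, h2⟩

theorem isCompact_image_chart : IsCompact (P.chart '' Icc 0 1) :=
  isCompact_Icc.image P.continuous_chart

theorem closure_dom : closure P.dom = P.chart '' Icc 0 1 := by
  rw [dom_eq]
  refine subset_antisymm ?_ ?_
  · exact closure_minimal (image_mono (cube_subset_Icc _)) P.isCompact_image_chart.isClosed
  · rw [← closure_cube]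
    exact image_closure_subset_closure_image P.continuous_chart

theorem isCompact_closure_dom : IsCompact (closure P.dom) := P.closure_dom ▸ P.isCompact_image_chart

theorem chart_mem_closure {ξ : Fin (d + 1) → ℝ} (hξ : ξ ∈ Icc (0 : Fin (d + 1) → ℝ) 1) :
    P.chart ξ ∈ closure P.dom := P.closure_dom ▸ mem_image_of_mem _ hξ

theorem chart_mem_dom {ξ : Fin (d + 1) → ℝ} (hξ : ξ ∈ cube (d + 1)) : P.chart ξ ∈ P.dom :=
  P.dom_eq ▸ mem_image_of_mem _ hξ

theorem param_mem {x : Pt d} (hx : x ∈ closure P.dom) :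
    P.param x ∈ Icc (0 : Fin (d + 1) → ℝ) 1 := by
  rw [closure_dom] at hx
  obtain ⟨ξ, hξ, rfl⟩ := hx
  exact Function.invFunOn_mem ⟨ξ, hξ, P.Φbar_eq hξ⟩

theorem chart_param {x : Pt d} (hx : x ∈ closure P.dom) : P.chart (P.param x) = x := by
  rw [← P.Φbar_eq (P.param_mem hx)]
  rw [closure_dom] at hx
  obtain ⟨ξ, hξ, rfl⟩ := hx
  exact Function.invFunOn_eq ⟨ξ, hξ, P.Φbar_eq hξ⟩

theorem param_chart {ξ : Fin (d + 1) → ℝ} (hξ : ξ ∈ Icc (0 : Fin (d + 1) → ℝ) 1) :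
    P.param (P.chart ξ) = ξ :=
  P.injOn_chart (P.param_mem (P.chart_mem_closure hξ)) hξ
    (P.chart_param (P.chart_mem_closure hξ))

theorem continuousOn_param : ContinuousOn P.param (closure P.dom) := by
  obtain ⟨c, hc, h⟩ := P.exists_antilipschitz
  have : LipschitzOnWith (Real.toNNReal c⁻¹) P.param (closure P.dom) := by
    refine LipschitzOnWith.of_dist_le_mul fun x hx y hy => ?_
    have := h _ (P.param_mem hx) _ (P.param_mem hy)
    rw [P.chart_param hx, P.chart_param hy] at this
    rw [Real.coe_toNNReal _ (by positivity), inv_mul_eq_div, le_div_iff₀ hc]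
    linarith
  exact this.continuousOn

theorem hasFDerivWithinAt_param {x : Pt d} (hx : x ∈ closure P.dom) :
    HasFDerivWithinAt P.param (P.Dinv (P.param x)) (closure P.dom) x := by
  obtain ⟨g, hg, hgξ, hl, -⟩ := P.exists_localInverse (P.param_mem hx)
  rw [P.chart_param hx] at hg hgξ
  refine hg.hasFDerivWithinAt.congr_of_eventuallyEq ?_ hgξ.symm
  have := (P.continuousOn_param x hx).eventually hl
  filter_upwards [this, self_mem_nhdsWithin] with y hy hy'
  rw [P.chart_param hy'] at hy
  exact hy.symm

theorem trace_eq {F : Type*} [TopologicalSpace F] [T2Space F] {f : Pt d → F}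
    {f' : (Fin (d + 1) → ℝ) → F} (hf' : ContinuousOn f' (Icc 0 1))
    (h : ∀ ξ ∈ cube (d + 1), f (P.chart ξ) = f' ξ) {x : Pt d} (hx : x ∈ closure P.dom) :
    P.trace f x = f' (P.param x) := by
  refine extendFrom_eq hx ?_
  have hc : ContinuousOn (fun x => f' (P.param x)) (closure P.dom) :=
    hf'.comp P.continuousOn_param fun x hx => P.param_mem hx
  refine ((hc x hx).mono subset_closure).tendsto.congr' ?_
  filter_upwards [self_mem_nhdsWithin] with y hy
  rw [dom_eq] at hy
  obtain ⟨ξ, hξ, rfl⟩ := hy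
  rw [h ξ hξ, P.param_chart (cube_subset_Icc _ hξ)]

/-- Chain rule for functions on the patch that are given in the parameter domain. -/
theorem hasFDerivAt_of_comp_chart {f : Pt d → ℝ} {f' : (Fin (d + 1) → ℝ) → ℝ}
    (h : ∀ ξ ∈ cube (d + 1), f (P.chart ξ) = f' ξ) {ξ : Fin (d + 1) → ℝ} (hξ : ξ ∈ cube (d + 1))
    {L : (Fin (d + 1) → ℝ) →L[ℝ] ℝ} (hL : HasFDerivAt f' L ξ) :
    HasFDerivAt f (L ∘L P.Dinv ξ) (P.chart ξ) := by
  obtain ⟨g, hg, hgξ, -, hr⟩ := P.exists_localInverse (cube_subset_Icc _ hξ)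
  have h1 : HasFDerivAt (f' ∘ g) (L ∘L P.Dinv ξ) (P.chart ξ) :=
    HasFDerivAt.comp _ (by rwa [hgξ]) hg
  refine h1.congr_of_eventuallyEq ?_
  have : ∀ᶠ y in 𝓝 (P.chart ξ), g y ∈ cube (d + 1) :=
    hg.continuousAt.eventually ((isOpen_cube _).mem_nhds (by rwa [hgξ]))
  filter_upwards [this, hr] with y h1 h2
  rw [Function.comp, ← h _ h1, h2]

/-- The derivative in direction `e_k`, in parametric coordinates. -/
theorem fderiv_single_of_comp_chart {f : Pt d → ℝ} {f' : (Fin (d + 1) → ℝ) → ℝ}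
    (h : ∀ ξ ∈ cube (d + 1), f (P.chart ξ) = f' ξ) {ξ : Fin (d + 1) → ℝ} (hξ : ξ ∈ cube (d + 1))
    {L : (Fin (d + 1) → ℝ) →L[ℝ] ℝ} (hL : HasFDerivAt f' L ξ) (k : Fin (d + 1)) :
    fderiv ℝ f (P.chart ξ) (EuclideanSpace.single k 1) =
      ∑ a, L (Pi.single a 1) * (P.J ξ)⁻¹ a k := by
  rw [(P.hasFDerivAt_of_comp_chart h hξ hL).fderiv, ContinuousLinearMap.comp_apply, Dinv_apply]
  have : (P.J ξ)⁻¹.mulVec (EuclideanSpace.single k (1 : ℝ)).ofLp = fun a => (P.J ξ)⁻¹ a k := by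
    ext a
    simp
  rw [this]
  conv_lhs => rw [← Finset.univ_sum_single (fun a => (P.J ξ)⁻¹ a k)]
  rw [map_sum]
  refine Finset.sum_congr rfl fun a _ => ?_
  rw [show Pi.single a ((P.J ξ)⁻¹ a k) = (P.J ξ)⁻¹ a k • Pi.single (M := fun _ => ℝ) a (1 : ℝ) by
    rw [← Pi.single_smul]; simp, map_smul, smul_eq_mul, mul_comm]

end Patch

/-! ### Smooth functions of first derivatives of splines -/

section Jet

variable {d : ℕ} {ι : Type*} (K : Fin (d + 1) → KnotVector)
  (c : ι → ((α : Fin (d + 1)) → Fin (K α).n) → ℝ)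

/-- All the first partial derivatives of a finite family of splines. -/
def jet (ξ : Fin (d + 1) → ℝ) : ι → Fin (d + 1) → ℝ :=
  fun s b => splD K (Pi.single b 1) (c s) ξ

theorem single_le_one (b α : Fin (d + 1)) : (Pi.single b 1 : Fin (d + 1) → ℕ) α ≤ 1 := by
  by_cases h : α = b
  · subst h; simp
  · simp [Pi.single_eq_of_ne h]

theorem continuous_jet : Continuous (jet K c) :=
  continuous_pi fun s => continuous_pi fun b => continuous_splD K (c s) (single_le_one b)

/-- The points of the cube with no coordinate among the breakpoints. -/
def goodSet : Set (Fin (d + 1) → ℝ) := {ξ | ξ ∈ cube (d + 1) ∧ ∀ α, ξ α ∉ (K α).breaks}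

theorem ae_mem_goodSet : ∀ᵐ ξ ∂(volume.restrict (cube (d + 1))), ξ ∈ goodSet K := by
  filter_upwards [ae_restrict_mem (isOpen_cube _).measurableSet,
    ae_restrict_of_ae (ae_notMem_countable fun α => (K α).finite_breaks.countable)] with ξ h1 h2
  exact ⟨h1, h2⟩

theorem hasFDerivAt_splD_single {ξ : Fin (d + 1) → ℝ} (hξ : ξ ∈ goodSet K) (b : Fin (d + 1))
    (c : ((α : Fin (d + 1)) → Fin (K α).n) → ℝ) :
    HasFDerivAt (splD K (Pi.single b 1) c) (∑ a, splD K (Pi.single b 1 + Pi.single a 1) c ξ •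
      ContinuousLinearMap.proj (R := ℝ) (φ := fun _ : Fin (d + 1) => ℝ) a) ξ := by
  refine hasFDerivAt_splD K c fun α => ?_
  by_cases h : α = b
  · subst h; exact Or.inr ⟨by simp, hξ.2 α⟩
  · simp [Pi.single_eq_of_ne h]

theorem exists_hasFDerivAt_jet {ξ : Fin (d + 1) → ℝ} (hξ : ξ ∈ goodSet K) :
    ∃ L : (Fin (d + 1) → ℝ) →L[ℝ] (ι → Fin (d + 1) → ℝ), HasFDerivAt (jet K c) L ξ ∧
      ∀ a s b, L (Pi.single a 1) s b = splD K (Pi.single b 1 + Pi.single a 1) (c s) ξ := by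
  refine ⟨ContinuousLinearMap.pi fun s => ContinuousLinearMap.pi fun b => _,
    hasFDerivAt_pi.2 fun s => hasFDerivAt_pi.2 fun b => hasFDerivAt_splD_single K hξ b (c s), ?_⟩
  intro a s b
  simp [Pi.single_apply]

/-- A smooth function of first derivatives of splines has an integrable gradient, since the second
derivatives of splines are bounded. -/
theorem integrableOn_fderiv_comp_jet [Fintype ι] {Ψ : (ι → Fin (d + 1) → ℝ) → ℝ}
    (hΨ : ∀ ξ ∈ Icc (0 : Fin (d + 1) → ℝ) 1, ContDiffAt ℝ 1 Ψ (jet K c ξ)) (a : Fin (d + 1)) :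
    IntegrableOn (fun ξ => fderiv ℝ (fun ξ => Ψ (jet K c ξ)) ξ (Pi.single a 1))
      (cube (d + 1)) := by
  have hcont : ContinuousOn (fun ξ => fderiv ℝ Ψ (jet K c ξ)) (Icc 0 1) := by
    intro ξ hξ
    have h1 : ContinuousAt (fderiv ℝ Ψ) (jet K c ξ) :=
      (ContDiffAt.fderiv_right (m := 0) (hΨ ξ hξ) (by simp)).continuousAt
    exact (h1.comp (continuous_jet K c).continuousAt).continuousWithinAt
  obtain ⟨M, hM⟩ := isCompact_Icc.exists_bound_of_continuousOn hcont
  choose B hB using fun (s : ι) (b : Fin (d + 1)) =>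
    bounded_splD K (c s) (m := Pi.single b 1 + Pi.single a 1) fun α =>
      add_le_add (single_le_one b α) (single_le_one a α)
  have hB0 : ∀ s b, 0 ≤ B s b := fun s b =>
    (abs_nonneg _).trans (hB s b 0 ⟨le_rfl, fun _ => zero_le_one⟩)
  refine Measure.integrableOn_of_bounded (M := M * ∑ s, ∑ b, B s b) (volume_cube_ne_top _)
    (measurable_fderiv_apply_const ℝ _ _).aestronglyMeasurable ?_
  filter_upwards [ae_mem_goodSet K] with ξ hξ
  have hξI := cube_subset_Icc _ hξ.1
  obtain ⟨L, hL, hL'⟩ := exists_hasFDerivAt_jet K c hξ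
  have hd := ((hΨ ξ hξI).differentiableAt (by simp)).hasFDerivAt.comp ξ hL
  have e : fderiv ℝ (fun ξ => Ψ (jet K c ξ)) ξ = fderiv ℝ Ψ (jet K c ξ) ∘L L := hd.fderiv
  rw [e, ContinuousLinearMap.comp_apply]
  refine (ContinuousLinearMap.le_opNorm _ _).trans ?_
  refine mul_le_mul (hM ξ hξI) ?_ (norm_nonneg _) ((norm_nonneg _).trans (hM ξ hξI))
  rw [pi_norm_le_iff_of_nonneg (Finset.sum_nonneg fun s _ => Finset.sum_nonneg fun b _ => hB0 s b)]
  intro s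
  refine le_trans ?_ (Finset.single_le_sum (f := fun s => ∑ b, B s b)
    (fun s _ => Finset.sum_nonneg fun b _ => hB0 s b) (Finset.mem_univ s))
  rw [pi_norm_le_iff_of_nonneg (Finset.sum_nonneg fun b _ => hB0 s b)]
  intro b
  refine le_trans ?_ (Finset.single_le_sum (fun b _ => hB0 s b) (Finset.mem_univ b))
  rw [hL']
  exact hB s b ξ hξI

theorem hasFDerivAt_comp_jet [Fintype ι] {Ψ : (ι → Fin (d + 1) → ℝ) → ℝ}
    (hΨ : ∀ ξ ∈ Icc (0 : Fin (d + 1) → ℝ) 1, ContDiffAt ℝ 1 Ψ (jet K c ξ))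
    {ξ : Fin (d + 1) → ℝ} (hξ : ξ ∈ goodSet K) :
    HasFDerivAt (fun ξ => Ψ (jet K c ξ)) (fderiv ℝ (fun ξ => Ψ (jet K c ξ)) ξ) ξ := by
  obtain ⟨L, hL, -⟩ := exists_hasFDerivAt_jet K c hξ
  have h := ((hΨ ξ (cube_subset_Icc _ hξ.1)).differentiableAt (by simp)).hasFDerivAt.comp ξ hL
  exact h.differentiableAt.hasFDerivAt

end Jet

theorem contDiff_det {E : Type*} [NormedAddCommGroup E] [NormedSpace ℝ E] {n : ℕ}
    {A : E → Matrix (Fin n) (Fin n) ℝ} (h : ∀ i j, ContDiff ℝ 1 fun z => A z i j) :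
    ContDiff ℝ 1 fun z => (A z).det := by
  simp only [Matrix.det_apply']
  exact ContDiff.sum fun σ _ => contDiff_const.mul (contDiff_prod fun i _ => h _ _)

theorem contDiff_adjugate {E : Type*} [NormedAddCommGroup E] [NormedSpace ℝ E] {n : ℕ}
    {A : E → Matrix (Fin n) (Fin n) ℝ} (h : ∀ i j, ContDiff ℝ 1 fun z => A z i j) (a k : Fin n) :
    ContDiff ℝ 1 fun z => (A z).adjugate a k := by
  simp only [adjugate_eq_det_updateRow_transpose]
  refine contDiff_det fun i j => ?_
  by_cases hi : i = a
  · subst hi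
    simp only [Matrix.updateRow_self]
    exact contDiff_const
  · simp only [Matrix.updateRow_ne hi, Matrix.transpose_apply]
    exact h _ _

theorem inv_apply_eq {n : ℕ} (A : Matrix (Fin n) (Fin n) ℝ) (a k : Fin n) :
    A⁻¹ a k = A.det⁻¹ * A.adjugate a k := by
  rw [Matrix.inv_def, Ring.inverse_eq_inv', Matrix.smul_apply, smul_eq_mul]

theorem contDiffAt_inv_apply {E : Type*} [NormedAddCommGroup E] [NormedSpace ℝ E] {n : ℕ}
    {A : E → Matrix (Fin n) (Fin n) ℝ} (h : ∀ i j, ContDiff ℝ 1 fun z => A z i j) (a k : Fin n)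
    {z : E} (hz : (A z).det ≠ 0) : ContDiffAt ℝ 1 (fun z => (A z)⁻¹ a k) z := by
  simp only [inv_apply_eq]
  exact ((contDiff_det h).contDiffAt.inv hz).mul (contDiff_adjugate h a k).contDiffAt

/-! ### Discrete functions and their gradients in parametric coordinates -/

namespace Patch

variable {d : ℕ} (P : Patch d)

/-- The coefficients of discrete functions on the patch. -/
abbrev Coeff : Type := ((α : Fin (d + 1)) → Fin (P.K α).n) → ℝ

/-- The discrete function with coefficients `c` in parametric coordinates. -/
def spl (c : P.Coeff) (ξ : Fin (d + 1) → ℝ) : ℝ := splD P.K 0 c ξ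

/-- The derivative in the direction `e_k` of physical space of the discrete function with
coefficients `c`, in parametric coordinates. -/
def grad (c : P.Coeff) (k : Fin (d + 1)) (ξ : Fin (d + 1) → ℝ) : ℝ :=
  ∑ a, splD P.K (Pi.single a 1) c ξ * (P.J ξ)⁻¹ a k

/-- The spatial part of the gradient, in parametric coordinates. -/
def gradSp (c : P.Coeff) (ξ : Fin (d + 1) → ℝ) : Sp d :=
  WithLp.toLp 2 fun k => P.grad c k.castSucc ξ

variable {P}

theorem exists_coeff {v : Pt d → ℝ} (hv : v ∈ P.space) :
    ∃ c : P.Coeff, ∀ ξ ∈ cube (d + 1), v (P.chart ξ) = P.spl c ξ := by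
  obtain ⟨c, hc⟩ := hv
  exact ⟨c, fun ξ hξ => by rw [P.chart_eq hξ, hc ξ hξ, spl, splD_zero _ _ hξ]⟩

variable (P)

theorem continuous_spl (c : P.Coeff) : Continuous (P.spl c) :=
  continuous_splD _ _ fun _ => zero_le_one

theorem hasFDerivAt_spl (c : P.Coeff) (ξ : Fin (d + 1) → ℝ) :
    HasFDerivAt (P.spl c) (∑ a, splD P.K (Pi.single a 1) c ξ •
      ContinuousLinearMap.proj (R := ℝ) (φ := fun _ : Fin (d + 1) => ℝ) a) ξ := by
  have := hasFDerivAt_splD P.K c (m := 0) (ξ := ξ) fun α => Or.inl rfl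
  simp only [zero_add] at this
  exact this

theorem continuousOn_J_inv (a k : Fin (d + 1)) :
    ContinuousOn (fun ξ => (P.J ξ)⁻¹ a k) (Icc 0 1) := by
  simp only [inv_apply_eq]
  exact (P.continuous_J.matrix_det.continuousOn.inv₀ fun ξ hξ => P.det_J_ne_zero hξ).mul
    (P.continuous_J.matrix_adjugate.matrix_elem a k).continuousOn

theorem continuousOn_grad (c : P.Coeff) (k : Fin (d + 1)) :
    ContinuousOn (P.grad c k) (Icc 0 1) :=
  continuousOn_finsetSum _ fun a _ =>
    (continuous_splD _ _ (single_le_one a)).continuousOn.mul (P.continuousOn_J_inv a k)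

theorem continuousOn_gradSp (c : P.Coeff) : ContinuousOn (P.gradSp c) (Icc 0 1) :=
  (PiLp.continuous_toLp 2 _).comp_continuousOn
    (continuousOn_pi.2 fun k => P.continuousOn_grad c k.castSucc)

variable {P} {v : Pt d → ℝ} {c : P.Coeff}

theorem fderiv_chart_single
    (hv : ∀ ξ ∈ cube (d + 1), v (P.chart ξ) = P.spl c ξ)
    {ξ : Fin (d + 1) → ℝ} (hξ : ξ ∈ cube (d + 1)) (k : Fin (d + 1)) :
    fderiv ℝ v (P.chart ξ) (EuclideanSpace.single k 1) = P.grad c k ξ := by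
  rw [P.fderiv_single_of_comp_chart hv hξ (P.hasFDerivAt_spl c ξ), grad]
  simp [Pi.single_apply]

theorem dt_chart
    (hv : ∀ ξ ∈ cube (d + 1), v (P.chart ξ) = P.spl c ξ)
    {ξ : Fin (d + 1) → ℝ} (hξ : ξ ∈ cube (d + 1)) :
    dt v (P.chart ξ) = P.grad c (Fin.last d) ξ := fderiv_chart_single hv hξ _

theorem gradX_chart
    (hv : ∀ ξ ∈ cube (d + 1), v (P.chart ξ) = P.spl c ξ)
    {ξ : Fin (d + 1) → ℝ} (hξ : ξ ∈ cube (d + 1)) :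
    gradX v (P.chart ξ) = P.gradSp c ξ := by
  rw [gradX, gradSp]
  congr 1
  funext k
  exact fderiv_chart_single hv hξ _

/-- The first derivatives of a discrete function (`none`) and of the chart (`some r`). -/
def jetFamily (P : Patch d) (c : P.Coeff) : Option (Fin (d + 1)) → P.Coeff
  | none => c
  | some r => fun i => P.control i r

/-- The function that gives the physical derivative in the direction `e_k` from `jetFamily`. -/
def gradOfJet (k : Fin (d + 1)) (z : Option (Fin (d + 1)) → Fin (d + 1) → ℝ) : ℝ :=
  ∑ a, z none a * (Matrix.of fun r b => z (some r) b)⁻¹ a k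

theorem contDiffAt_gradOfJet (P : Patch d) (c : P.Coeff) (k : Fin (d + 1))
    {ξ : Fin (d + 1) → ℝ} (hξ : ξ ∈ Icc (0 : Fin (d + 1) → ℝ) 1) :
    ContDiffAt ℝ 1 (gradOfJet k) (jet P.K (P.jetFamily c) ξ) := by
  refine ContDiffAt.sum fun a _ => ContDiffAt.mul (by fun_prop)
    (contDiffAt_inv_apply (fun i j => by simp only [Matrix.of_apply]; fun_prop) a k ?_)
  exact P.det_J_ne_zero hξ

theorem hasFDerivAt_grad (P : Patch d) (c : P.Coeff) (k : Fin (d + 1)) {ξ : Fin (d + 1) → ℝ}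
    (hξ : ξ ∈ goodSet P.K) : HasFDerivAt (P.grad c k) (fderiv ℝ (P.grad c k) ξ) ξ :=
  hasFDerivAt_comp_jet P.K (P.jetFamily c) (fun _ h => contDiffAt_gradOfJet P c k h) hξ

theorem integrableOn_fderiv_grad (P : Patch d) (c : P.Coeff) (k a : Fin (d + 1)) :
    IntegrableOn (fun ξ => fderiv ℝ (P.grad c k) ξ (Pi.single a 1)) (cube (d + 1)) :=
  integrableOn_fderiv_comp_jet P.K (P.jetFamily c)
    (fun _ h => contDiffAt_gradOfJet P c k h) a

theorem integrableOn_fderiv_adjugate (P : Patch d) (k a : Fin (d + 1)) :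
    IntegrableOn (fun ξ => fderiv ℝ (fun ξ => (P.J ξ).adjugate a k) ξ (Pi.single a 1))
      (cube (d + 1)) :=
  integrableOn_fderiv_comp_jet P.K (fun r i => P.control i r)
    (Ψ := fun z => (Matrix.of fun r b => z r b).adjugate a k)
    (fun _ _ => (contDiff_adjugate (fun i j => by
      simp only [Matrix.of_apply]; fun_prop) a k).contDiffAt) a

theorem exists_hasFDerivAt_J (P : Patch d) {ξ : Fin (d + 1) → ℝ} (hξ : ξ ∈ goodSet P.K) :
    ∃ C' : Fin (d + 1) → ((Fin (d + 1) → ℝ) →L[ℝ] (Fin (d + 1) → ℝ)),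
      (∀ b, HasFDerivAt (fun ξ r => P.J ξ r b) (C' b) ξ) ∧
      ∀ a b, C' b (Pi.single a 1) = C' a (Pi.single b 1) := by
  refine ⟨fun b => ContinuousLinearMap.pi fun r => _, fun b => hasFDerivAt_pi.2 fun r =>
    hasFDerivAt_splD_single P.K hξ b (fun i => P.control i r), fun a b => ?_⟩
  ext r
  simp [Pi.single_apply, add_comm]

/-- `∂_t ∇_x v` in parametric coordinates, off the element boundaries. -/
theorem dtGradX_chart (hv : ∀ ξ ∈ cube (d + 1), v (P.chart ξ) = P.spl c ξ)
    {ξ : Fin (d + 1) → ℝ} (hξ : ξ ∈ goodSet P.K) (k : Fin d) :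
    dtGradX v (P.chart ξ) k =
      ∑ a, fderiv ℝ (P.grad c k.castSucc) ξ (Pi.single a 1) * (P.J ξ)⁻¹ a (Fin.last d) := by
  refine P.fderiv_single_of_comp_chart (f := fun y => gradX v y k) (fun η hη => ?_) hξ.1
    (hasFDerivAt_grad P c k.castSucc hξ) (Fin.last d)
  rw [gradX_chart hv hη]
  rfl

end Patch

namespace Patch

variable {d : ℕ} (P : Patch d)

/-! ### Change of variables on the patch -/

/-- The chart with values in the space of coordinates. -/
def coordMap (ξ : Fin (d + 1) → ℝ) : Fin (d + 1) → ℝ := (P.chart ξ).ofLp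

theorem preimage_image_coordMap :
    (MeasurableEquiv.toLp 2 (Fin (d + 1) → ℝ)).symm ⁻¹' (P.coordMap '' cube (d + 1)) = P.dom := by
  rw [dom_eq]
  ext x
  constructor
  · rintro ⟨ξ, hξ, h⟩
    exact ⟨ξ, hξ, (MeasurableEquiv.toLp 2 (Fin (d + 1) → ℝ)).symm.injective h⟩
  · rintro ⟨ξ, hξ, rfl⟩
    exact ⟨ξ, hξ, rfl⟩

theorem hasFDerivWithinAt_coordMap (ξ : Fin (d + 1) → ℝ) (s : Set (Fin (d + 1) → ℝ)) :
    HasFDerivWithinAt P.coordMap (LinearMap.toContinuousLinearMap (Matrix.toLin' (P.J ξ))) s ξ :=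
  ((EuclideanSpace.equiv (Fin (d + 1)) ℝ).hasFDerivAt.comp ξ
    (P.hasFDerivAt_chart ξ)).hasFDerivWithinAt

theorem injOn_coordMap : InjOn P.coordMap (cube (d + 1)) := fun _ hξ _ hη h =>
  P.injOn_chart (cube_subset_Icc _ hξ) (cube_subset_Icc _ hη)
    ((MeasurableEquiv.toLp 2 (Fin (d + 1) → ℝ)).symm.injective h)

theorem integral_dom (f : Pt d → ℝ) :
    ∫ x in P.dom, f x = ∫ ξ in cube (d + 1), |(P.J ξ).det| * f (P.chart ξ) := by
  have mp := EuclideanSpace.volume_preserving_symm_measurableEquiv_toLp (Fin (d + 1))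
  have me := (MeasurableEquiv.toLp 2 (Fin (d + 1) → ℝ)).symm.measurableEmbedding
  have h1 := integral_image_eq_integral_abs_det_fderiv_smul volume (isOpen_cube _).measurableSet
    (fun ξ _ => P.hasFDerivWithinAt_coordMap ξ _) P.injOn_coordMap fun y => f (WithLp.toLp 2 y)
  have h2 := mp.setIntegral_preimage_emb me (fun y => f (WithLp.toLp 2 y))
    (P.coordMap '' cube (d + 1))
  rw [P.preimage_image_coordMap] at h2
  rw [show (∫ x in P.dom, f x) = ∫ y in P.coordMap '' cube (d + 1), f (WithLp.toLp 2 y) from h2, h1]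
  refine setIntegral_congr_fun (isOpen_cube _).measurableSet fun ξ _ => ?_
  simp only [smul_eq_mul, coordMap]
  congr 2
  rw [ContinuousLinearMap.det, LinearMap.coe_toContinuousLinearMap, LinearMap.det_toLin']

/-- The Jacobian determinant has constant sign on the closed cube. -/
theorem exists_sign_det_J : ∃ σ : ℝ, (σ = 1 ∨ σ = -1) ∧
    ∀ ξ ∈ Icc (0 : Fin (d + 1) → ℝ) 1, |(P.J ξ).det| = σ * (P.J ξ).det := by
  have hpre : IsPreconnected (Icc (0 : Fin (d + 1) → ℝ) 1) := (convex_Icc _ _).isPreconnected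
  have hc : ContinuousOn (fun ξ => (P.J ξ).det) (Icc 0 1) :=
    P.continuous_J.matrix_det.continuousOn
  by_cases h : ∀ ξ ∈ Icc (0 : Fin (d + 1) → ℝ) 1, 0 < (P.J ξ).det
  · exact ⟨1, Or.inl rfl, fun ξ hξ => by rw [abs_of_pos (h ξ hξ), one_mul]⟩
  · push Not at h
    obtain ⟨ξ, hξ, h⟩ := h
    refine ⟨-1, Or.inr rfl, fun η hη => ?_⟩
    have : (P.J η).det ≤ 0 := by
      by_contra! hpos
      obtain ⟨ζ, hζ, h0⟩ := hpre.intermediate_value hξ hη hc ⟨h, hpos.le⟩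
      exact P.det_J_ne_zero hζ h0
    rw [abs_of_nonpos this, neg_one_mul]

/-! ### The boundary faces -/

/-- The parametrization of the face `{ξ_k = s}` of the cube, where `f = (k, s)`. -/
def face (f : Fin (d + 1) × Fin 2) (y : Fin d → ℝ) : Fin (d + 1) → ℝ :=
  f.1.insertNth (α := fun _ => ℝ) ((f.2 : ℕ) : ℝ) y

/-- The covector `J^{-⊤} w`; for `w` normal to a face of the cube it is normal to the image. -/
def covec (ξ w : Fin (d + 1) → ℝ) : Pt d := WithLp.toLp 2 (((P.J ξ)⁻¹).transpose.mulVec w)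

/-- The area element of a face. -/
def weight (f : Fin (d + 1) × Fin 2) (y : Fin d → ℝ) : ℝ :=
  |(P.J (face f y)).det| * ‖P.covec (face f y) (Pi.single f.1 1)‖

/-- The parametrization of a boundary face of the patch. -/
def faceMap (f : Fin (d + 1) × Fin 2) (y : Fin d → ℝ) : Pt d := P.chart (face f y)

/-- The relatively open boundary faces of the patch. -/
def faceSet (f : Fin (d + 1) × Fin 2) : Set (Pt d) := P.faceMap f '' cube d

/-- The surface measure of a boundary face of the patch. -/
def faceMeasure (f : Fin (d + 1) × Fin 2) : Measure (Pt d) :=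
  Measure.map (P.faceMap f)
    ((volume.restrict (cube d)).withDensity fun y => ENNReal.ofReal (P.weight f y))

theorem natCast_fin_two_mem_Icc (s : Fin 2) : ((s : ℕ) : ℝ) ∈ Icc (0 : ℝ) 1 := by
  fin_cases s <;> simp

theorem face_mem_Icc {f : Fin (d + 1) × Fin 2} {y : Fin d → ℝ} (hy : y ∈ Icc (0 : Fin d → ℝ) 1) :
    face f y ∈ Icc (0 : Fin (d + 1) → ℝ) 1 :=
  insertNth_mem_Icc_iff.2 ⟨natCast_fin_two_mem_Icc _, hy⟩

theorem face_mem_Icc_of_cube {f : Fin (d + 1) × Fin 2} {y : Fin d → ℝ} (hy : y ∈ cube d) :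
    face f y ∈ Icc (0 : Fin (d + 1) → ℝ) 1 := face_mem_Icc (cube_subset_Icc _ hy)

theorem continuous_face (f : Fin (d + 1) × Fin 2) : Continuous (face (d := d) f) :=
  Continuous.finInsertNth f.1 continuous_const continuous_id

theorem continuous_faceMap (f : Fin (d + 1) × Fin 2) : Continuous (P.faceMap f) :=
  P.continuous_chart.comp (continuous_face f)

theorem face_injective (f : Fin (d + 1) × Fin 2) : Function.Injective (face (d := d) f) := by
  intro y z h
  funext j
  have := congrFun h (f.1.succAbove j)
  simpa [face] using this

theorem injOn_faceMap (f : Fin (d + 1) × Fin 2) : InjOn (P.faceMap f) (cube d) :=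
  fun _ hy _ hz h => face_injective f
    (P.injOn_chart (face_mem_Icc_of_cube hy) (face_mem_Icc_of_cube hz) h)

theorem measurableSet_faceSet (f : Fin (d + 1) × Fin 2) : MeasurableSet (P.faceSet f) :=
  (isOpen_cube d).measurableSet.image_of_continuousOn_injOn (P.continuous_faceMap f).continuousOn
    (P.injOn_faceMap f)

theorem faceMap_mem_closure {f : Fin (d + 1) × Fin 2} {y : Fin d → ℝ} (hy : y ∈ cube d) :
    P.faceMap f y ∈ closure P.dom := P.chart_mem_closure (face_mem_Icc_of_cube hy)

theorem faceSet_subset_closure (f : Fin (d + 1) × Fin 2) : P.faceSet f ⊆ closure P.dom := by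
  rintro _ ⟨y, hy, rfl⟩
  exact P.faceMap_mem_closure hy

theorem param_faceMap {f : Fin (d + 1) × Fin 2} {y : Fin d → ℝ} (hy : y ∈ cube d) :
    P.param (P.faceMap f y) = face f y := P.param_chart (face_mem_Icc_of_cube hy)

theorem pushCovector_eq {ξ : Fin (d + 1) → ℝ} (hξ : ξ ∈ Icc (0 : Fin (d + 1) → ℝ) 1)
    (w : Fin (d + 1) → ℝ) : P.pushCovector ξ w = P.covec ξ w := by
  rw [pushCovector, P.jac_eq hξ, covec]

theorem surface_eq : P.surface = ∑ f, P.faceMeasure f := by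
  rw [surface, Fintype.sum_prod_type]
  refine Finset.sum_congr rfl fun k _ => Finset.sum_congr rfl fun s _ => ?_
  have e : (volume.restrict (cube d)).withDensity (fun y => ENNReal.ofReal
        (|(P.jac (k.insertNth (α := fun _ => ℝ) ((s : ℕ) : ℝ) y)).det| *
          ‖P.pushCovector (k.insertNth (α := fun _ => ℝ) ((s : ℕ) : ℝ) y) (Pi.single k 1)‖)) =
      (volume.restrict (cube d)).withDensity fun y => ENNReal.ofReal (P.weight (k, s) y) := by
    refine withDensity_congr_ae ?_
    filter_upwards [ae_restrict_mem (isOpen_cube d).measurableSet] with y hy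
    have h := face_mem_Icc_of_cube (f := (k, s)) hy
    rw [weight, ← P.pushCovector_eq h, ← P.jac_eq h]
    rfl
  rw [e, faceMeasure]
  refine Measure.map_congr ?_
  refine (withDensity_absolutelyContinuous _ _).ae_eq ?_
  filter_upwards [ae_restrict_mem (isOpen_cube d).measurableSet] with y hy
  exact P.Φbar_eq (face_mem_Icc_of_cube (f := (k, s)) hy)

theorem continuousOn_covec {w : Fin (d + 1) → ℝ} :
    ContinuousOn (fun ξ => P.covec ξ w) (Icc 0 1) := by
  refine (PiLp.continuous_toLp 2 _).comp_continuousOn (continuousOn_pi.2 fun a => ?_)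
  change ContinuousOn (fun ξ => ∑ b, (P.J ξ)⁻¹ b a * w b) _
  exact continuousOn_finsetSum Finset.univ fun b _ =>
    (P.continuousOn_J_inv b a).mul (continuousOn_const (c := w b))

theorem continuousOn_weight (f : Fin (d + 1) × Fin 2) :
    ContinuousOn (P.weight f) (Icc 0 1) := by
  have hm : MapsTo (face (d := d) f) (Icc 0 1) (Icc 0 1) := fun y hy => face_mem_Icc hy
  refine ContinuousOn.mul ?_ ?_
  · exact (P.continuous_J.matrix_det.abs.comp (continuous_face f)).continuousOn
  · exact (P.continuousOn_covec.comp (continuous_face f).continuousOn hm).norm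

theorem weight_nonneg (f : Fin (d + 1) × Fin 2) (y : Fin d → ℝ) : 0 ≤ P.weight f y := by
  unfold weight; positivity

theorem aemeasurable_weight (f : Fin (d + 1) × Fin 2) :
    AEMeasurable (P.weight f) (volume.restrict (cube d)) :=
  ((P.continuousOn_weight f).mono (cube_subset_Icc d)).aemeasurable (isOpen_cube d).measurableSet

theorem faceMeasure_apply (f : Fin (d + 1) × Fin 2) {E : Set (Pt d)} (hE : MeasurableSet E) :
    P.faceMeasure f E = ∫⁻ y in cube d ∩ P.faceMap f ⁻¹' E, ENNReal.ofReal (P.weight f y) := by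
  have hpre : MeasurableSet (P.faceMap f ⁻¹' E) := (P.continuous_faceMap f).measurable hE
  rw [faceMeasure, Measure.map_apply (P.continuous_faceMap f).measurable hE,
    withDensity_apply _ hpre, Measure.restrict_restrict hpre, inter_comm]

instance (f : Fin (d + 1) × Fin 2) : IsFiniteMeasure (P.faceMeasure f) := by
  obtain ⟨M, hM⟩ := isCompact_Icc.exists_bound_of_continuousOn (P.continuousOn_weight f)
  refine ⟨?_⟩
  rw [P.faceMeasure_apply f MeasurableSet.univ, preimage_univ, inter_univ]
  refine (setLIntegral_mono measurable_const (g := fun _ => ENNReal.ofReal M)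
    fun y hy => ?_).trans_lt (by
      rw [setLIntegral_const]
      exact ENNReal.mul_lt_top ENNReal.ofReal_lt_top (volume_cube_ne_top d).lt_top)
  exact ENNReal.ofReal_le_ofReal ((le_abs_self _).trans (hM y (cube_subset_Icc d hy)))

instance : IsFiniteMeasure P.surface := by
  rw [surface_eq]
  infer_instance

theorem faceMeasure_compl_faceSet (f : Fin (d + 1) × Fin 2) :
    P.faceMeasure f (P.faceSet f)ᶜ = 0 := by
  rw [P.faceMeasure_apply f (P.measurableSet_faceSet f).compl]
  have : cube d ∩ P.faceMap f ⁻¹' (P.faceSet f)ᶜ = ∅ := by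
    ext y
    simp only [mem_inter_iff, mem_preimage, mem_compl_iff, mem_empty_iff_false, iff_false, not_and,
      not_not]
    exact fun hy => mem_image_of_mem _ hy
  rw [this, Measure.restrict_empty, lintegral_zero_measure]

/-- The regular part of the boundary: the relatively open faces. -/
def regularBoundary : Set (Pt d) := ⋃ f, P.faceSet f

theorem regularBoundary_subset_closure : P.regularBoundary ⊆ closure P.dom :=
  iUnion_subset fun f => P.faceSet_subset_closure f

theorem ae_mem_regularBoundary : ∀ᵐ x ∂P.surface, x ∈ P.regularBoundary := by
  rw [surface_eq, ae_iff, Measure.finsetSum_apply]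
  refine Finset.sum_eq_zero fun f _ => ?_
  exact measure_mono_null (compl_subset_compl.2 (subset_iUnion P.faceSet f))
    (P.faceMeasure_compl_faceSet f)

theorem ae_mem_closure : ∀ᵐ x ∂P.surface, x ∈ closure P.dom := by
  filter_upwards [P.ae_mem_regularBoundary] with x hx using P.regularBoundary_subset_closure hx

theorem restrict_closure_surface : P.surface.restrict (closure P.dom) = P.surface :=
  Measure.restrict_eq_self_of_ae_mem P.ae_mem_closure

theorem aemeasurable_param : AEMeasurable P.param P.surface := by
  rw [← restrict_closure_surface]
  exact P.continuousOn_param.aemeasurable isClosed_closure.measurableSet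

theorem faceMeasure_le_surface (f : Fin (d + 1) × Fin 2) : P.faceMeasure f ≤ P.surface := by
  rw [surface_eq]
  exact Measure.le_iff.2 fun s _ => by
    rw [Measure.finsetSum_apply]
    exact Finset.single_le_sum (f := fun f => P.faceMeasure f s) (fun _ _ => zero_le)
      (Finset.mem_univ f)

theorem integral_surface {g : Pt d → ℝ} (hg : Integrable g P.surface) :
    ∫ x, g x ∂P.surface = ∑ f, ∫ y in cube d, P.weight f y * g (P.faceMap f y) := by
  have hgf : ∀ f, Integrable g (P.faceMeasure f) := fun f =>
    hg.mono_measure (P.faceMeasure_le_surface f)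
  rw [surface_eq, integral_finsetSum_measure fun f _ => hgf f]
  refine Finset.sum_congr rfl fun f _ => ?_
  rw [faceMeasure, integral_map (P.continuous_faceMap f).aemeasurable (hgf f).aestronglyMeasurable,
    integral_withDensity_eq_integral_toReal_smul₀ (P.aemeasurable_weight f).ennreal_ofReal
      (Eventually.of_forall fun _ => ENNReal.ofReal_lt_top)]
  refine integral_congr_ae (Eventually.of_forall fun y => ?_)
  simp only [ENNReal.toReal_ofReal (P.weight_nonneg f y), smul_eq_mul]

/-! ### The outer unit normal -/

/-- The sign of the outer normal of the unit cube on the face `{ξ_k = s}`. -/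
def faceSign (s : Fin 2) : ℝ := 2 * ((s : ℕ) : ℝ) - 1

theorem cubeNormal_face {f : Fin (d + 1) × Fin 2} {y : Fin d → ℝ} (hy : y ∈ cube d) :
    cubeNormal (face f y) = Pi.single f.1 (faceSign f.2) := by
  obtain ⟨k, s⟩ := f
  funext a
  by_cases ha : a = k
  · subst ha
    fin_cases s <;> simp [cubeNormal, face, faceSign]
    norm_num
  · obtain ⟨j, rfl⟩ := Fin.exists_succAbove_eq ha
    have := hy j (mem_univ j)
    simp [cubeNormal, face, ha, this.1.ne', this.2.ne]

theorem covec_single (ξ : Fin (d + 1) → ℝ) (k : Fin (d + 1)) (s : ℝ) :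
    P.covec ξ (Pi.single k s) = s • P.covec ξ (Pi.single k 1) := by
  ext a
  simp [covec]

theorem covec_apply (ξ : Fin (d + 1) → ℝ) (k a : Fin (d + 1)) :
    P.covec ξ (Pi.single k 1) a = (P.J ξ)⁻¹ k a := by
  simp [covec]

theorem covec_ne_zero {ξ : Fin (d + 1) → ℝ} (hξ : ξ ∈ Icc (0 : Fin (d + 1) → ℝ) 1)
    (k : Fin (d + 1)) : P.covec ξ (Pi.single k 1) ≠ 0 := by
  intro h
  have h1 : ((P.J ξ)⁻¹ * P.J ξ) k k = 0 := by
    rw [Matrix.mul_apply]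
    refine Finset.sum_eq_zero fun a _ => ?_
    rw [← covec_apply, h]
    simp
  rw [Matrix.nonsing_inv_mul _ (P.isUnit_det_J hξ)] at h1
  simp at h1

theorem faceSign_eq (s : Fin 2) : faceSign s = 1 ∨ faceSign s = -1 := by
  fin_cases s <;> simp [faceSign]
  norm_num

theorem normal_faceMap {f : Fin (d + 1) × Fin 2} {y : Fin d → ℝ} (hy : y ∈ cube d) :
    P.normal (P.faceMap f y) = ‖P.covec (face f y) (Pi.single f.1 1)‖⁻¹ • faceSign f.2 •
      P.covec (face f y) (Pi.single f.1 1) := by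
  rw [normal, P.param_faceMap hy, P.pushCovector_eq (face_mem_Icc_of_cube hy), cubeNormal_face hy,
    covec_single, norm_smul]
  have : ‖faceSign f.2‖ = 1 := by
    rcases faceSign_eq f.2 with h | h <;> simp [h]
  rw [this, one_mul]

theorem norm_normal_le (x : Pt d) : ‖P.normal x‖ ≤ 1 := by
  rw [normal, norm_smul, norm_inv, norm_norm]
  exact inv_mul_le_one

theorem norm_normal {x : Pt d} (hx : x ∈ P.regularBoundary) : ‖P.normal x‖ = 1 := by
  obtain ⟨f, y, hy, rfl⟩ := mem_iUnion.1 hx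
  rw [P.normal_faceMap hy, norm_smul, norm_smul, norm_inv, norm_norm]
  have : ‖faceSign f.2‖ = 1 := by
    rcases faceSign_eq f.2 with h | h <;> simp [h]
  rw [this, one_mul]
  exact inv_mul_cancel₀ (norm_ne_zero_iff.2 (P.covec_ne_zero (face_mem_Icc_of_cube hy) _))

theorem measurable_cubeNormal {m : ℕ} : Measurable (cubeNormal (m := m)) := by
  refine measurable_pi_lambda _ fun a => ?_
  unfold cubeNormal
  refine Measurable.ite ?_ measurable_const (Measurable.ite ?_ measurable_const measurable_const)
  · exact measurable_pi_apply a (measurableSet_singleton 0)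
  · exact measurable_pi_apply a (measurableSet_singleton 1)

theorem aemeasurable_normal : AEMeasurable P.normal P.surface := by
  have hinv : ∀ a k, Measurable fun ξ => (P.J ξ)⁻¹ a k := by
    intro a k
    simp only [inv_apply_eq]
    exact P.continuous_J.matrix_det.measurable.inv.mul
      (P.continuous_J.matrix_adjugate.matrix_elem a k).measurable
  have hG : Measurable fun ξ : Fin (d + 1) → ℝ => P.covec ξ (cubeNormal ξ) := by
    refine (PiLp.continuous_toLp 2 _).measurable.comp (measurable_pi_lambda _ fun a => ?_)
    change Measurable fun ξ => ∑ b, (P.J ξ)⁻¹ b a * cubeNormal ξ b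
    exact Finset.measurable_sum _ fun b _ => (hinv b a).mul
      ((measurable_pi_apply b).comp measurable_cubeNormal)
  have := (hG.norm.inv.smul hG).comp_aemeasurable P.aemeasurable_param
  refine this.congr ?_
  filter_upwards [P.ae_mem_closure] with x hx
  simp [normal, P.pushCovector_eq (P.param_mem hx)]

theorem nt_eq (x : Pt d) : P.nt x = P.normal x (Fin.last d) := rfl

theorem abs_nt_le (x : Pt d) : |P.nt x| ≤ 1 :=
  (PiLp.norm_apply_le (P.normal x) (Fin.last d)).trans (P.norm_normal_le x)

theorem norm_nx_le (x : Pt d) : ‖P.nx x‖ ≤ 1 := by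
  refine le_trans ?_ (P.norm_normal_le x)
  rw [EuclideanSpace.norm_eq, EuclideanSpace.norm_eq]
  refine Real.sqrt_le_sqrt ?_
  rw [Fin.sum_univ_castSucc (n := d)]
  simp only [nx, spacePart]
  exact le_add_of_nonneg_right (by positivity)

theorem aemeasurable_nt : AEMeasurable P.nt P.surface :=
  (PiLp.continuous_apply 2 _ (Fin.last d)).measurable.comp_aemeasurable P.aemeasurable_normal

theorem aemeasurable_nx : AEMeasurable P.nx P.surface := by
  have : Continuous (spacePart : Pt d → Sp d) :=
    (PiLp.continuous_toLp 2 _).comp (continuous_pi fun k => PiLp.continuous_apply 2 _ _)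
  exact this.measurable.comp_aemeasurable P.aemeasurable_normal

/-! ### The divergence theorem on a patch -/

theorem aestronglyMeasurable_comp_param {F : Type*} [TopologicalSpace F]
    [TopologicalSpace.PseudoMetrizableSpace F] [SecondCountableTopology F]
    {W : (Fin (d + 1) → ℝ) → F} (hW : ContinuousOn W (Icc 0 1)) :
    AEStronglyMeasurable (fun x => W (P.param x)) P.surface := by
  rw [← restrict_closure_surface]
  exact (hW.comp P.continuousOn_param fun x hx => P.param_mem hx).aestronglyMeasurable
    isClosed_closure.measurableSet

/-- The divergence theorem for the vector field `w e_t`, with `W` the parametric form of `w`. -/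
theorem integral_dom_eq_integral_surface {W : (Fin (d + 1) → ℝ) → ℝ}
    {W' : Fin (d + 1) → (Fin (d + 1) → ℝ) → ℝ} {g : Pt d → ℝ} (hWc : ContinuousOn W (Icc 0 1))
    (hW : ∀ ξ ∈ goodSet P.K,
      ∃ f' : (Fin (d + 1) → ℝ) →L[ℝ] ℝ, HasFDerivAt W f' ξ ∧ ∀ a, f' (Pi.single a 1) = W' a ξ)
    (hW'i : ∀ a, IntegrableOn (W' a) (cube (d + 1)))
    (hg : ∀ ξ ∈ goodSet P.K, g (P.chart ξ) = ∑ a, W' a ξ * (P.J ξ)⁻¹ a (Fin.last d)) :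
    ∫ x in P.dom, g x = ∫ x, W (P.param x) * P.nt x ∂P.surface := by
  obtain ⟨σ, hσ, hdet⟩ := P.exists_sign_det_J
  have hadj : ∀ ξ ∈ Icc (0 : Fin (d + 1) → ℝ) 1, ∀ a k,
      |(P.J ξ).det| * (P.J ξ)⁻¹ a k = σ * (P.J ξ).adjugate a k := by
    intro ξ hξ a k
    rw [hdet ξ hξ, inv_apply_eq]
    field_simp [P.det_J_ne_zero hξ]
  have hint : Integrable (fun x => W (P.param x) * P.nt x) P.surface := by
    obtain ⟨M, hM⟩ := isCompact_Icc.exists_bound_of_continuousOn hWc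
    refine Integrable.of_bound (C := M) ((P.aestronglyMeasurable_comp_param hWc).mul
      P.aemeasurable_nt.aestronglyMeasurable) ?_
    filter_upwards [P.ae_mem_closure] with x hx
    rw [norm_mul]
    have h1 := hM _ (P.param_mem hx)
    calc ‖W (P.param x)‖ * ‖P.nt x‖ ≤ M * 1 :=
          mul_le_mul h1 (P.abs_nt_le x) (norm_nonneg _) ((norm_nonneg _).trans h1)
      _ = M := mul_one M
  have hdiv := integral_cube_adjugate (fun α => (P.K α).finite_breaks.countable)
    P.continuous_J_apply (fun ξ h1 h2 => exists_hasFDerivAt_J P ⟨h1, h2⟩) hWc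
    (fun ξ h1 h2 => hW ξ ⟨h1, h2⟩) hW'i (Fin.last d)
    (fun a => integrableOn_fderiv_adjugate P (Fin.last d) a)
  have hcont : ∀ f : Fin (d + 1) × Fin 2, IntegrableOn (fun y => W (face f y) *
      (P.J (face f y)).adjugate f.1 (Fin.last d)) (cube d) := by
    intro f
    refine IntegrableOn.mono_set (t := Icc 0 1) (ContinuousOn.integrableOn_compact isCompact_Icc ?_)
      (cube_subset_Icc d)
    have hm : MapsTo (face (d := d) f) (Icc 0 1) (Icc 0 1) := fun y hy => face_mem_Icc hy
    exact (hWc.comp (continuous_face f).continuousOn hm).mul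
      ((P.continuous_J.matrix_adjugate.matrix_elem _ _).comp (continuous_face f)).continuousOn
  have hLHS : ∫ x in P.dom, g x = σ * ∫ ξ in cube (d + 1),
      ∑ a, W' a ξ * (P.J ξ).adjugate a (Fin.last d) := by
    rw [integral_dom, ← integral_const_mul]
    refine integral_congr_ae ?_
    filter_upwards [ae_mem_goodSet P.K] with ξ hξ
    rw [hg ξ hξ, Finset.mul_sum, Finset.mul_sum]
    refine Finset.sum_congr rfl fun a _ => ?_
    linear_combination W' a ξ * hadj ξ (cube_subset_Icc _ hξ.1) a (Fin.last d)
  have hRHS : ∀ f : Fin (d + 1) × Fin 2,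
      ∫ y in cube d, P.weight f y * (W (P.param (P.faceMap f y)) * P.nt (P.faceMap f y)) =
        σ * faceSign f.2 * ∫ y in cube d, W (face f y) *
          (P.J (face f y)).adjugate f.1 (Fin.last d) := by
    intro f
    rw [← integral_const_mul]
    refine setIntegral_congr_fun (isOpen_cube d).measurableSet fun y hy => ?_
    have hI := face_mem_Icc_of_cube (f := f) hy
    have hne := norm_ne_zero_iff.2 (P.covec_ne_zero hI f.1)
    simp only [P.param_faceMap hy, nt_eq, P.normal_faceMap hy, weight, PiLp.smul_apply, smul_eq_mul,
      covec_apply]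
    field_simp
    linear_combination W (face f y) * faceSign f.2 * hadj _ hI f.1 (Fin.last d)
  rw [hLHS, hdiv, P.integral_surface hint, Fintype.sum_prod_type, Finset.mul_sum]
  refine Finset.sum_congr rfl fun a _ => ?_
  rw [Fin.sum_univ_two, hRHS, hRHS]
  have e1 : ∀ y : Fin d → ℝ, a.insertNth (α := fun _ => ℝ) 1 y = face (a, 1) y := fun y => by
    simp [face]
  have e0 : ∀ y : Fin d → ℝ, a.insertNth (α := fun _ => ℝ) 0 y = face (a, 0) y := fun y => by
    simp [face]
  simp only [e1, e0]
  rw [integral_sub (hcont (a, 1)) (hcont (a, 0))]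
  simp only [faceSign, Fin.val_zero, Fin.val_one, Nat.cast_zero, Nat.cast_one]
  ring

end Patch

namespace Patch

variable {d : ℕ} (P P' : Patch d)

/-! ### The patch near a regular boundary point -/

theorem face_apply_same (f : Fin (d + 1) × Fin 2) (y : Fin d → ℝ) :
    face f y f.1 = ((f.2 : ℕ) : ℝ) := by simp [face]

theorem face_apply_mem {f : Fin (d + 1) × Fin 2} {y : Fin d → ℝ} (hy : y ∈ cube d)
    {a : Fin (d + 1)} (ha : a ≠ f.1) : face f y a ∈ Ioo (0 : ℝ) 1 := by
  obtain ⟨j, rfl⟩ := Fin.exists_succAbove_eq ha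
  simpa [face] using hy j (mem_univ j)

theorem natCast_fin_two_notMem_Ioo (s : Fin 2) : ((s : ℕ) : ℝ) ∉ Ioo (0 : ℝ) 1 := by
  fin_cases s <;> simp

theorem face_notMem_cube (f : Fin (d + 1) × Fin 2) (y : Fin d → ℝ) :
    face f y ∉ cube (d + 1) := fun h =>
  natCast_fin_two_notMem_Ioo f.2 (face_apply_same f y ▸ h f.1 (mem_univ _))

theorem face_index_eq {f f' : Fin (d + 1) × Fin 2} {y z : Fin d → ℝ}
    (hz : z ∈ cube d) (h : face f y = face f' z) : f = f' := by
  have h1 : f.1 = f'.1 := by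
    by_contra hne
    exact natCast_fin_two_notMem_Ioo f.2 (by
      rw [← face_apply_same f y, h]; exact face_apply_mem hz hne)
  refine Prod.ext h1 ?_
  have := congrFun h f.1
  rw [face_apply_same, h1, face_apply_same] at this
  exact Fin.ext (by exact_mod_cast this)

theorem frontier_dom : frontier P.dom = closure P.dom \ P.dom := P.isOpen_dom.frontier_eq

theorem regularBoundary_subset_frontier : P.regularBoundary ⊆ frontier P.dom := by
  intro x hx
  rw [frontier_dom]
  refine ⟨P.regularBoundary_subset_closure hx, fun h => ?_⟩
  obtain ⟨f, y, hy, rfl⟩ := mem_iUnion.1 hx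
  rw [dom_eq] at h
  obtain ⟨ξ, hξ, he⟩ := h
  have := P.injOn_chart (cube_subset_Icc _ hξ) (face_mem_Icc_of_cube hy) he
  exact face_notMem_cube f y (this ▸ hξ)

theorem eventually_neg_of_hasDerivAt {φ : ℝ → ℝ} {c : ℝ} (h : HasDerivAt φ c 0) (h0 : φ 0 = 0)
    (hc : c < 0) : ∀ᶠ ε in 𝓝[>] (0 : ℝ), φ ε < 0 := by
  have := hasDerivAt_iff_tendsto_slope_zero.1 h
  have h1 : ∀ᶠ ε in 𝓝[>] (0 : ℝ), ε⁻¹ • (φ (0 + ε) - φ 0) < 0 :=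
    (this.mono_left (nhdsWithin_mono _ fun x hx => ne_of_gt hx)).eventually (gt_mem_nhds hc)
  filter_upwards [h1, self_mem_nhdsWithin] with ε h2 h3
  have h3 : 0 < ε := h3
  rw [zero_add, h0, sub_zero, smul_eq_mul] at h2
  by_contra! h4
  exact absurd h2 (not_lt.2 (mul_nonneg (inv_nonneg.2 h3.le) h4))

theorem Dinv_apply_eq_inner (ξ : Fin (d + 1) → ℝ) (s : Pt d) (k : Fin (d + 1)) :
    P.Dinv ξ s k = inner ℝ s (P.covec ξ (Pi.single k 1)) := by
  rw [Dinv_apply, PiLp.inner_apply]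
  simp [covec, Matrix.mulVec, dotProduct]

/-- In parametric coordinates, the direction `s` at a boundary point moves the coordinate normal to
the face by a positive multiple of `s · n`, counted outwards. -/
theorem exists_inner_normal_eq {f : Fin (d + 1) × Fin 2} {y : Fin d → ℝ} (hy : y ∈ cube d)
    (s : Pt d) : ∃ r > 0, faceSign f.2 * P.Dinv (face f y) s f.1 =
      r * inner ℝ s (P.normal (P.faceMap f y)) := by
  have hn := norm_pos_iff.2 (P.covec_ne_zero (face_mem_Icc_of_cube (f := f) hy) f.1)
  refine ⟨_, hn, ?_⟩
  rw [P.normal_faceMap hy, inner_smul_right, inner_smul_right, Dinv_apply_eq_inner]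
  field_simp

/-- The local inverse of the chart along the ray `x + ε s` from a regular boundary point `x`. -/
theorem exists_curve {f : Fin (d + 1) × Fin 2} {y : Fin d → ℝ} (hy : y ∈ cube d) (s : Pt d) :
    ∃ γ : ℝ → (Fin (d + 1) → ℝ), HasDerivAt γ (P.Dinv (face f y) s) 0 ∧ γ 0 = face f y ∧
      (∀ᶠ ε in 𝓝 (0 : ℝ), P.chart (γ ε) = P.faceMap f y + ε • s) ∧
      ∀ᶠ ε in 𝓝 (0 : ℝ), P.faceMap f y + ε • s ∈ closure P.dom →
        γ ε = P.param (P.faceMap f y + ε • s) := by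
  have hI := face_mem_Icc_of_cube (f := f) hy
  obtain ⟨g, hg, hgξ, hgl, hgr⟩ := P.exists_localInverse hI
  have hline : HasDerivAt (fun ε : ℝ => P.faceMap f y + ε • s) s 0 := by
    simpa using ((hasDerivAt_id (0 : ℝ)).smul_const s).const_add (P.faceMap f y)
  have hx0 : P.faceMap f y + (0 : ℝ) • s = P.chart (face f y) := by simp [faceMap]
  have hlim : Tendsto (fun ε : ℝ => P.faceMap f y + ε • s) (𝓝 0) (𝓝 (P.chart (face f y))) :=
    hx0 ▸ hline.continuousAt.tendsto
  have hparam : ∀ᶠ z in 𝓝[closure P.dom] (P.chart (face f y)), g z = P.param z := by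
    have hc := P.continuousOn_param _ (P.chart_mem_closure hI)
    rw [ContinuousWithinAt, P.param_chart hI] at hc
    filter_upwards [hc.eventually hgl, self_mem_nhdsWithin] with z hz hz'
    rwa [P.chart_param hz'] at hz
  exact ⟨fun ε => g (P.faceMap f y + ε • s),
    HasFDerivAt.comp_hasDerivAt (f := fun ε : ℝ => P.faceMap f y + ε • s) (0 : ℝ)
      (by rwa [hx0]) hline, by simp only [hx0, hgξ], hlim.eventually hgr,
    hlim.eventually (eventually_nhdsWithin_iff.1 hparam)⟩

/-- A direction pointing inwards at a regular boundary point enters the patch. -/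
theorem eventually_mem_dom {x s : Pt d} (hx : x ∈ P.regularBoundary)
    (hs : inner ℝ s (P.normal x) < 0) : ∀ᶠ ε in 𝓝[>] (0 : ℝ), x + ε • s ∈ P.dom := by
  obtain ⟨f, y, hy, rfl⟩ := mem_iUnion.1 hx
  obtain ⟨r, hr, hrs⟩ := P.exists_inner_normal_eq (f := f) hy s
  obtain ⟨γ, hγ, h0, hright, -⟩ := P.exists_curve (f := f) hy s
  have hneg : ∀ᶠ ε in 𝓝[>] (0 : ℝ), faceSign f.2 * (γ ε f.1 - face f y f.1) < 0 := by
    refine eventually_neg_of_hasDerivAt (c := faceSign f.2 * P.Dinv (face f y) s f.1)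
      (((hasDerivAt_pi.1 hγ f.1).sub_const _).const_mul _) (by rw [h0, sub_self, mul_zero]) ?_
    rw [hrs]
    exact mul_neg_of_pos_of_neg hr hs
  have hclose : ∀ᶠ ε in 𝓝 (0 : ℝ), ∀ a, |γ ε a - face f y a| < 1 ∧
      (a ≠ f.1 → γ ε a ∈ Ioo (0 : ℝ) 1) := by
    refine eventually_all.2 fun a => ?_
    have ha : Tendsto (fun ε : ℝ => γ ε a) (𝓝 0) (𝓝 (face f y a)) := by
      have := tendsto_pi_nhds.1 hγ.continuousAt.tendsto a
      rwa [h0] at this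
    refine Eventually.and ?_ ?_
    · have := (ha.sub_const (face f y a)).abs
      rw [sub_self, abs_zero] at this
      exact this.eventually (gt_mem_nhds one_pos)
    · by_cases hne : a = f.1
      · exact Eventually.of_forall fun _ h => absurd hne h
      · filter_upwards [ha.eventually (isOpen_Ioo.mem_nhds (face_apply_mem hy hne))] with ε hε _
        exact hε
  filter_upwards [hneg, nhdsWithin_le_nhds hclose, nhdsWithin_le_nhds hright] with ε h1 h2 h3
  rw [← h3]
  refine P.chart_mem_dom fun a _ => ?_
  by_cases ha : a = f.1
  · subst ha
    have h4 := abs_lt.1 (h2 f.1).1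
    rw [face_apply_same] at h1 h4
    obtain ⟨k, s⟩ := f
    fin_cases s
    · simp [faceSign] at h1 h4 ⊢
      exact ⟨h1, by linarith⟩
    · simp [faceSign] at h1 h4 ⊢
      constructor <;> linarith
  · exact (h2 a).2 ha

/-- A direction pointing outwards at a regular boundary point leaves the closed patch. -/
theorem eventually_notMem_closure {x s : Pt d} (hx : x ∈ P.regularBoundary)
    (hs : 0 < inner ℝ s (P.normal x)) : ∀ᶠ ε in 𝓝[>] (0 : ℝ), x + ε • s ∉ closure P.dom := by
  obtain ⟨f, y, hy, rfl⟩ := mem_iUnion.1 hx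
  obtain ⟨r, hr, hrs⟩ := P.exists_inner_normal_eq (f := f) hy s
  obtain ⟨γ, hγ, h0, -, hparam⟩ := P.exists_curve (f := f) hy s
  have hpos : ∀ᶠ ε in 𝓝[>] (0 : ℝ), -(faceSign f.2 * (γ ε f.1 - face f y f.1)) < 0 := by
    refine eventually_neg_of_hasDerivAt (c := -(faceSign f.2 * P.Dinv (face f y) s f.1))
      (((hasDerivAt_pi.1 hγ f.1).sub_const _).const_mul _).neg
      (by rw [h0, sub_self, mul_zero, neg_zero]) ?_
    rw [hrs]
    exact neg_neg_of_pos (mul_pos hr hs)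
  filter_upwards [hpos, nhdsWithin_le_nhds hparam] with ε h1 h2 h3
  have h4 := P.param_mem h3
  rw [← h2 h3] at h4
  have h5 : 0 ≤ γ ε f.1 := h4.1 f.1
  have h6 : γ ε f.1 ≤ 1 := h4.2 f.1
  rw [face_apply_same] at h1
  obtain ⟨k, s⟩ := f
  fin_cases s
  · simp [faceSign] at h1 h5 h6
    linarith
  · simp [faceSign] at h1 h5 h6
    linarith

variable {P P'}

/-- Disjoint patches have opposite normals at common regular boundary points: otherwise some
direction would point into both patches. -/
theorem normal_eq_neg (hdis : Disjoint P.dom P'.dom) {x : Pt d} (hx : x ∈ P.regularBoundary)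
    (hx' : x ∈ P'.regularBoundary) : P'.normal x = -P.normal x := by
  have h1 := P.norm_normal hx
  have h2 := P'.norm_normal hx'
  by_contra hne
  have h3 : P.normal x + P'.normal x ≠ 0 := fun h => hne (eq_neg_of_add_eq_zero_right h)
  have h4 : 0 < ‖P.normal x + P'.normal x‖ ^ 2 := by positivity
  rw [norm_add_sq_real, h1, h2] at h4
  have h5 : inner ℝ (-(P.normal x + P'.normal x)) (P.normal x) < 0 := by
    rw [inner_neg_left, inner_add_left, real_inner_self_eq_norm_sq, h1, real_inner_comm]
    linarith
  have h6 : inner ℝ (-(P.normal x + P'.normal x)) (P'.normal x) < 0 := by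
    rw [inner_neg_left, inner_add_left, real_inner_self_eq_norm_sq, h2]
    linarith
  obtain ⟨ε, h7, h8⟩ := ((P.eventually_mem_dom hx h5).and (P'.eventually_mem_dom hx' h6)).exists
  exact disjoint_left.1 hdis h7 h8

theorem nt_eq_neg (hdis : Disjoint P.dom P'.dom) {x : Pt d} (hx : x ∈ P.regularBoundary)
    (hx' : x ∈ P'.regularBoundary) : P'.nt x = -P.nt x := by
  rw [nt_eq, nt_eq, normal_eq_neg hdis hx hx']
  rfl

/-! ### The singular part of the boundary is a null set -/

/-- The surface measure is absolutely continuous with respect to the `d`-dimensional Hausdorff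
measure: the face is recovered from its image by a Lipschitz map. -/
theorem faceMeasure_eq_zero_of_hausdorff {E : Set (Pt d)} (hE : MeasurableSet E)
    (h0 : μH[(d : ℝ)] E = 0) (f : Fin (d + 1) × Fin 2) : P.faceMeasure f E = 0 := by
  rw [P.faceMeasure_apply f hE]
  have hv : volume (cube d ∩ P.faceMap f ⁻¹' E) = 0 := by
    obtain ⟨c, hc, h⟩ := P.exists_antilipschitz
    have hl : LipschitzOnWith (Real.toNNReal c⁻¹) (fun x => f.1.removeNth (P.param x))
        (closure P.dom) := by
      refine LipschitzOnWith.of_dist_le_mul fun x hx y hy => ?_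
      have := h _ (P.param_mem hx) _ (P.param_mem hy)
      rw [P.chart_param hx, P.chart_param hy] at this
      rw [Real.coe_toNNReal _ (by positivity), inv_mul_eq_div, le_div_iff₀ hc]
      have h2 : dist (f.1.removeNth (P.param x)) (f.1.removeNth (P.param y)) ≤
          dist (P.param x) (P.param y) :=
        (dist_pi_le_iff dist_nonneg).2 fun j => dist_le_pi_dist (P.param x) (P.param y) _
      nlinarith
    have hsub : cube d ∩ P.faceMap f ⁻¹' E ⊆
        (fun x => f.1.removeNth (P.param x)) '' (E ∩ closure P.dom) := by
      rintro y ⟨hy, hyE⟩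
      refine ⟨P.faceMap f y, ⟨hyE, P.faceMap_mem_closure hy⟩, ?_⟩
      simp [P.param_faceMap hy, face]
    have := (hl.mono inter_subset_right).hausdorffMeasure_image_le (s := E ∩ closure P.dom)
      (d := (d : ℝ)) (by positivity)
    rw [measure_mono_null inter_subset_left h0, mul_zero] at this
    have h3 : μH[(d : ℝ)] (cube d ∩ P.faceMap f ⁻¹' E) = 0 :=
      measure_mono_null hsub (le_antisymm this zero_le)
    have h4 := hausdorffMeasure_pi_real (ι := Fin d)
    rw [Fintype.card_fin] at h4
    rwa [h4] at h3
  rw [Measure.restrict_eq_zero.2 hv, lintegral_zero_measure]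

/-- Images of faces of codimension two have Hausdorff dimension at most `d - 1`. -/
theorem hausdorffMeasure_image_codim_two {a b : Fin (d + 1)} (hab : a ≠ b) (s t : ℝ) :
    μH[(d : ℝ)] (P.chart '' {ξ | ξ a = s ∧ ξ b = t}) = 0 := by
  classical
  let g : ({c // c ≠ a ∧ c ≠ b} → ℝ) → (Fin (d + 1) → ℝ) := fun z c =>
    if h : c ≠ a ∧ c ≠ b then z ⟨c, h⟩ else if c = a then s else t
  have hg : ContDiff ℝ 1 g := by
    refine contDiff_pi.2 fun c => ?_
    by_cases h : c ≠ a ∧ c ≠ b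
    · simp only [g, dif_pos h]
      exact contDiff_apply ℝ ℝ (⟨c, h⟩ : {c // c ≠ a ∧ c ≠ b})
    · simp only [g, dif_neg h]
      exact contDiff_const
  have hdim := (P.contDiff_chart.comp hg).dimH_range_le
  rw [Module.finrank_fintype_fun_eq_card] at hdim
  have hcard : Fintype.card {c // c ≠ a ∧ c ≠ b} < d := by
    rw [Fintype.card_subtype]
    have : (Finset.univ.filter fun c => c ≠ a ∧ c ≠ b) = (Finset.univ.erase a).erase b := by
      ext c
      simp [and_comm]
    rw [this, Finset.card_erase_of_mem (by simp [hab.symm]), Finset.card_erase_of_mem (by simp)]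
    have := a.2
    have := b.2
    have : (a : ℕ) ≠ b := fun h => hab (Fin.ext h)
    simp only [Finset.card_univ, Fintype.card_fin]
    omega
  have h0 := hausdorffMeasure_of_dimH_lt (d := (d : NNReal))
    (hdim.trans_lt (by exact_mod_cast hcard))
  refine measure_mono_null ?_ h0
  rintro _ ⟨ξ, ⟨h1, h2⟩, rfl⟩
  refine ⟨fun c => ξ c, ?_⟩
  simp only [Function.comp]
  congr 1
  funext c
  by_cases h : c ≠ a ∧ c ≠ b
  · simp [g, h]
  · simp only [g, dif_neg h]
    by_cases hc : c = a
    · simp [hc, h1]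
    · have : c = b := by
        by_contra hb
        exact h ⟨hc, hb⟩
      simp [this, hab.symm, h2]

/-- A boundary point outside the open faces lies on two faces of the cube. -/
theorem frontier_diff_subset : frontier P.dom \ P.regularBoundary ⊆
    ⋃ (a : Fin (d + 1)) (b : Fin (d + 1)) (_ : a ≠ b) (s : Fin 2) (t : Fin 2),
      P.chart '' (Icc 0 1 ∩ {ξ | ξ a = ((s : ℕ) : ℝ) ∧ ξ b = ((t : ℕ) : ℝ)}) := by
  rintro x ⟨hx, hxR⟩
  rw [frontier_dom, closure_dom] at hx
  obtain ⟨⟨ξ, hξ, rfl⟩, hx⟩ := hx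
  have hend : ∀ a, ξ a ∉ Ioo (0 : ℝ) 1 → ∃ s : Fin 2, ξ a = ((s : ℕ) : ℝ) := by
    intro a ha
    have h0 : 0 ≤ ξ a := hξ.1 a
    have h1 : ξ a ≤ 1 := hξ.2 a
    rcases h0.eq_or_lt with h | h
    · exact ⟨0, by simp [← h]⟩
    rcases h1.eq_or_lt with h' | h'
    · exact ⟨1, by simp [h']⟩
    · exact absurd ⟨h, h'⟩ ha
  have hnc : ξ ∉ cube (d + 1) := fun h => hx (P.chart_mem_dom h)
  simp only [cube, mem_univ_pi, not_forall] at hnc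
  obtain ⟨a, ha⟩ := hnc
  obtain ⟨s, hs⟩ := hend a ha
  have hb : ∃ b, a ≠ b ∧ ξ b ∉ Ioo (0 : ℝ) 1 := by
    by_contra! hb
    refine hxR (mem_iUnion.2 ⟨(a, s), a.removeNth ξ, fun j _ => ?_, ?_⟩)
    · exact hb _ (Fin.succAbove_ne a j).symm
    · simp [faceMap, face, ← hs]
  obtain ⟨b, hab, hb⟩ := hb
  obtain ⟨t, ht⟩ := hend b hb
  simp only [mem_iUnion]
  exact ⟨a, b, hab, s, t, ξ, ⟨hξ, hs, ht⟩, rfl⟩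

variable (P P') in
theorem surface_frontier_diff_eq_zero : P.surface (frontier P'.dom \ P'.regularBoundary) = 0 := by
  refine measure_mono_null frontier_diff_subset ?_
  simp only [measure_iUnion_null_iff]
  intro a b hab s t
  have hclosed : IsClosed {ξ : Fin (d + 1) → ℝ | ξ a = ((s : ℕ) : ℝ) ∧ ξ b = ((t : ℕ) : ℝ)} :=
    (isClosed_eq (continuous_apply a) continuous_const).inter
      (isClosed_eq (continuous_apply b) continuous_const)
  have hcomp := ((isCompact_Icc (a := (0 : Fin (d + 1) → ℝ)) (b := 1)).inter_right hclosed).image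
    P'.continuous_chart
  rw [surface_eq, Measure.finsetSum_apply]
  refine Finset.sum_eq_zero fun f _ => faceMeasure_eq_zero_of_hausdorff hcomp.measurableSet ?_ f
  exact measure_mono_null (image_mono inter_subset_right) (hausdorffMeasure_image_codim_two hab _ _)

end Patch

namespace Patch

variable {d : ℕ} {P P' : Patch d}

/-! ### The two surface measures on a common facet -/

/-- At a common regular boundary point of disjoint patches, the conormals of the two
parametrizations are parallel. -/
theorem exists_covec_eq_smul (hdis : Disjoint P.dom P'.dom) {f f' : Fin (d + 1) × Fin 2}
    {y z : Fin d → ℝ} (hy : y ∈ cube d) (hz : z ∈ cube d) (h : P'.faceMap f' z = P.faceMap f y) :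
    ∃ r : ℝ, |r| * ‖P'.covec (face f' z) (Pi.single f'.1 1)‖ =
        ‖P.covec (face f y) (Pi.single f.1 1)‖ ∧
      P.covec (face f y) (Pi.single f.1 1) = r • P'.covec (face f' z) (Pi.single f'.1 1) := by
  have hx : P.faceMap f y ∈ P.regularBoundary := mem_iUnion.2 ⟨f, y, hy, rfl⟩
  have hx' : P.faceMap f y ∈ P'.regularBoundary := mem_iUnion.2 ⟨f', z, hz, h⟩
  have hn := normal_eq_neg hdis hx hx'
  rw [P.normal_faceMap hy, ← h, P'.normal_faceMap hz] at hn
  set u := P.covec (face f y) (Pi.single f.1 1) with hu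
  set u' := P'.covec (face f' z) (Pi.single f'.1 1) with hu'
  have h0 : ‖u‖ ≠ 0 := norm_ne_zero_iff.2 (P.covec_ne_zero (face_mem_Icc_of_cube hy) f.1)
  have h0' : ‖u'‖ ≠ 0 := norm_ne_zero_iff.2 (P'.covec_ne_zero (face_mem_Icc_of_cube hz) f'.1)
  have hsq : faceSign f.2 * faceSign f.2 = 1 := by
    rcases faceSign_eq f.2 with h | h <;> simp [h]
  have key : u = (-(‖u‖ * faceSign f.2 * ‖u'‖⁻¹ * faceSign f'.2)) • u' := by
    have h2 : (‖u‖ * faceSign f.2) • (‖u'‖⁻¹ • faceSign f'.2 • u') =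
        (‖u‖ * faceSign f.2) • -(‖u‖⁻¹ • faceSign f.2 • u) := by rw [hn]
    rw [smul_neg, smul_smul, smul_smul, smul_smul, smul_smul,
      show ‖u‖ * faceSign f.2 * ‖u‖⁻¹ * faceSign f.2 =
        (‖u‖ * ‖u‖⁻¹) * (faceSign f.2 * faceSign f.2) by ring, mul_inv_cancel₀ h0, hsq, one_mul,
      one_smul] at h2
    rw [neg_smul, h2, neg_neg]
  refine ⟨_, ?_, key⟩
  conv_rhs => rw [key]
  rw [norm_smul, Real.norm_eq_abs]

/-- Minors of `G` and entries of the adjugate matrix agree up to sign. -/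
theorem det_submatrix_succAbove {n : ℕ} (G : Matrix (Fin (n + 1)) (Fin (n + 1)) ℝ)
    (a b : Fin (n + 1)) : |(G.submatrix a.succAbove b.succAbove).det| = |G.adjugate b a| := by
  rw [Matrix.adjugate_fin_succ_eq_det_submatrix, abs_mul, abs_pow, abs_neg, abs_one, one_pow,
    one_mul]

/-- Where the boundaries of two disjoint patches meet, the area elements of the two
parametrizations are related by the Jacobian determinant of the transition map. -/
theorem abs_det_mul_weight (hdis : Disjoint P.dom P'.dom) {f f' : Fin (d + 1) × Fin 2}
    {y z : Fin d → ℝ} (hy : y ∈ cube d) (hz : z ∈ cube d) (h : P'.faceMap f' z = P.faceMap f y) :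
    |(((P'.J (face f' z))⁻¹ * P.J (face f y)).submatrix f'.1.succAbove f.1.succAbove).det| *
      P'.weight f' z = P.weight f y := by
  obtain ⟨r, hr, hcov⟩ := exists_covec_eq_smul hdis hy hz h
  have hI := P.isUnit_det_J (face_mem_Icc_of_cube (f := f) hy)
  have hI' := P'.isUnit_det_J (face_mem_Icc_of_cube (f := f') hz)
  set A := P.J (face f y) with hA
  set A' := P'.J (face f' z) with hA'
  -- The entry of the inverse transition matrix across the face is the ratio of the conormals.
  -- By Cramer's rule it determines the tangential minor of the transition matrix.
  have hentry : (A⁻¹ * A') f.1 f'.1 = r := by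
    have h1 : ∀ b, A⁻¹ f.1 b = r * A'⁻¹ f'.1 b := fun b => by
      rw [hA, hA', ← covec_apply, ← covec_apply, hcov]
      rfl
    have h2 : (A'⁻¹ * A') f'.1 f'.1 = 1 := by rw [Matrix.nonsing_inv_mul _ hI']; simp
    rw [Matrix.mul_apply] at h2 ⊢
    simp only [h1, mul_assoc, ← Finset.mul_sum, h2, mul_one]
  have hinv : (A'⁻¹ * A)⁻¹ = A⁻¹ * A' := by
    rw [Matrix.mul_inv_rev, Matrix.nonsing_inv_nonsing_inv _ hI']
  have hdet : (A'⁻¹ * A).det = A'.det⁻¹ * A.det := by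
    rw [Matrix.det_mul, Matrix.det_nonsing_inv, Ring.inverse_eq_inv']
  have hadj : (A'⁻¹ * A).adjugate f.1 f'.1 = A'.det⁻¹ * A.det * r := by
    have h1 := inv_apply_eq (A'⁻¹ * A) f.1 f'.1
    rw [hinv, hentry, hdet] at h1
    rw [h1, mul_inv_cancel_left₀ (mul_ne_zero (inv_ne_zero hI'.ne_zero) hI.ne_zero)]
  rw [det_submatrix_succAbove, hadj, weight, weight, ← hA, ← hA', ← hr, abs_mul, abs_mul, abs_inv]
  have := abs_ne_zero.2 hI'.ne_zero
  field_simp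

/-- Where the boundaries of two disjoint patches meet, the surface measures of the two sides agree.
The transition map between the two parametrizations is only defined on a closed set, but it has a
derivative within this set, which is all that the change of variables needs. -/
theorem restrict_faceMeasure_eq (hdis : Disjoint P.dom P'.dom) (f f' : Fin (d + 1) × Fin 2) :
    (P.faceMeasure f).restrict (P'.faceSet f') = (P'.faceMeasure f').restrict (P.faceSet f) := by
  ext E hE
  have hm := P.measurableSet_faceSet f
  have hm' := P'.measurableSet_faceSet f'
  rw [Measure.restrict_apply hE, Measure.restrict_apply hE, faceMeasure_apply _ _ (hE.inter hm'),
    faceMeasure_apply _ _ (hE.inter hm)]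
  set A := cube d ∩ P.faceMap f ⁻¹' (E ∩ P'.faceSet f') with hA
  have hAm : MeasurableSet A := (isOpen_cube d).measurableSet.inter
    ((P.continuous_faceMap f).measurable (hE.inter hm'))
  -- `τ` is the transition map between the two parametrizations.
  set τ : (Fin d → ℝ) → (Fin d → ℝ) := fun y => f'.1.removeNth (P'.param (P.faceMap f y)) with hτ
  have hτs : ∀ y ∈ A, τ y ∈ cube d ∧ P'.faceMap f' (τ y) = P.faceMap f y ∧
      P'.param (P.faceMap f y) = face f' (τ y) := by
    rintro y ⟨hy, hyE, z, hz, hzy⟩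
    have e : τ y = z := by simp [hτ, ← hzy, P'.param_faceMap hz, face]
    rw [e, ← hzy, P'.param_faceMap hz]
    exact ⟨hz, rfl, rfl⟩
  have himg : τ '' A = cube d ∩ P'.faceMap f' ⁻¹' (E ∩ P.faceSet f) := by
    ext z
    constructor
    · rintro ⟨y, hy, rfl⟩
      obtain ⟨h1, h2, -⟩ := hτs y hy
      refine ⟨h1, ?_⟩
      rw [mem_preimage, h2]
      exact ⟨hy.2.1, mem_image_of_mem _ hy.1⟩
    · rintro ⟨hz, hzE, y, hy, hyz⟩
      refine ⟨y, ⟨hy, ?_⟩, ?_⟩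
      · rw [mem_preimage, hyz]
        exact ⟨hzE, mem_image_of_mem _ hz⟩
      · simp [hτ, hyz, P'.param_faceMap hz, face]
  have hinj : InjOn τ A := by
    intro y hy z hz h
    refine P.injOn_faceMap f hy.1 hz.1 ?_
    rw [← (hτs y hy).2.1, ← (hτs z hz).2.1, h]
  set G : (Fin d → ℝ) → Matrix (Fin d) (Fin d) ℝ := fun y =>
    ((P'.J (face f' (τ y)))⁻¹ * P.J (face f y)).submatrix f'.1.succAbove f.1.succAbove with hG
  have hder : ∀ y ∈ A, HasFDerivWithinAt τ
      (LinearMap.toContinuousLinearMap (Matrix.toLin' (G y))) A y := by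
    intro y hy
    obtain ⟨h1, h2, h3⟩ := hτs y hy
    have hface : HasFDerivAt (face (d := d) f) (ContinuousLinearMap.pi fun a =>
        f.1.insertNth (α := fun _ => (Fin d → ℝ) →L[ℝ] ℝ) 0
          (fun j => ContinuousLinearMap.proj j) a) y := by
      rw [hasFDerivAt_pi, Fin.forall_iff_succAbove f.1]
      constructor
      · simpa [face] using hasFDerivAt_const _ _
      · intro j
        simpa [face] using hasFDerivAt_apply j y
    have hmap : HasFDerivAt (P.faceMap f) _ y := (P.hasFDerivAt_chart (face f y)).comp y hface
    have hmaps : MapsTo (P.faceMap f) A (closure P'.dom) := fun z hz =>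
      P'.faceSet_subset_closure f' hz.2.2
    have hpar := (P'.hasFDerivWithinAt_param (hmaps hy)).comp y hmap.hasFDerivWithinAt hmaps
    rw [h3] at hpar
    rw [hasFDerivWithinAt_pi']
    intro j
    refine (hasFDerivWithinAt_pi'.1 hpar (f'.1.succAbove j)).congr_fderiv ?_
    ext v
    simp only [ContinuousLinearMap.comp_apply, ContinuousLinearMap.proj_apply, Dinv_apply, D_apply,
      LinearMap.coe_toContinuousLinearMap', Matrix.toLin'_apply, Matrix.mulVec_mulVec]
    simp only [Matrix.mulVec, dotProduct, hG, Matrix.submatrix_apply]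
    rw [Fin.sum_univ_succAbove _ f.1]
    simp
  rw [← himg, lintegral_image_eq_lintegral_abs_det_fderiv_mul volume hAm hder hinj]
  refine setLIntegral_congr_fun hAm fun y hy => ?_
  obtain ⟨h1, h2, -⟩ := hτs y hy
  rw [← abs_det_mul_weight hdis hy.1 h1 h2, ENNReal.ofReal_mul (abs_nonneg _),
    ContinuousLinearMap.det, LinearMap.coe_toContinuousLinearMap, LinearMap.det_toLin']

theorem disjoint_faceSet {f f' : Fin (d + 1) × Fin 2} (h : f ≠ f') :
    Disjoint (P.faceSet f) (P.faceSet f') := by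
  rw [disjoint_left]
  rintro _ ⟨y, hy, rfl⟩ ⟨z, hz, hzy⟩
  exact h.symm (face_index_eq hy
    (P.injOn_chart (face_mem_Icc_of_cube hz) (face_mem_Icc_of_cube hy) hzy))

theorem restrict_regularBoundary (μ : Measure (Pt d)) :
    μ.restrict P.regularBoundary = ∑ f, μ.restrict (P.faceSet f) := by
  rw [regularBoundary, Measure.restrict_iUnion (fun f f' h => disjoint_faceSet h)
    fun f => P.measurableSet_faceSet f, Measure.sum_fintype]

theorem restrict_surface_regularBoundary_eq (hdis : Disjoint P.dom P'.dom) :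
    P.surface.restrict P'.regularBoundary = P'.surface.restrict P.regularBoundary := by
  have h : ∀ (ν : Fin (d + 1) × Fin 2 → Measure (Pt d)) (s : Set (Pt d)),
      (∑ f, ν f).restrict s = ∑ f, (ν f).restrict s := fun ν s =>
    map_sum (Measure.restrictₗ s) ν Finset.univ
  rw [restrict_regularBoundary, restrict_regularBoundary, surface_eq, surface_eq]
  simp only [h]
  rw [Finset.sum_comm]
  exact Finset.sum_congr rfl fun f _ => Finset.sum_congr rfl fun f' _ =>
    restrict_faceMeasure_eq hdis f f'

variable (P P') in
theorem ae_mem_regularBoundary_of_mem_frontier :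
    ∀ᵐ x ∂P.surface, x ∈ frontier P'.dom → x ∈ P'.regularBoundary := by
  rw [ae_iff]
  refine measure_mono_null (fun x hx => ?_) (surface_frontier_diff_eq_zero P P')
  simpa using hx

variable (P P') in
theorem restrict_surface_frontier_eq :
    P.surface.restrict (frontier P.dom ∩ frontier P'.dom) =
      P.surface.restrict P'.regularBoundary := by
  refine Measure.restrict_congr_set (Filter.eventuallyEq_set.2 ?_)
  filter_upwards [ae_mem_regularBoundary_of_mem_frontier P P', P.ae_mem_regularBoundary]
    with x h1 h2
  exact ⟨fun h => h1 h.2, fun h => ⟨P.regularBoundary_subset_frontier h2,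
    P'.regularBoundary_subset_frontier h⟩⟩

/-- The two sides induce the same surface measure on a common facet. -/
theorem restrict_surface_facet_eq (hdis : Disjoint P.dom P'.dom) :
    P.surface.restrict (frontier P.dom ∩ frontier P'.dom) =
      P'.surface.restrict (frontier P'.dom ∩ frontier P.dom) := by
  rw [restrict_surface_frontier_eq, restrict_surface_frontier_eq,
    restrict_surface_regularBoundary_eq hdis]

end Patch

namespace MultiPatch

variable {d N : ℕ} (M : MultiPatch d N)

/-! ### Facets of the multi-patch domain -/

theorem facet_comm (i j : Fin N) : M.facet i j = M.facet j i := inter_comm _ _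

theorem measurableSet_facet (i j : Fin N) : MeasurableSet (M.facet i j) :=
  isClosed_frontier.measurableSet.inter isClosed_frontier.measurableSet

theorem restrict_surface_facet {i j : Fin N} (hij : i ≠ j) :
    (M.patch j).surface.restrict (M.facet i j) = (M.patch i).surface.restrict (M.facet i j) := by
  rw [facet, Patch.restrict_surface_facet_eq (M.disjoint i j hij), inter_comm]

/-- Almost every boundary point of a patch is regular for all the patches whose boundary contains
it. -/
theorem ae_regular (i : Fin N) : ∀ᵐ x ∂(M.patch i).surface, x ∈ (M.patch i).regularBoundary ∧
    ∀ j, x ∈ M.facet i j → x ∈ (M.patch j).regularBoundary := by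
  refine (M.patch i).ae_mem_regularBoundary.and (ae_all_iff.2 fun j => ?_)
  filter_upwards [Patch.ae_mem_regularBoundary_of_mem_frontier (M.patch i) (M.patch j)] with x h hx
  exact h hx.2

/-- Interior facets do not overlap: three unit normals cannot be opposite in pairs. -/
theorem notMem_facet_of_mem {i j k : Fin N} {x : Pt d} (hij : i ≠ j) (hik : i ≠ k) (hjk : j ≠ k)
    (hi : x ∈ (M.patch i).regularBoundary) (hj : x ∈ (M.patch j).regularBoundary)
    (hk : x ∈ (M.patch k).regularBoundary) : False := by
  have h1 := Patch.normal_eq_neg (M.disjoint i j hij) hi hj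
  have h2 := Patch.normal_eq_neg (M.disjoint i k hik) hi hk
  have h3 := Patch.normal_eq_neg (M.disjoint j k hjk) hj hk
  rw [h1, h2, neg_neg] at h3
  have h4 := (M.patch i).norm_normal hi
  have h5 := real_inner_self_eq_norm_sq ((M.patch i).normal x)
  nth_rw 1 [← h3] at h5
  rw [inner_neg_left, real_inner_self_eq_norm_sq, h4] at h5
  norm_num at h5

/-- Regular boundary points of a patch on no interior facet lie on the boundary of the space-time
domain: just outside the patch there would be points of finitely many other patches. -/
theorem mem_frontier_Q {i : Fin N} {x : Pt d} (hx : x ∈ (M.patch i).regularBoundary)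
    (hF : ∀ j, j ≠ i → x ∉ M.facet i j) : x ∈ frontier M.Q := by
  have hopen : IsOpen M.Q := M.isOpen_cylinder
  rw [hopen.frontier_eq]
  have hxi := (M.patch i).regularBoundary_subset_frontier hx
  refine ⟨closure_mono (M.subset i) (frontier_subset_closure hxi), fun hxQ => ?_⟩
  have hs : 0 < inner ℝ ((M.patch i).normal x) ((M.patch i).normal x) := by
    rw [real_inner_self_eq_norm_sq, (M.patch i).norm_normal hx]
    norm_num
  have hlim : Tendsto (fun ε : ℝ => x + ε • (M.patch i).normal x) (𝓝[>] 0) (𝓝 x) := by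
    have : Continuous fun ε : ℝ => x + ε • (M.patch i).normal x := by fun_prop
    simpa using (this.tendsto 0).mono_left nhdsWithin_le_nhds
  have h1 : ∀ᶠ ε in 𝓝[>] (0 : ℝ), x + ε • (M.patch i).normal x ∈ M.Q :=
    hlim.eventually (hopen.mem_nhds hxQ)
  have hother : ∀ j, j ≠ i → x ∉ closure (M.patch j).dom := by
    intro j hj hxj
    refine hF j hj ⟨hxi, ?_⟩
    rw [Patch.frontier_dom]
    refine ⟨hxj, fun hxd => ?_⟩
    have := (M.disjoint i j hj.symm).closure_left (M.patch j).isOpen_dom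
    exact disjoint_left.1 this (frontier_subset_closure hxi) hxd
  have h2 : ∀ᶠ ε in 𝓝[>] (0 : ℝ), ∀ j, j ≠ i →
      x + ε • (M.patch i).normal x ∉ closure (M.patch j).dom := by
    refine eventually_all.2 fun j => ?_
    by_cases hj : j = i
    · exact Eventually.of_forall fun _ h => absurd hj h
    · filter_upwards [hlim.eventually (isClosed_closure.isOpen_compl.mem_nhds (hother j hj))]
        with ε hε _ using hε
  obtain ⟨ε, h3, h4, h5⟩ :=
    (h1.and (h2.and ((M.patch i).eventually_notMem_closure hx hs))).exists
  have h6 : x + ε • (M.patch i).normal x ∈ ⋃ j, closure (M.patch j).dom :=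
    M.cover ▸ subset_closure h3
  obtain ⟨j, hj⟩ := mem_iUnion.1 h6
  by_cases hji : j = i
  · exact h5 (hji ▸ hj)
  · exact h4 j hji hj

/-- The boundary of the space-time domain consists of its bottom, its top and its lateral part. -/
theorem mem_boundary_parts {x : Pt d} (hx : x ∈ frontier M.Q) :
    x ∈ M.top ∨ x ∈ M.lateral ∪ M.bottom := by
  have hcont : Continuous (timePart : Pt d → ℝ) := PiLp.continuous_apply 2 _ _
  have hsub : closure M.Q ⊆ {z | 0 ≤ timePart z ∧ timePart z ≤ M.T} :=
    closure_minimal (fun z hz => ⟨hz.1.le, hz.2.1.le⟩)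
      ((isClosed_le continuous_const hcont).inter (isClosed_le hcont continuous_const))
  obtain ⟨h0, hT⟩ := hsub (frontier_subset_closure hx)
  rcases h0.eq_or_lt with h | h
  · exact Or.inr (Or.inr ⟨hx, h.symm⟩)
  rcases hT.eq_or_lt with h' | h'
  · exact Or.inl ⟨hx, h'⟩
  · exact Or.inr (Or.inl ⟨hx, h, h'⟩)

end MultiPatch

/-! ### The inverse inequality -/

/-- On a finite-dimensional space of functions that are continuous on the closure of a bounded open
set, the maximum norm is bounded by the `L²` norm: both only see the complement of the kernel, on
whose unit sphere the `L²` norm has a positive minimum. -/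
theorem exists_sq_norm_le_integral {d : ℕ} {ι : Type*} [Fintype ι] {F : Type*}
    [NormedAddCommGroup F] [NormedSpace ℝ F] {U : Set (Pt d)} (hU : IsOpen U)
    (hK : IsCompact (closure U)) (L : (ι → ℝ) →ₗ[ℝ] (Pt d → F))
    (hL : ∀ c, ContinuousOn (L c) (closure U)) :
    ∃ C : ℝ, 0 ≤ C ∧ ∀ c, ∀ x ∈ closure U, ‖L c x‖ ^ 2 ≤ C * ∫ y in U, ‖L c y‖ ^ 2 := by
  classical
  obtain ⟨A, hA0, hA⟩ : ∃ A : ℝ, 0 ≤ A ∧ ∀ c, ∀ x ∈ closure U, ‖L c x‖ ≤ A * ‖c‖ := by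
    choose B hB using fun i : ι => hK.exists_bound_of_continuousOn (hL (Pi.single i 1))
    refine ⟨∑ i, |B i|, Finset.sum_nonneg fun i _ => abs_nonneg _, fun c x hx => ?_⟩
    have hc : c = ∑ i, c i • (Pi.single i 1 : ι → ℝ) := by
      conv_lhs => rw [← Finset.univ_sum_single c]
      exact Finset.sum_congr rfl fun i _ => by rw [← Pi.single_smul]; simp
    have hs : L c x = ∑ i, c i • L (Pi.single i 1) x := by
      conv_lhs => rw [hc]
      simp [map_sum, Finset.sum_apply]
    rw [hs, Finset.sum_mul]
    refine (norm_sum_le _ _).trans (Finset.sum_le_sum fun i _ => ?_)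
    rw [norm_smul, mul_comm]
    exact mul_le_mul ((hB i x hx).trans (le_abs_self _)) (norm_le_pi_norm c i) (norm_nonneg _)
      (abs_nonneg _)
  have hUfin : volume U ≠ ⊤ := ((measure_mono subset_closure).trans_lt hK.measure_lt_top).ne
  have hmeas : ∀ c, AEStronglyMeasurable (fun y => ‖L c y‖ ^ 2) (volume.restrict U) := fun c =>
    (((hL c).mono subset_closure).norm.pow 2).aestronglyMeasurable hU.measurableSet
  have hbd : ∀ c, ∀ R, ‖c‖ ≤ R → ∀ᵐ y ∂(volume.restrict U), ‖‖L c y‖ ^ 2‖ ≤ (A * R) ^ 2 := by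
    intro c R hR
    filter_upwards [ae_restrict_mem hU.measurableSet] with y hy
    rw [norm_pow, norm_norm]
    gcongr
    exact (hA c y (subset_closure hy)).trans (by gcongr)
  set B : (ι → ℝ) → ℝ := fun c => ∫ y in U, ‖L c y‖ ^ 2 with hBdef
  have : IsFiniteMeasure (volume.restrict U) := ⟨by simpa using hUfin.lt_top⟩
  have hBcont : Continuous B := by
    rw [continuous_iff_continuousAt]
    intro c₀
    refine continuousAt_of_dominated (bound := fun _ => (A * (‖c₀‖ + 1)) ^ 2)
      (Eventually.of_forall hmeas) ?_ (integrable_const _) ?_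
    · have : ∀ᶠ c in 𝓝 c₀, ‖c‖ < ‖c₀‖ + 1 :=
        continuous_norm.continuousAt.eventually (gt_mem_nhds (by simp))
      filter_upwards [this] with c hc using hbd c _ hc.le
    · refine Eventually.of_forall fun y => ?_
      have h1 : Continuous fun c : ι → ℝ => L c y :=
        ((LinearMap.proj y : (Pt d → F) →ₗ[ℝ] F) ∘ₗ L).continuous_of_finiteDimensional
      exact (h1.norm.pow 2).continuousAt
  have hBhom : ∀ (t : ℝ) c, B (t • c) = t ^ 2 * B c := by
    intro t c
    simp only [hBdef, map_smul, Pi.smul_apply, norm_smul, mul_pow, Real.norm_eq_abs, sq_abs]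
    rw [integral_const_mul]
  have hB0 : ∀ c, B c = 0 → ∀ x ∈ closure U, L c x = 0 := by
    intro c hc
    have hint : Integrable (fun y => ‖L c y‖ ^ 2) (volume.restrict U) :=
      Integrable.of_bound (hmeas c) _ (hbd c _ le_rfl)
    have hae := (integral_eq_zero_iff_of_nonneg (fun y => by positivity) hint).1 hc
    have hcU : ContinuousOn (fun y => ‖L c y‖ ^ 2) U := ((hL c).mono subset_closure).norm.pow 2
    have hz : EqOn (fun y => ‖L c y‖ ^ 2) (fun _ => 0) U :=
      Measure.eqOn_open_of_ae_eq hae hU hcU continuousOn_const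
    have hz' : EqOn (L c) (fun _ => 0) U := fun y hy => by
      have := hz hy
      simpa using this
    exact hz'.of_subset_closure (hL c) continuousOn_const subset_closure subset_rfl
  -- The quotient by the kernel is realized by a complement `W`, on which the `L²` norm is
  -- definite.
  set Λ : (ι → ℝ) →ₗ[ℝ] (closure U → F) :=
    { toFun := fun c x => L c x
      map_add' := fun c c' => by ext x; simp
      map_smul' := fun t c => by ext x; simp } with hΛ
  obtain ⟨W, hW⟩ := Submodule.exists_isCompl (LinearMap.ker Λ)
  have hpos : ∀ w ∈ Metric.sphere (0 : W) 1, 0 < B w := by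
    intro w hw
    refine lt_of_le_of_ne (integral_nonneg fun y => by positivity) fun h => ?_
    have hk : (w : ι → ℝ) ∈ LinearMap.ker Λ := by
      rw [LinearMap.mem_ker]
      ext x
      exact hB0 _ h.symm x x.2
    have := Submodule.disjoint_def.1 hW.disjoint _ hk w.2
    simp at hw
    have h2 : w = 0 := Subtype.ext this
    simp [h2] at hw
  obtain ⟨m, hm, hmB⟩ := (isCompact_sphere (0 : W) 1).exists_forall_le'
    (hBcont.comp continuous_subtype_val).continuousOn hpos
  have hWB : ∀ w : W, m * ‖(w : ι → ℝ)‖ ^ 2 ≤ B w := by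
    intro w
    by_cases hw : w = 0
    · subst hw
      simpa using integral_nonneg fun y => by positivity
    have hn : ‖w‖ ≠ 0 := norm_ne_zero_iff.2 hw
    have h1 := hmB (‖w‖⁻¹ • w) (by
      rw [mem_sphere_zero_iff_norm, norm_smul, norm_inv, norm_norm, inv_mul_cancel₀ hn])
    simp only [Function.comp, Submodule.coe_smul] at h1
    rw [hBhom, inv_pow, inv_mul_eq_div, le_div_iff₀ (by positivity)] at h1
    exact h1
  refine ⟨A ^ 2 / m, by positivity, fun c x hx => ?_⟩
  obtain ⟨k, hk, w, hw, rfl⟩ := Submodule.mem_sup.1 (hW.sup_eq_top ▸ Submodule.mem_top (x := c))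
  have hkz : ∀ y ∈ closure U, L k y = 0 := fun y hy => congrFun (LinearMap.mem_ker.1 hk) ⟨y, hy⟩
  have heq : ∀ y ∈ closure U, L (k + w) y = L w y := fun y hy => by
    rw [map_add, Pi.add_apply, hkz y hy, zero_add]
  have hI : ∫ y in U, ‖L (k + w) y‖ ^ 2 = B w :=
    setIntegral_congr_fun hU.measurableSet fun y hy => by
      simp only [heq y (subset_closure hy)]
  rw [hI, heq x hx]
  have h1 := hWB ⟨w, hw⟩
  have h2 : ‖L w x‖ ^ 2 ≤ (A * ‖w‖) ^ 2 := by
    gcongr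
    exact hA w x hx
  calc ‖L w x‖ ^ 2 ≤ A ^ 2 / m * (m * ‖w‖ ^ 2) := by
        rw [mul_pow] at h2
        field_simp
        exact h2
    _ ≤ _ := by gcongr

namespace Patch

variable {d : ℕ} {P : Patch d} {v : Pt d → ℝ} {c : P.Coeff}

theorem trace_apply (hv : ∀ ξ ∈ cube (d + 1), v (P.chart ξ) = P.spl c ξ) {x : Pt d}
    (hx : x ∈ closure P.dom) : P.trace v x = P.spl c (P.param x) :=
  P.trace_eq (P.continuous_spl c).continuousOn hv hx

theorem trace_gradX (hv : ∀ ξ ∈ cube (d + 1), v (P.chart ξ) = P.spl c ξ) {x : Pt d}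
    (hx : x ∈ closure P.dom) : P.trace (gradX v) x = P.gradSp c (P.param x) :=
  P.trace_eq (P.continuousOn_gradSp c) (fun _ h => gradX_chart hv h) hx

theorem trace_dt (hv : ∀ ξ ∈ cube (d + 1), v (P.chart ξ) = P.spl c ξ) {x : Pt d}
    (hx : x ∈ closure P.dom) : P.trace (dt v) x = P.grad c (Fin.last d) (P.param x) :=
  P.trace_eq (P.continuousOn_grad c _) (fun _ h => dt_chart hv h) hx

theorem eq_comp_param {F : Type*} {f : Pt d → F} {W : (Fin (d + 1) → ℝ) → F}
    (h : ∀ ξ ∈ cube (d + 1), f (P.chart ξ) = W ξ) {x : Pt d} (hx : x ∈ P.dom) :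
    f x = W (P.param x) := by
  rw [dom_eq] at hx
  obtain ⟨ξ, hξ, rfl⟩ := hx
  rw [h ξ hξ, P.param_chart (cube_subset_Icc _ hξ)]

/-- The inverse inequality for a linear family of functions on the patch. -/
theorem exists_inverse_inequality (P : Patch d) {F : Type*} [NormedAddCommGroup F]
    [NormedSpace ℝ F] (L : P.Coeff →ₗ[ℝ] ((Fin (d + 1) → ℝ) → F))
    (hL : ∀ c, ContinuousOn (L c) (Icc 0 1)) :
    ∃ C : ℝ, 0 ≤ C ∧ ∀ (c : P.Coeff) (f : Pt d → F), (∀ ξ ∈ cube (d + 1), f (P.chart ξ) = L c ξ) →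
      ∫ x, ‖P.trace f x‖ ^ 2 ∂P.surface ≤ C * ∫ x in P.dom, ‖f x‖ ^ 2 := by
  obtain ⟨C, hC0, hC⟩ := exists_sq_norm_le_integral P.isOpen_dom P.isCompact_closure_dom
    ((LinearMap.funLeft ℝ F P.param) ∘ₗ L) fun c =>
      (hL c).comp P.continuousOn_param fun x hx => P.param_mem hx
  refine ⟨P.surface.real univ * C, by positivity, fun c f hf => ?_⟩
  have hI : ∫ y in P.dom, ‖f y‖ ^ 2 = ∫ y in P.dom, ‖L c (P.param y)‖ ^ 2 :=
    setIntegral_congr_fun P.isOpen_dom.measurableSet fun y hy => by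
      simp only [eq_comp_param hf hy]
  rw [hI]
  have hle : ∀ᵐ x ∂P.surface, ‖P.trace f x‖ ^ 2 ≤ C * ∫ y in P.dom, ‖L c (P.param y)‖ ^ 2 := by
    filter_upwards [P.ae_mem_closure] with x hx
    rw [P.trace_eq (hL c) hf hx]
    exact hC c x hx
  calc ∫ x, ‖P.trace f x‖ ^ 2 ∂P.surface
      ≤ ∫ _, (C * ∫ y in P.dom, ‖L c (P.param y)‖ ^ 2) ∂P.surface :=
        integral_mono_of_nonneg (Eventually.of_forall fun x => by positivity)
          (integrable_const _) hle
    _ = _ := by rw [integral_const, smul_eq_mul, mul_assoc]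

theorem splD_add (K : Fin (d + 1) → KnotVector) (m : Fin (d + 1) → ℕ)
    (c c' : ((α : Fin (d + 1)) → Fin (K α).n) → ℝ) (ξ : Fin (d + 1) → ℝ) :
    splD K m (c + c') ξ = splD K m c ξ + splD K m c' ξ := by
  simp [splD, add_mul, Finset.sum_add_distrib]

theorem splD_smul (K : Fin (d + 1) → KnotVector) (m : Fin (d + 1) → ℕ) (t : ℝ)
    (c : ((α : Fin (d + 1)) → Fin (K α).n) → ℝ) (ξ : Fin (d + 1) → ℝ) :
    splD K m (t • c) ξ = t * splD K m c ξ := by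
  simp [splD, Finset.mul_sum, mul_assoc]

variable (P)

/-- `spl` as a linear map. -/
def splLin : P.Coeff →ₗ[ℝ] ((Fin (d + 1) → ℝ) → ℝ) where
  toFun := P.spl
  map_add' _ _ := funext fun _ => splD_add _ _ _ _ _
  map_smul' _ _ := funext fun _ => splD_smul _ _ _ _ _

/-- `gradSp` as a linear map. -/
def gradSpLin : P.Coeff →ₗ[ℝ] ((Fin (d + 1) → ℝ) → Sp d) where
  toFun := P.gradSp
  map_add' c c' := by
    funext ξ
    ext k
    simp [gradSp, grad, splD_add, add_mul, Finset.sum_add_distrib]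
  map_smul' t c := by
    funext ξ
    ext k
    simp [gradSp, grad, splD_smul, Finset.mul_sum, mul_assoc]

/-! ### The mesh size -/

theorem exists_knot_lt (K : KnotVector) : ∃ e < K.n + K.p, K.knot e < K.knot (e + 1) := by
  by_contra! h
  have : ∀ e ≤ K.n + K.p, K.knot e ≤ 0 := by
    intro e
    induction e with
    | zero => intro _; exact K.first.le
    | succ e ih => intro he; exact (h e (by omega)).trans (ih (by omega))
  have h1 := this _ le_rfl
  rw [K.last] at h1
  norm_num at h1

theorem mesh_subset_closure {E : Set (Pt d)} (hE : E ∈ P.mesh) :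
    E ⊆ closure P.dom := by
  obtain ⟨e, he, rfl⟩ := hE
  refine (image_mono fun ξ hξ => ?_).trans subset_closure
  intro α _
  have h := hξ α (mem_univ α)
  have h0 : 0 ≤ (P.K α).knot (e α) := (P.K α).first ▸ (P.K α).mono (Nat.zero_le _)
  have h1 : (P.K α).knot (e α + 1) ≤ 1 := by
    have := (P.K α).mono (Nat.succ_le_of_lt (he α).1)
    rwa [(P.K α).last] at this
  exact ⟨h0.trans_lt h.1, h.2.trans_le h1⟩

theorem h_pos : 0 < P.h := by
  choose e he using fun α => exists_knot_lt (P.K α)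
  set box : Set (Fin (d + 1) → ℝ) :=
    univ.pi fun α => Ioo ((P.K α).knot (e α)) ((P.K α).knot (e α + 1)) with hbox
  have hmem : P.Φ '' box ∈ P.mesh := ⟨e, he, rfl⟩
  have hbdd : Bornology.IsBounded (closure P.dom) := P.isCompact_closure_dom.isBounded
  have hle : Metric.diam (P.Φ '' box) ≤ P.h := by
    refine le_csSup ⟨Metric.diam (closure P.dom), ?_⟩ (mem_image_of_mem _ hmem)
    rintro _ ⟨E, hE, rfl⟩
    exact Metric.diam_mono (P.mesh_subset_closure hE) hbdd
  refine lt_of_lt_of_le ?_ hle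
  have hcube : box ⊆ cube (d + 1) := by
    intro ξ hξ α _
    have h := hξ α (mem_univ α)
    have h0 : 0 ≤ (P.K α).knot (e α) := (P.K α).first ▸ (P.K α).mono (Nat.zero_le _)
    have h1 : (P.K α).knot (e α + 1) ≤ 1 := by
      have := (P.K α).mono (Nat.succ_le_of_lt (he α).1)
      rwa [(P.K α).last] at this
    exact ⟨h0.trans_lt h.1, h.2.trans_le h1⟩
  choose m hm using fun α => exists_between (he α).2
  choose m' hm' using fun α => exists_between (hm α).2
  have h1 : m ∈ box := fun α _ => hm α
  have h2 : m' ∈ box := fun α _ => ⟨(hm α).1.trans (hm' α).1, (hm' α).2⟩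
  obtain ⟨r, hr, h⟩ := P.regular
  have h3 := h m (hcube h1) m' (hcube h2)
  have h4 : 0 < dist m m' := dist_pos.2 fun h => (hm' 0).1.ne (congrFun h 0)
  refine lt_of_lt_of_le (mul_pos hr h4) (h3.trans ?_)
  exact Metric.dist_le_diam_of_mem (hbdd.subset (P.mesh_subset_closure hmem))
    (mem_image_of_mem _ h1) (mem_image_of_mem _ h2)

end Patch

theorem MultiPatch.exists_inverseConst {d N : ℕ} (M : MultiPatch d N) :
    ∃ C : ℝ, 0 < C ∧ M.InverseConst C := by
  choose C₁ h₁ H₁ using fun i => (M.patch i).exists_inverse_inequality (M.patch i).splLin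
    fun c => ((M.patch i).continuous_spl c).continuousOn
  choose C₂ h₂ H₂ using fun i => (M.patch i).exists_inverse_inequality (M.patch i).gradSpLin
    (M.patch i).continuousOn_gradSp
  have hh : ∀ i, 0 < M.h i := fun i => (M.patch i).h_pos
  have hnn : ∀ i, 0 ≤ (C₁ i + C₂ i) * M.h i := fun i =>
    mul_nonneg (add_nonneg (h₁ i) (h₂ i)) (hh i).le
  set C : ℝ := 1 + ∑ i, (C₁ i + C₂ i) * M.h i with hC
  have hCi : ∀ i, C₁ i + C₂ i ≤ C * (M.h i)⁻¹ := by
    intro i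
    rw [← div_eq_mul_inv, le_div_iff₀ (hh i)]
    have := Finset.single_le_sum (fun i _ => hnn i) (Finset.mem_univ i)
    linarith
  refine ⟨C, add_pos_of_pos_of_nonneg one_pos (Finset.sum_nonneg fun i _ => hnn i),
    fun i v hv => ?_⟩
  obtain ⟨c, hc⟩ := Patch.exists_coeff hv
  constructor
  · have h := H₁ i c v hc
    simp only [Real.norm_eq_abs, sq_abs] at h
    refine h.trans (mul_le_mul_of_nonneg_right ?_ (integral_nonneg fun x => by positivity))
    linarith [hCi i, h₂ i]
  · refine (H₂ i c (gradX v) fun ξ hξ => Patch.gradX_chart hc hξ).trans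
      (mul_le_mul_of_nonneg_right ?_ (integral_nonneg fun x => by positivity))
    linarith [hCi i, h₁ i]

namespace Patch

variable {d : ℕ} (P : Patch d)

/-! ### Time derivatives as boundary integrals -/

theorem integrableOn_dom {f : Pt d → ℝ}
    (hf : IntegrableOn (fun ξ => |(P.J ξ).det| * f (P.chart ξ)) (cube (d + 1))) :
    IntegrableOn f P.dom := by
  have mp := EuclideanSpace.volume_preserving_symm_measurableEquiv_toLp (Fin (d + 1))
  have me := (MeasurableEquiv.toLp 2 (Fin (d + 1) → ℝ)).symm.measurableEmbedding
  have h2 := mp.integrableOn_comp_preimage me (f := fun y => f (WithLp.toLp 2 y))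
    (s := P.coordMap '' cube (d + 1))
  rw [P.preimage_image_coordMap] at h2
  refine h2.2 ((integrableOn_image_iff_integrableOn_abs_det_fderiv_smul volume
    (isOpen_cube _).measurableSet (fun ξ _ => P.hasFDerivWithinAt_coordMap ξ _)
    P.injOn_coordMap _).2 ?_)
  refine hf.congr_fun (fun ξ _ => ?_) (isOpen_cube _).measurableSet
  simp only [smul_eq_mul, coordMap]
  congr 2
  rw [ContinuousLinearMap.det, LinearMap.coe_toContinuousLinearMap, LinearMap.det_toLin']

theorem integrableOn_dom_of_continuousOn {f : Pt d → ℝ} {W : (Fin (d + 1) → ℝ) → ℝ}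
    (hW : ContinuousOn W (Icc 0 1)) (h : ∀ ξ ∈ cube (d + 1), f (P.chart ξ) = W ξ) :
    IntegrableOn f P.dom := by
  refine P.integrableOn_dom (IntegrableOn.congr_fun
    (f := fun ξ => |(P.J ξ).det| * W ξ) ?_ (fun ξ hξ => by simp only [h ξ hξ])
    (isOpen_cube _).measurableSet)
  exact ((P.continuous_J.matrix_det.abs.continuousOn.mul hW).integrableOn_compact
    isCompact_Icc).mono_set (cube_subset_Icc _)

variable {P} {v : Pt d → ℝ} {c : P.Coeff}

theorem integral_mul_dt (hv : ∀ ξ ∈ cube (d + 1), v (P.chart ξ) = P.spl c ξ) :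
    ∫ x in P.dom, v x * dt v x = 1 / 2 * ∫ x, P.nt x * P.trace v x ^ 2 ∂P.surface := by
  have h := P.integral_dom_eq_integral_surface (W := fun ξ => 1 / 2 * P.spl c ξ ^ 2)
    (W' := fun a ξ => P.spl c ξ * splD P.K (Pi.single a 1) c ξ) (g := fun x => v x * dt v x)
    (continuous_const.mul ((P.continuous_spl c).pow 2)).continuousOn
    (fun ξ _ => ⟨_, ((P.hasFDerivAt_spl c ξ).pow 2).const_mul (1 / 2), fun a => by
      simp [Pi.single_apply]
      ring⟩)
    (fun a => (((P.continuous_spl c).mul (continuous_splD _ _ (single_le_one a))).continuousOn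
      |>.integrableOn_compact isCompact_Icc).mono_set (cube_subset_Icc _))
    (fun ξ hξ => by
      rw [hv ξ hξ.1, dt_chart hv hξ.1, grad, Finset.mul_sum]
      exact Finset.sum_congr rfl fun a _ => by ring)
  rw [h, ← integral_const_mul]
  refine integral_congr_ae ?_
  filter_upwards [P.ae_mem_closure] with x hx
  rw [trace_apply hv hx]
  ring

theorem norm_gradSp_sq (c : P.Coeff) (ξ : Fin (d + 1) → ℝ) :
    ‖P.gradSp c ξ‖ ^ 2 = ∑ k : Fin d, P.grad c k.castSucc ξ ^ 2 := by
  rw [EuclideanSpace.norm_sq_eq]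
  simp [gradSp]

theorem inner_dtGradX_chart (hv : ∀ ξ ∈ cube (d + 1), v (P.chart ξ) = P.spl c ξ)
    {ξ : Fin (d + 1) → ℝ} (hξ : ξ ∈ goodSet P.K) :
    inner ℝ (dtGradX v (P.chart ξ)) (gradX v (P.chart ξ)) =
      ∑ a, (∑ k : Fin d, P.grad c k.castSucc ξ *
        fderiv ℝ (P.grad c k.castSucc) ξ (Pi.single a 1)) * (P.J ξ)⁻¹ a (Fin.last d) := by
  rw [PiLp.inner_apply, gradX_chart hv hξ.1]
  simp only [dtGradX_chart hv hξ, Finset.sum_mul]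
  rw [Finset.sum_comm]
  refine Finset.sum_congr rfl fun k _ => ?_
  simp only [gradSp, RCLike.inner_apply, conj_trivial, Finset.mul_sum]
  exact Finset.sum_congr rfl fun a _ => by ring

theorem integrableOn_grad_mul_fderiv (c : P.Coeff) (a : Fin (d + 1)) :
    IntegrableOn (fun ξ => ∑ k : Fin d, P.grad c k.castSucc ξ *
      fderiv ℝ (P.grad c k.castSucc) ξ (Pi.single a 1)) (cube (d + 1)) :=
  integrable_finsetSum _ fun k _ => integrableOn_continuousOn_mul
    (integrableOn_fderiv_grad P c k.castSucc a) _ (P.continuousOn_grad c k.castSucc)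

theorem integral_inner_dtGradX (hv : ∀ ξ ∈ cube (d + 1), v (P.chart ξ) = P.spl c ξ) :
    ∫ x in P.dom, inner ℝ (dtGradX v x) (gradX v x) =
      1 / 2 * ∫ x, P.nt x * ‖P.trace (gradX v) x‖ ^ 2 ∂P.surface := by
  have h := P.integral_dom_eq_integral_surface
    (W := fun ξ => 1 / 2 * ∑ k : Fin d, P.grad c k.castSucc ξ ^ 2)
    (W' := fun a ξ => ∑ k : Fin d, P.grad c k.castSucc ξ *
      fderiv ℝ (P.grad c k.castSucc) ξ (Pi.single a 1))
    (g := fun x => inner ℝ (dtGradX v x) (gradX v x))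
    (continuousOn_const.mul (continuousOn_finsetSum _ fun k _ => (P.continuousOn_grad c _).pow 2))
    (fun ξ hξ => ⟨_, (HasFDerivAt.fun_sum fun k _ =>
      (hasFDerivAt_grad P c (Fin.castSucc k) hξ).pow 2).const_mul (1 / 2), fun a => by
        simp only [smul_apply, sum_apply, smul_eq_mul, Finset.mul_sum]
        exact Finset.sum_congr rfl fun k _ => by simp; ring⟩)
    (integrableOn_grad_mul_fderiv c) (fun ξ hξ => inner_dtGradX_chart hv hξ)
  rw [h, ← integral_const_mul]
  refine integral_congr_ae ?_
  filter_upwards [P.ae_mem_closure] with x hx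
  rw [trace_gradX hv hx, norm_gradSp_sq]
  ring

theorem integrableOn_inner_dtGradX (hv : ∀ ξ ∈ cube (d + 1), v (P.chart ξ) = P.spl c ξ) :
    IntegrableOn (fun x => inner ℝ (dtGradX v x) (gradX v x)) P.dom := by
  refine P.integrableOn_dom ?_
  have h : IntegrableOn (fun ξ => ∑ a, (|(P.J ξ).det| * (P.J ξ)⁻¹ a (Fin.last d)) *
      (∑ k : Fin d, P.grad c k.castSucc ξ *
        fderiv ℝ (P.grad c k.castSucc) ξ (Pi.single a 1))) (cube (d + 1)) :=
    integrable_finsetSum _ fun a _ => integrableOn_continuousOn_mul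
      (integrableOn_grad_mul_fderiv c a) _
      (P.continuous_J.matrix_det.abs.continuousOn.mul (P.continuousOn_J_inv a _))
  refine Integrable.congr h ?_
  filter_upwards [ae_mem_goodSet P.K] with ξ hξ
  rw [inner_dtGradX_chart hv hξ, Finset.mul_sum]
  exact Finset.sum_congr rfl fun a _ => by ring

/-- The volume terms of the bilinear form on one patch, after integration by parts in time. -/
theorem integral_volume_terms (hv : ∀ ξ ∈ cube (d + 1), v (P.chart ξ) = P.spl c ξ) (κ : ℝ) :
    ∫ x in P.dom, (-(v x * dt v x) + κ * (dt v x * dt v x) + inner ℝ (gradX v x) (gradX v x)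
        - κ * inner ℝ (dtGradX v x) (gradX v x)) =
      (∫ x in P.dom, ‖gradX v x‖ ^ 2) + κ * (∫ x in P.dom, dt v x ^ 2)
        - 1 / 2 * (∫ x, P.nt x * P.trace v x ^ 2 ∂P.surface)
        - κ / 2 * ∫ x, P.nt x * ‖P.trace (gradX v) x‖ ^ 2 ∂P.surface := by
  have i1 : IntegrableOn (fun x => v x * dt v x) P.dom :=
    P.integrableOn_dom_of_continuousOn
      ((P.continuous_spl c).continuousOn.mul (P.continuousOn_grad c (Fin.last d)))
      fun ξ hξ => by rw [hv ξ hξ, dt_chart hv hξ]; rfl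
  have i2 : IntegrableOn (fun x => dt v x ^ 2) P.dom :=
    P.integrableOn_dom_of_continuousOn ((P.continuousOn_grad c (Fin.last d)).pow 2)
      fun ξ hξ => by rw [dt_chart hv hξ]; rfl
  have i3 : IntegrableOn (fun x => ‖gradX v x‖ ^ 2) P.dom :=
    P.integrableOn_dom_of_continuousOn ((P.continuousOn_gradSp c).norm.pow 2)
      fun ξ hξ => by rw [gradX_chart hv hξ]; rfl
  have i4 := integrableOn_inner_dtGradX hv
  have e : ∀ x, -(v x * dt v x) + κ * (dt v x * dt v x) + inner ℝ (gradX v x) (gradX v x)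
        - κ * inner ℝ (dtGradX v x) (gradX v x) = (‖gradX v x‖ ^ 2 + κ * dt v x ^ 2)
        - (v x * dt v x + κ * inner ℝ (dtGradX v x) (gradX v x)) := fun x => by
    rw [real_inner_self_eq_norm_sq]
    ring
  have j1 : IntegrableOn (fun x => ‖gradX v x‖ ^ 2 + κ * dt v x ^ 2) P.dom :=
    i3.add (i2.const_mul κ)
  have j2 : IntegrableOn (fun x => v x * dt v x + κ * inner ℝ (dtGradX v x) (gradX v x)) P.dom :=
    i1.add (i4.const_mul κ)
  simp only [e]
  rw [integral_sub j1 j2,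
    integral_add i3 (i2.const_mul κ), integral_add i1 (i4.const_mul κ), integral_const_mul,
    integral_const_mul, integral_mul_dt hv, integral_inner_dtGradX hv]
  ring

/-! ### Bounded traces -/

variable (P) in
theorem memLp_top_comp_param {F : Type*} [NormedAddCommGroup F] [SecondCountableTopology F]
    {W : (Fin (d + 1) → ℝ) → F} (hW : ContinuousOn W (Icc 0 1)) :
    MemLp (fun x => W (P.param x)) ⊤ P.surface := by
  obtain ⟨C, hC⟩ := isCompact_Icc.exists_bound_of_continuousOn hW
  refine memLp_top_of_bound (P.aestronglyMeasurable_comp_param hW) C ?_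
  filter_upwards [P.ae_mem_closure] with x hx using hC _ (P.param_mem hx)

theorem memLp_trace (hv : ∀ ξ ∈ cube (d + 1), v (P.chart ξ) = P.spl c ξ) :
    MemLp (P.trace v) ⊤ P.surface := by
  refine (P.memLp_top_comp_param (P.continuous_spl c).continuousOn).ae_eq ?_
  filter_upwards [P.ae_mem_closure] with x hx using (trace_apply hv hx).symm

theorem memLp_trace_gradX (hv : ∀ ξ ∈ cube (d + 1), v (P.chart ξ) = P.spl c ξ) :
    MemLp (P.trace (gradX v)) ⊤ P.surface := by
  refine (P.memLp_top_comp_param (P.continuousOn_gradSp c)).ae_eq ?_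
  filter_upwards [P.ae_mem_closure] with x hx using (trace_gradX hv hx).symm

theorem memLp_trace_dt (hv : ∀ ξ ∈ cube (d + 1), v (P.chart ξ) = P.spl c ξ) :
    MemLp (P.trace (dt v)) ⊤ P.surface := by
  refine (P.memLp_top_comp_param (P.continuousOn_grad c (Fin.last d))).ae_eq ?_
  filter_upwards [P.ae_mem_closure] with x hx using (trace_dt hv hx).symm

variable (P) in
theorem memLp_nt : MemLp P.nt ⊤ P.surface :=
  memLp_top_of_bound P.aemeasurable_nt.aestronglyMeasurable 1 (Eventually.of_forall P.abs_nt_le)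

variable (P) in
theorem memLp_nx : MemLp P.nx ⊤ P.surface :=
  memLp_top_of_bound P.aemeasurable_nx.aestronglyMeasurable 1 (Eventually.of_forall P.norm_nx_le)

end Patch

/-! ### Estimates on facets -/

/-- The upwind identity: the upwind flux minus the two boundary terms of the integration by parts
is a square. Here `n` is the time component of the normal of the first patch. -/
theorem inner_upwind {E : Type*} [NormedAddCommGroup E] [InnerProductSpace ℝ E] (n : ℝ) (a b : E) :
    inner ℝ (open Classical in if 0 ≤ n then a else b) (n • a + (-n) • b) =
      1 / 2 * (n * ‖a‖ ^ 2) + 1 / 2 * (-n * ‖b‖ ^ 2) + 1 / 2 * (|n| * ‖a - b‖ ^ 2) := by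
  have hab := norm_sub_sq_real a b
  split_ifs with h
  · rw [abs_of_nonneg h, hab, inner_add_right, inner_smul_right, inner_smul_right,
      real_inner_self_eq_norm_sq]
    ring
  · rw [abs_of_neg (not_le.1 h), hab, inner_add_right, inner_smul_right, inner_smul_right,
      real_inner_self_eq_norm_sq, real_inner_comm]
    ring

theorem integrable_mul_norm_sq {α E : Type*} [MeasurableSpace α] {μ : Measure α} [IsFiniteMeasure μ]
    [NormedAddCommGroup E] {n : α → ℝ} {f : α → E} (hn : MemLp n ⊤ μ) (hf : MemLp f ⊤ μ) :
    Integrable (fun x => n x * ‖f x‖ ^ 2) μ := by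
  have h1 : MemLp (fun x => ‖f x‖ * ‖f x‖) ⊤ μ := hf.norm.mul hf.norm
  have h2 : MemLp (fun x => n x * (‖f x‖ * ‖f x‖)) ⊤ μ := h1.mul hn
  simpa only [pow_two] using h2.integrable le_top

theorem integrable_norm_sq {α E : Type*} [MeasurableSpace α] {μ : Measure α} [IsFiniteMeasure μ]
    [NormedAddCommGroup E] {f : α → E} (hf : MemLp f ⊤ μ) : Integrable (fun x => ‖f x‖ ^ 2) μ := by
  have h1 : MemLp (fun x => ‖f x‖ * ‖f x‖) ⊤ μ := hf.norm.mul hf.norm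
  simpa only [pow_two] using h1.integrable le_top

namespace MultiPatch

variable {d N : ℕ} (M : MultiPatch d N)

theorem facetInt_comm {i j : Fin N} (hij : i ≠ j) (f : Pt d → ℝ) :
    M.facetInt j i f = M.facetInt i j f := by
  rw [facetInt, facetInt, facet_comm M j i, M.restrict_surface_facet hij]

theorem memLp_facet {E : Type*} [NormedAddCommGroup E] {i j : Fin N} (hij : i ≠ j) {f : Pt d → E}
    (hf : MemLp f ⊤ (M.patch j).surface) :
    MemLp f ⊤ ((M.patch i).surface.restrict (M.facet i j)) := by
  rw [← M.restrict_surface_facet hij]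
  exact hf.restrict _

theorem ae_facet_nt {i j : Fin N} (hij : i ≠ j) :
    ∀ᵐ x ∂((M.patch i).surface.restrict (M.facet i j)), (M.patch j).nt x = -(M.patch i).nt x := by
  filter_upwards [ae_restrict_of_ae (M.ae_regular i), ae_restrict_mem (M.measurableSet_facet i j)]
    with x hx hxF
  exact Patch.nt_eq_neg (M.disjoint i j hij) hx.1 (hx.2 j hxF)

/-- The upwind flux through an interior facet dominates the boundary terms of the two patches and
the jump. -/
theorem facet_upwind_estimate {E : Type*} [NormedAddCommGroup E] [InnerProductSpace ℝ E]
    {i j : Fin N} (hij : i ≠ j) {f : Pt d → E}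
    (hi : MemLp ((M.patch i).trace f) ⊤ (M.patch i).surface)
    (hj : MemLp ((M.patch j).trace f) ⊤ (M.patch j).surface) :
    1 / 2 * M.facetInt i j (fun x => (M.patch i).nt x * ‖(M.patch i).trace f x‖ ^ 2)
      + 1 / 2 * M.facetInt j i (fun x => (M.patch j).nt x * ‖(M.patch j).trace f x‖ ^ 2)
      + 1 / 2 * M.facetInt i j (fun x => ‖M.jumpT i j f x‖ ^ 2) ≤
    M.facetInt i j fun x => inner ℝ (M.up i j f x) (M.jumpT i j f x) := by
  rw [M.facetInt_comm hij]
  have hi' := hi.restrict (M.facet i j)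
  have hj' := M.memLp_facet hij hj
  have hni := (M.patch i).memLp_nt.restrict (M.facet i j)
  have hnj := M.memLp_facet hij (M.patch j).memLp_nt
  simp only [facetInt]
  set μ := (M.patch i).surface.restrict (M.facet i j)
  have i1 := integrable_mul_norm_sq hni hi'
  have i2 := integrable_mul_norm_sq hnj hj'
  have i3 : Integrable (fun x => ‖M.jumpT i j f x‖ ^ 2) μ :=
    integrable_norm_sq ((hi'.smul hni).add (hj'.smul hnj))
  have i4 : Integrable (fun x => |(M.patch i).nt x| *
      ‖(M.patch i).trace f x - (M.patch j).trace f x‖ ^ 2) μ :=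
    integrable_mul_norm_sq hni.norm (hi'.sub hj')
  have hae := M.ae_facet_nt hij
  have hid : (fun x => 1 / 2 * ((M.patch i).nt x * ‖(M.patch i).trace f x‖ ^ 2)
        + 1 / 2 * ((M.patch j).nt x * ‖(M.patch j).trace f x‖ ^ 2)
        + 1 / 2 * (|(M.patch i).nt x| * ‖(M.patch i).trace f x - (M.patch j).trace f x‖ ^ 2))
      =ᵐ[μ] fun x => inner ℝ (M.up i j f x) (M.jumpT i j f x) := by
    filter_upwards [hae] with x hx
    simp only [up, jumpT, hx]
    exact (inner_upwind _ _ _).symm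
  rw [← integral_const_mul, ← integral_const_mul, ← integral_const_mul,
    ← integral_add (i1.const_mul _) (i2.const_mul _)]
  have i12 : Integrable (fun x => 1 / 2 * ((M.patch i).nt x * ‖(M.patch i).trace f x‖ ^ 2)
        + 1 / 2 * ((M.patch j).nt x * ‖(M.patch j).trace f x‖ ^ 2)) μ :=
    (i1.const_mul _).add (i2.const_mul _)
  rw [← integral_add i12 (i3.const_mul _), ← integral_congr_ae hid]
  refine integral_mono_ae (i12.add (i3.const_mul _)) (i12.add (i4.const_mul _)) ?_
  filter_upwards [hae] with x hx
  have h1 : ‖M.jumpT i j f x‖ ^ 2 ≤ |(M.patch i).nt x| *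
      ‖(M.patch i).trace f x - (M.patch j).trace f x‖ ^ 2 := by
    have h2 : M.jumpT i j f x =
        (M.patch i).nt x • ((M.patch i).trace f x - (M.patch j).trace f x) := by
      rw [jumpT, hx, smul_sub, neg_smul, sub_eq_add_neg]
    rw [h2, norm_smul, mul_pow, Real.norm_eq_abs]
    refine mul_le_mul_of_nonneg_right ?_ (by positivity)
    have := (M.patch i).abs_nt_le x
    have := abs_nonneg ((M.patch i).nt x)
    nlinarith
  linarith

/-- The loss on a facet caused by different weights `κ i`, `κ j` on its two sides. -/
theorem facet_weighted_estimate {E : Type*} [NormedAddCommGroup E] [InnerProductSpace ℝ E]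
    {i j : Fin N} (hij : i ≠ j) {f : Pt d → E} {κ : Fin N → ℝ} (hκi : 0 ≤ κ i)
    (hκ : (M.patch i).surface (M.facet i j) ≠ 0 → κ i ≤ 2 * κ j)
    (hi : MemLp ((M.patch i).trace f) ⊤ (M.patch i).surface)
    (hj : MemLp ((M.patch j).trace f) ⊤ (M.patch j).surface) :
    κ i / 2 * M.facetInt i j (fun x => (M.patch i).nt x * ‖(M.patch i).trace f x‖ ^ 2)
      + κ j / 2 * M.facetInt j i (fun x => (M.patch j).nt x * ‖(M.patch j).trace f x‖ ^ 2)
      + κ i / 2 * M.facetInt i j (fun x => ‖M.jumpT i j f x‖ ^ 2) ≤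
    κ i * M.facetInt i j (fun x => inner ℝ (M.up i j f x) (M.jumpT i j f x))
      + κ j / 2 * M.facetInt j i (fun x => ‖(M.patch j).trace f x‖ ^ 2) := by
  have h1 := mul_le_mul_of_nonneg_left (M.facet_upwind_estimate hij hi hj) hκi
  set A := M.facetInt j i fun x => (M.patch j).nt x * ‖(M.patch j).trace f x‖ ^ 2 with hA
  set G := M.facetInt j i fun x => ‖(M.patch j).trace f x‖ ^ 2 with hG
  -- The condition `κ i ≤ 2 κ j` is just `|κ j - κ i| ≤ κ j`, for `κ i ≥ 0`.
  have h2 : (κ j - κ i) * A ≤ κ j * G := by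
    by_cases h0 : (M.patch i).surface (M.facet i j) = 0
    · have hz : ∀ g, M.facetInt j i g = 0 := fun g => by
        rw [M.facetInt_comm hij, facetInt, Measure.restrict_eq_zero.2 h0, integral_zero_measure]
      rw [hA, hG, hz, hz, mul_zero, mul_zero]
    · have hle := hκ h0
      have hAG : |A| ≤ G := by
        rw [hA, facetInt, ← Real.norm_eq_abs]
        refine norm_integral_le_of_norm_le (integrable_norm_sq (hj.restrict _))
          (Eventually.of_forall fun x => ?_)
        rw [norm_mul, Real.norm_of_nonneg (sq_nonneg ‖(M.patch j).trace f x‖)]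
        exact mul_le_of_le_one_left (by positivity) ((M.patch j).abs_nt_le x)
      have h3 : |κ j - κ i| ≤ κ j := abs_le.2 ⟨by linarith, by linarith⟩
      calc (κ j - κ i) * A ≤ |κ j - κ i| * |A| := by rw [← abs_mul]; exact le_abs_self _
        _ ≤ κ j * G := mul_le_mul h3 hAG (abs_nonneg _) ((abs_nonneg _).trans h3)
  linarith

/-! ### Decomposition of the boundary of a patch -/

/-- The part of the boundary of a patch that lies on no interior facet. -/
def outerPart (i : Fin N) : Set (Pt d) := (⋃ j ∈ Finset.univ.erase i, M.facet i j)ᶜ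

theorem measurableSet_outerPart (i : Fin N) : MeasurableSet (M.outerPart i) :=
  (Finset.measurableSet_biUnion _ fun j _ => M.measurableSet_facet i j).compl

theorem integral_surface_eq_sum {i : Fin N} {f : Pt d → ℝ}
    (hf : Integrable f (M.patch i).surface) :
    ∫ x, f x ∂(M.patch i).surface = ∑ j ∈ Finset.univ.erase i, M.facetInt i j f
      + ∫ x in M.outerPart i, f x ∂(M.patch i).surface := by
  have hm : MeasurableSet (⋃ j ∈ Finset.univ.erase i, M.facet i j) :=
    Finset.measurableSet_biUnion _ fun j _ => M.measurableSet_facet i j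
  rw [← integral_add_compl hm hf, outerPart]
  congr 1
  have hU : ⋃ j ∈ Finset.univ.erase i, M.facet i j =
      ⋃ j : (Finset.univ.erase i : Finset (Fin N)), M.facet i j := by
    ext x
    simp
  rw [hU, integral_iUnion_ae
    (s := fun j : (Finset.univ.erase i : Finset (Fin N)) => M.facet i j)
    (fun j => (M.measurableSet_facet i j).nullMeasurableSet) ?_ hf.integrableOn,
    tsum_fintype]
  · exact Finset.sum_coe_sort (Finset.univ.erase i) fun j => M.facetInt i j f
  · intro j k hjk
    have hj' : (j : Fin N) ≠ i := (Finset.mem_erase.1 j.2).1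
    have hk' : (k : Fin N) ≠ i := (Finset.mem_erase.1 k.2).1
    have hjk' : (j : Fin N) ≠ k := fun h => hjk (Subtype.ext h)
    refine measure_eq_zero_iff_ae_notMem.2 ?_
    filter_upwards [M.ae_regular i] with x hx hxF
    exact M.notMem_facet_of_mem hj'.symm hk'.symm hjk' hx.1 (hx.2 j hxF.1) (hx.2 k hxF.2)

/-- On the outer part of the boundary, a discrete function lives on the top only. -/
theorem outerPart_le_topInt {i : Fin N} {v : Pt d → ℝ}
    (hv : MemLp ((M.patch i).trace v) ⊤ (M.patch i).surface)
    (h0 : ∀ᵐ x ∂(M.patch i).surface.restrict (M.lateral ∪ M.bottom), (M.patch i).trace v x = 0) :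
    ∫ x in M.outerPart i, (M.patch i).nt x * (M.patch i).trace v x ^ 2 ∂(M.patch i).surface ≤
      M.topInt i fun x => (M.patch i).trace v x ^ 2 := by
  have hmt : MeasurableSet (M.facetTop i) := by
    refine isClosed_frontier.measurableSet.inter (isClosed_frontier.inter ?_).measurableSet
    exact isClosed_eq (PiLp.continuous_apply 2 _ _) continuous_const
  have hmlb : MeasurableSet (M.lateral ∪ M.bottom) := by
    have hc : Continuous (timePart : Pt d → ℝ) := PiLp.continuous_apply 2 _ _
    refine (isClosed_frontier.measurableSet.inter ?_).union
      (isClosed_frontier.inter (isClosed_eq hc continuous_const)).measurableSet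
    exact ((isOpen_lt continuous_const hc).inter (isOpen_lt hc continuous_const)).measurableSet
  have i1 : Integrable (fun x => (M.patch i).nt x * (M.patch i).trace v x ^ 2)
      (M.patch i).surface := by
    simpa using integrable_mul_norm_sq (M.patch i).memLp_nt hv
  have i2 : Integrable (fun x => (M.patch i).trace v x ^ 2) (M.patch i).surface := by
    simpa using integrable_norm_sq hv
  rw [topInt, ← integral_indicator (M.measurableSet_outerPart i), ← integral_indicator hmt]
  refine integral_mono_ae (i1.indicator (M.measurableSet_outerPart i)) (i2.indicator hmt) ?_
  filter_upwards [(ae_restrict_iff' hmlb).1 h0, M.ae_regular i] with x h0x hx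
  by_cases hxo : x ∈ M.outerPart i
  · rw [indicator_of_mem hxo]
    have hF : ∀ j, j ≠ i → x ∉ M.facet i j := fun j hj hxF =>
      hxo (mem_iUnion₂.2 ⟨j, Finset.mem_erase.2 ⟨hj, Finset.mem_univ j⟩, hxF⟩)
    rcases M.mem_boundary_parts (M.mem_frontier_Q hx.1 hF) with ht | hlb
    · rw [indicator_of_mem (show x ∈ M.facetTop i from
        ⟨(M.patch i).regularBoundary_subset_frontier hx.1, ht⟩)]
      exact mul_le_of_le_one_left (sq_nonneg _) ((le_abs_self _).trans ((M.patch i).abs_nt_le x))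
    · rw [h0x hlb]
      simp only [ne_eq, OfNat.ofNat_ne_zero, not_false_eq_true, zero_pow, mul_zero]
      exact indicator_nonneg (fun y _ => sq_nonneg _) x
  · rw [indicator_of_notMem hxo]
    exact indicator_nonneg (fun y _ => sq_nonneg _) x

/-! ### Sums over interior facets -/

theorem sum_offDiag_eq_sum_labelling {I : Finset (Fin N × Fin N)} (hI : IsLabelling I)
    (a : Fin N → Fin N → ℝ) :
    ∑ i, ∑ j ∈ Finset.univ.erase i, a i j = ∑ F ∈ I, (a F.1 F.2 + a F.2 F.1) := by
  classical
  have h1 : ∑ i, ∑ j ∈ Finset.univ.erase i, a i j =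
      ∑ F ∈ (Finset.univ : Finset (Fin N × Fin N)) with F.1 ≠ F.2, a F.1 F.2 := by
    rw [Finset.sum_filter, Fintype.sum_prod_type]
    refine Finset.sum_congr rfl fun i _ => ?_
    rw [← Finset.sum_filter]
    refine Finset.sum_congr ?_ fun _ _ => rfl
    ext j
    simp [eq_comm]
  have h2 : ((Finset.univ : Finset (Fin N × Fin N)).filter fun F => F.1 ≠ F.2) =
      I ∪ I.image Prod.swap := by
    ext ⟨i, j⟩
    simp only [Finset.mem_filter, Finset.mem_univ, true_and, Finset.mem_union, Finset.mem_image]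
    constructor
    · intro hij
      rcases hI.2 i j hij with h | h
      · exact Or.inl h.1
      · exact Or.inr ⟨(j, i), h.1, rfl⟩
    · rintro (h | ⟨⟨k, l⟩, h, e⟩) hij
      · exact hI.1 i (by rwa [← hij] at h)
      · obtain ⟨rfl, rfl⟩ := Prod.mk.inj e
        have hij : l = k := hij
        exact hI.1 k (by rwa [hij] at h)
  have h3 : Disjoint I (I.image Prod.swap) := by
    rw [Finset.disjoint_left]
    rintro ⟨i, j⟩ h h'
    obtain ⟨⟨k, l⟩, hkl, e⟩ := Finset.mem_image.1 h'
    obtain ⟨rfl, rfl⟩ := Prod.mk.inj e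
    by_cases hkl' : k = l
    · exact hI.1 k (by rwa [← hkl'] at hkl)
    · rcases hI.2 _ _ hkl' with g | g
      · exact g.2 h
      · exact g.2 hkl
  rw [h1, h2, Finset.sum_union h3, Finset.sum_image fun x _ y _ h => Prod.swap_injective h,
    ← Finset.sum_add_distrib]
  rfl

end MultiPatch

namespace MultiPatch

variable {d N : ℕ} (M : MultiPatch d N)

/-! ### Coercivity -/

theorem h_pos (i : Fin N) : 0 < M.h i := (M.patch i).h_pos

theorem facetInt_nonneg (i j : Fin N) {f : Pt d → ℝ} (hf : ∀ x, 0 ≤ f x) :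
    0 ≤ M.facetInt i j f := integral_nonneg hf

theorem topInt_nonneg (i : Fin N) {f : Pt d → ℝ} (hf : ∀ x, 0 ≤ f x) :
    0 ≤ M.topInt i f := integral_nonneg hf

theorem normSq_nonneg (I : Finset (Fin N × Fin N)) {θ : Fin N → ℝ} (hθ : ∀ i, 0 < θ i)
    {δ₁ δ₂ : ℝ} (hδ₁ : 0 < δ₁) (hδ₂ : 0 < δ₂) (v : Pt d → ℝ) : 0 ≤ M.normSq I θ δ₁ δ₂ v := by
  have hκ : ∀ i, 0 ≤ θ i * M.h i := fun i => mul_nonneg (hθ i).le (M.h_pos i).le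
  refine add_nonneg (add_nonneg (add_nonneg (add_nonneg (add_nonneg ?_ ?_) ?_) ?_) ?_) ?_
  · exact Finset.sum_nonneg fun i _ => add_nonneg (integral_nonneg fun x => by positivity)
      (mul_nonneg (hκ i) (integral_nonneg fun x => by positivity))
  · exact mul_nonneg (by norm_num) (Finset.sum_nonneg fun i _ =>
      M.topInt_nonneg i fun x => by positivity)
  · exact Finset.sum_nonneg fun i _ => mul_nonneg (by linarith [hκ i])
      (M.topInt_nonneg i fun x => by positivity)
  · exact mul_nonneg (by norm_num) (Finset.sum_nonneg fun F _ =>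
      M.facetInt_nonneg _ _ fun x => by positivity)
  · exact Finset.sum_nonneg fun F _ => mul_nonneg (by linarith [hκ F.1])
      (M.facetInt_nonneg _ _ fun x => by positivity)
  · refine Finset.sum_nonneg fun F _ => add_nonneg
      (mul_nonneg (div_nonneg hδ₁.le (M.h_pos _).le) (M.facetInt_nonneg _ _ fun x => by positivity))
      (mul_nonneg ?_ (M.facetInt_nonneg _ _ fun x => by positivity))
    rw [mul_assoc]
    exact mul_nonneg hδ₂.le (hκ _)

/-- The terms on the boundary that come from integration by parts of `-κ ∂_t g · g` are bounded by
the terms of the form on the facets, up to `κ/2` times the full boundary norm of `g`. -/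
theorem sum_boundary_le {I : Finset (Fin N × Fin N)} (hI : IsLabelling I) {κ : Fin N → ℝ}
    (hκ : ∀ i, 0 ≤ κ i)
    (hκI : ∀ i j, (i, j) ∈ I → (M.patch i).surface (M.facet i j) ≠ 0 → κ i ≤ 2 * κ j)
    {E : Type*} [NormedAddCommGroup E] [InnerProductSpace ℝ E] {f : Pt d → E}
    (hf : ∀ i, MemLp ((M.patch i).trace f) ⊤ (M.patch i).surface) :
    ∑ i, κ i / 2 * ∫ x, (M.patch i).nt x * ‖(M.patch i).trace f x‖ ^ 2 ∂(M.patch i).surface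
      + ∑ F ∈ I, κ F.1 / 2 * M.facetInt F.1 F.2 (fun x => ‖M.jumpT F.1 F.2 f x‖ ^ 2) ≤
    ∑ F ∈ I, κ F.1 * M.facetInt F.1 F.2
        (fun x => inner ℝ (M.up F.1 F.2 f x) (M.jumpT F.1 F.2 f x))
      + ∑ i, κ i / 2 * ∫ x, ‖(M.patch i).trace f x‖ ^ 2 ∂(M.patch i).surface := by
  have i1 : ∀ i, Integrable (fun x => (M.patch i).nt x * ‖(M.patch i).trace f x‖ ^ 2)
      (M.patch i).surface := fun i => integrable_mul_norm_sq (M.patch i).memLp_nt (hf i)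
  have i2 : ∀ i, Integrable (fun x => ‖(M.patch i).trace f x‖ ^ 2) (M.patch i).surface :=
    fun i => integrable_norm_sq (hf i)
  have houter : ∀ i, κ i / 2 * ∫ x in M.outerPart i,
        (M.patch i).nt x * ‖(M.patch i).trace f x‖ ^ 2 ∂(M.patch i).surface ≤
      κ i / 2 * ∫ x in M.outerPart i, ‖(M.patch i).trace f x‖ ^ 2 ∂(M.patch i).surface := by
    intro i
    refine mul_le_mul_of_nonneg_left (integral_mono (i1 i).integrableOn (i2 i).integrableOn
      fun x => ?_) (by linarith [hκ i])
    exact mul_le_of_le_one_left (by positivity)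
      ((le_abs_self _).trans ((M.patch i).abs_nt_le x))
  simp only [fun i => M.integral_surface_eq_sum (i1 i), fun i => M.integral_surface_eq_sum (i2 i),
    mul_add, Finset.mul_sum, Finset.sum_add_distrib]
  rw [sum_offDiag_eq_sum_labelling hI, sum_offDiag_eq_sum_labelling hI]
  have hfac : ∑ F ∈ I, (κ F.1 / 2 * M.facetInt F.1 F.2 (fun x => (M.patch F.1).nt x *
          ‖(M.patch F.1).trace f x‖ ^ 2)
        + κ F.2 / 2 * M.facetInt F.2 F.1 (fun x => (M.patch F.2).nt x *
          ‖(M.patch F.2).trace f x‖ ^ 2))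
      + ∑ F ∈ I, κ F.1 / 2 * M.facetInt F.1 F.2 (fun x => ‖M.jumpT F.1 F.2 f x‖ ^ 2) ≤
      ∑ F ∈ I, κ F.1 * M.facetInt F.1 F.2
        (fun x => inner ℝ (M.up F.1 F.2 f x) (M.jumpT F.1 F.2 f x))
      + ∑ F ∈ I, (κ F.1 / 2 * M.facetInt F.1 F.2 (fun x => ‖(M.patch F.1).trace f x‖ ^ 2)
        + κ F.2 / 2 * M.facetInt F.2 F.1 (fun x => ‖(M.patch F.2).trace f x‖ ^ 2)) := by
    rw [← Finset.sum_add_distrib, ← Finset.sum_add_distrib]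
    refine Finset.sum_le_sum fun F hF => ?_
    have hne : F.1 ≠ F.2 := fun h => hI.1 F.1 (by
      have : (F.1, F.1) = F := Prod.ext rfl h
      rwa [this])
    have h1 := M.facet_weighted_estimate hne (hκ F.1) (hκI F.1 F.2 hF) (hf F.1) (hf F.2)
    have h2 : 0 ≤ κ F.1 / 2 * M.facetInt F.1 F.2 (fun x => ‖(M.patch F.1).trace f x‖ ^ 2) :=
      mul_nonneg (by linarith [hκ F.1]) (M.facetInt_nonneg _ _ fun x => by positivity)
    linarith
  have hout := Finset.sum_le_sum fun i (_ : i ∈ Finset.univ) => houter i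
  linarith

/-- For a discrete function that vanishes on the bottom and on the lateral boundary, the boundary
terms that come from integration by parts of `-v ∂_t v` are bounded by the terms of the form on the
facets and on the top. -/
theorem sum_boundary_scalar_le {I : Finset (Fin N × Fin N)} (hI : IsLabelling I) {v : Pt d → ℝ}
    (hv : ∀ i, MemLp ((M.patch i).trace v) ⊤ (M.patch i).surface)
    (h0 : ∀ i, ∀ᵐ x ∂(M.patch i).surface.restrict (M.lateral ∪ M.bottom),
      (M.patch i).trace v x = 0) :
    ∑ i, 1 / 2 * ∫ x, (M.patch i).nt x * (M.patch i).trace v x ^ 2 ∂(M.patch i).surface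
      + ∑ F ∈ I, 1 / 2 * M.facetInt F.1 F.2 (fun x => M.jumpT F.1 F.2 v x ^ 2) ≤
    ∑ F ∈ I, M.facetInt F.1 F.2 (fun x => M.up F.1 F.2 v x * M.jumpT F.1 F.2 v x)
      + ∑ i, 1 / 2 * M.topInt i (fun x => (M.patch i).trace v x ^ 2) := by
  have i1 : ∀ i, Integrable (fun x => (M.patch i).nt x * (M.patch i).trace v x ^ 2)
      (M.patch i).surface := fun i => by
    simpa using integrable_mul_norm_sq (M.patch i).memLp_nt (hv i)
  simp only [fun i => M.integral_surface_eq_sum (i1 i), mul_add, Finset.mul_sum,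
    Finset.sum_add_distrib]
  rw [sum_offDiag_eq_sum_labelling hI]
  have hfac : ∑ F ∈ I, (1 / 2 * M.facetInt F.1 F.2 (fun x => (M.patch F.1).nt x *
          (M.patch F.1).trace v x ^ 2)
        + 1 / 2 * M.facetInt F.2 F.1 (fun x => (M.patch F.2).nt x *
          (M.patch F.2).trace v x ^ 2))
      + ∑ F ∈ I, 1 / 2 * M.facetInt F.1 F.2 (fun x => M.jumpT F.1 F.2 v x ^ 2) ≤
      ∑ F ∈ I, M.facetInt F.1 F.2 (fun x => M.up F.1 F.2 v x * M.jumpT F.1 F.2 v x) := by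
    rw [← Finset.sum_add_distrib]
    refine Finset.sum_le_sum fun F hF => ?_
    have hne : F.1 ≠ F.2 := fun h => hI.1 F.1 (by
      have : (F.1, F.1) = F := Prod.ext rfl h
      rwa [this])
    have h1 := M.facet_upwind_estimate hne (hv F.1) (hv F.2)
    simpa [mul_comm] using h1
  have hout := Finset.sum_le_sum fun i (_ : i ∈ Finset.univ) =>
    mul_le_mul_of_nonneg_left (M.outerPart_le_topInt (hv i) (h0 i))
      (show (0 : ℝ) ≤ 1 / 2 by norm_num)
  linarith

theorem memLp_jumpX {i j : Fin N} (hij : i ≠ j) {f : Pt d → ℝ}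
    (hi : MemLp ((M.patch i).trace f) ⊤ (M.patch i).surface)
    (hj : MemLp ((M.patch j).trace f) ⊤ (M.patch j).surface) :
    MemLp (M.jumpX i j f) ⊤ ((M.patch i).surface.restrict (M.facet i j)) :=
  (((M.patch i).memLp_nx.restrict _).smul (hi.restrict _)).add
    ((M.memLp_facet hij (M.patch j).memLp_nx).smul (M.memLp_facet hij hj))

/-- The absorption of the boundary norm of the spatial gradient, by the inverse inequality and the
bound on `θ`. -/
theorem absorb_boundary_gradient {C Cq : ℝ} (hC : 0 < C) (hCq : 1 ≤ Cq) (hinv : M.InverseConst C)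
    {θ : Fin N → ℝ} (hθ : ∀ i, 0 < θ i ∧ θ i ≤ (C * Cq)⁻¹) {v : Pt d → ℝ} (i : Fin N)
    (hv : v ∈ (M.patch i).space) :
    θ i * M.h i / 2 * ∫ x, ‖(M.patch i).trace (gradX v) x‖ ^ 2 ∂(M.patch i).surface ≤
      1 / 2 * ∫ x in (M.patch i).dom, ‖gradX v x‖ ^ 2 := by
  have hh := M.h_pos i
  have hX : 0 ≤ ∫ x in (M.patch i).dom, ‖gradX v x‖ ^ 2 := integral_nonneg fun x => by positivity
  have hθC : θ i * C ≤ 1 := by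
    have h1 : θ i * (C * Cq) ≤ 1 := by
      have := mul_le_mul_of_nonneg_right (hθ i).2 (show 0 ≤ C * Cq by positivity)
      rwa [inv_mul_cancel₀ (by positivity)] at this
    have h2 : θ i * C ≤ θ i * (C * Cq) :=
      mul_le_mul_of_nonneg_left (le_mul_of_one_le_right hC.le hCq) (hθ i).1.le
    exact h2.trans h1
  have hκ : 0 ≤ θ i * M.h i / 2 := by have := (hθ i).1; positivity
  calc _ ≤ θ i * M.h i / 2 * (C * (M.h i)⁻¹ * ∫ x in (M.patch i).dom, ‖gradX v x‖ ^ 2) :=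
        mul_le_mul_of_nonneg_left (hinv i v hv).2 hκ
    _ = 1 / 2 * (θ i * C * ∫ x in (M.patch i).dom, ‖gradX v x‖ ^ 2) := by
        field_simp
    _ ≤ _ := by
        have := mul_le_of_le_one_left hX hθC
        linarith

/-- Coercivity of the bilinear form. -/
theorem half_normSq_le_aForm {C Cq : ℝ} (hC : 0 < C) (hCq : 1 ≤ Cq) (hinv : M.InverseConst C)
    {θ : Fin N → ℝ} (hθ : ∀ i, 0 < θ i ∧ θ i ≤ (C * Cq)⁻¹) {δ₁ δ₂ : ℝ} (hδ₁ : 0 < δ₁)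
    (hδ₂ : 0 < δ₂) {I : Finset (Fin N × Fin N)} (hI : IsLabelling I)
    (hκI : ∀ i j, (i, j) ∈ I → (M.patch i).surface (M.facet i j) ≠ 0 →
      θ i * M.h i ≤ 2 * (θ j * M.h j))
    {v : Pt d → ℝ} (hv : v ∈ M.V0) :
    1 / 2 * M.normSq I θ δ₁ δ₂ v ≤ M.aForm I θ δ₁ δ₂ v v := by
  choose c hc using fun i => Patch.exists_coeff (hv i).1
  have hκ : ∀ i, 0 ≤ θ i * M.h i := fun i => mul_nonneg (hθ i).1.le (M.h_pos i).le
  have mv := fun i => Patch.memLp_trace (hc i)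
  have mg := fun i => Patch.memLp_trace_gradX (hc i)
  have mt := fun i => Patch.memLp_trace_dt (hc i)
  have hvol := fun i => Patch.integral_volume_terms (hc i) (θ i * M.h i)
  have hb1 := M.sum_boundary_scalar_le hI mv fun i => (hv i).2
  have hb2 := M.sum_boundary_le hI hκ hκI mg
  have hab := Finset.sum_le_sum fun i (_ : i ∈ Finset.univ) =>
    M.absorb_boundary_gradient hC hCq hinv hθ i (hv i).1
  have hstab : ∀ F ∈ I, M.facetInt F.1 F.2 (fun x =>
        δ₁ / M.h F.1 * inner ℝ (M.jumpX F.1 F.2 v x) (M.jumpX F.1 F.2 v x)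
        + δ₂ * θ F.1 * M.h F.1 *
          inner ℝ (M.jumpX F.1 F.2 (dt v) x) (M.jumpX F.1 F.2 (dt v) x)) =
      δ₁ / M.h F.1 * (M.facetInt F.1 F.2 fun x => ‖M.jumpX F.1 F.2 v x‖ ^ 2)
        + δ₂ * θ F.1 * M.h F.1 *
          M.facetInt F.1 F.2 fun x => ‖M.jumpX F.1 F.2 (dt v) x‖ ^ 2 := by
    intro F hF
    have hne : F.1 ≠ F.2 := fun h => hI.1 F.1 (by
      have : (F.1, F.1) = F := Prod.ext rfl h
      rwa [this])
    simp only [facetInt, real_inner_self_eq_norm_sq]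
    rw [integral_add ((integrable_norm_sq (M.memLp_jumpX hne (mv F.1) (mv F.2))).const_mul _)
      ((integrable_norm_sq (M.memLp_jumpX hne (mt F.1) (mt F.2))).const_mul _),
      integral_const_mul, integral_const_mul]
  have hskew : ∀ a b : Sp d, -inner ℝ a b + inner ℝ a b = (0 : ℝ) := fun a b => by ring
  have hzero : ∀ i j, M.facetInt i j (fun _ => 0) = 0 := fun i j => by simp [facetInt]
  have hsq : ∀ i, (M.topInt i fun x => (M.patch i).trace v x * (M.patch i).trace v x) =
      M.topInt i fun x => (M.patch i).trace v x ^ 2 := fun i => by simp only [pow_two]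
  unfold aForm normSq
  -- First the volume and the stabilization terms, before simplification changes their shape. The
  -- consistency terms cancel afterwards, by `hskew`.
  simp only [hvol, Finset.sum_congr rfl hstab]
  simp only [hskew, hzero, hsq, real_inner_self_eq_norm_sq,
    Finset.sum_const_zero, mul_zero, add_zero, Finset.sum_add_distrib, Finset.sum_sub_distrib]
  simp only [← Finset.mul_sum] at hb1 hab ⊢
  have p1 : 0 ≤ ∑ i, θ i * M.h i * ∫ x in (M.patch i).dom, dt v x ^ 2 :=
    Finset.sum_nonneg fun i _ => mul_nonneg (hκ i) (integral_nonneg fun x => by positivity)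
  have p2 : 0 ≤ ∑ i, M.topInt i fun x => (M.patch i).trace v x ^ 2 :=
    Finset.sum_nonneg fun i _ => M.topInt_nonneg i fun x => by positivity
  have p3 : 0 ≤ ∑ i, θ i * M.h i * M.topInt i fun x => ‖(M.patch i).trace (gradX v) x‖ ^ 2 :=
    Finset.sum_nonneg fun i _ => mul_nonneg (hκ i) (M.topInt_nonneg i fun x => by positivity)
  have p3' : ∑ i, θ i * M.h i / 2 * (M.topInt i fun x => ‖(M.patch i).trace (gradX v) x‖ ^ 2) =
      1 / 2 * ∑ i, θ i * M.h i * M.topInt i fun x => ‖(M.patch i).trace (gradX v) x‖ ^ 2 := by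
    rw [Finset.mul_sum]
    exact Finset.sum_congr rfl fun i _ => by ring
  have p4 : 0 ≤ ∑ F ∈ I, M.facetInt F.1 F.2 fun x => M.jumpT F.1 F.2 v x ^ 2 :=
    Finset.sum_nonneg fun F _ => M.facetInt_nonneg _ _ fun x => by positivity
  have p5 : 0 ≤ ∑ F ∈ I, θ F.1 * M.h F.1 / 2 *
      M.facetInt F.1 F.2 fun x => ‖M.jumpT F.1 F.2 (gradX v) x‖ ^ 2 :=
    Finset.sum_nonneg fun F _ => mul_nonneg (by linarith [hκ F.1])
      (M.facetInt_nonneg _ _ fun x => by positivity)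
  have p6 : 0 ≤ ∑ F ∈ I, δ₁ / M.h F.1 *
      M.facetInt F.1 F.2 fun x => ‖M.jumpX F.1 F.2 v x‖ ^ 2 :=
    Finset.sum_nonneg fun F _ => mul_nonneg (div_nonneg hδ₁.le (M.h_pos _).le)
      (M.facetInt_nonneg _ _ fun x => by positivity)
  have p7 : 0 ≤ ∑ F ∈ I, δ₂ * θ F.1 * M.h F.1 *
      M.facetInt F.1 F.2 fun x => ‖M.jumpX F.1 F.2 (dt v) x‖ ^ 2 :=
    Finset.sum_nonneg fun F _ => mul_nonneg
      (by rw [mul_assoc]; exact mul_nonneg hδ₂.le (hκ _))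
      (M.facetInt_nonneg _ _ fun x => by positivity)
  rw [p3']
  linarith

end MultiPatch

end SpaceTimeIgA

end

theorem lemma4 {d N : ℕ} (hd : 1 ≤ d) (M : SpaceTimeIgA.MultiPatch d N)
    (Cq : ℝ) (hCq : 1 ≤ Cq) (hquasi : M.QuasiUniform Cq) :
    (∃ Cinv : ℝ, 0 < Cinv ∧ M.InverseConst Cinv) ∧
    ∀ Cinv : ℝ, 0 < Cinv → M.InverseConst Cinv →
    ∀ θ : Fin N → ℝ, (∀ i, 0 < θ i ∧ θ i ≤ (Cinv * Cq)⁻¹) →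
    ∀ δ₁ δ₂ : ℝ, 0 < δ₁ → 0 < δ₂ →
    ∀ I : Finset (Fin N × Fin N), SpaceTimeIgA.MultiPatch.IsLabelling I →
    (∀ i j, (i, j) ∈ I → (M.patch i).surface (M.facet i j) ≠ 0 → θ i * M.h i ≤ 2 * (θ j * M.h j)) →
    ∀ v ∈ M.V0, 1 / 2 * M.dgNorm I θ δ₁ δ₂ v ^ 2 ≤ M.aForm I θ δ₁ δ₂ v v := by
  refine ⟨M.exists_inverseConst, fun C hC hinv θ hθ δ₁ δ₂ hδ₁ hδ₂ I hI hκI v hv => ?_⟩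
  rw [SpaceTimeIgA.MultiPatch.dgNorm,
    Real.sq_sqrt (M.normSq_nonneg I (fun i => (hθ i).1) hδ₁ hδ₂ v)]
  exact M.half_normSq_le_aForm hC hCq hinv hθ hδ₁ hδ₂ hI hκI hv
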